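/- Let $\alpha\ge 1$ and $n\ge 2$ be integers and let $X_1,\dots,X_n$ be independent random variables with the gamma density $g_\alpha(x)=x^{\alpha-1}e^{-x}/\Gamma(\alpha)$, $x>0$. Write $G_a(x)=\int_0^x g_a(\xi)\,d\xi$ for the gamma distribution function of order $a>0$, let $S=\big((n-1)^{-1}\sum_i (X_i-\bar X)^2\big)^{1/2}$ be the sample standard deviation, and let $\Phi$ be the angle between $(X_1,\dots,X_n)$ and $(1,\dots,1)$ in $\mathbb R^n$. Put $\varphi_n=\arctan(1/\sqrt{n-1})$, $N=\lfloor(\alpha-1)n/2\rfloor$, $\bar{\mathcal E}(f(\Phi))=\mathcal E\big(f(\Phi)\mathbf 1_{\{\Phi\ge\varphi_n\}}\big)$, and for $k\ge 0$, $\lambda>0$ $$\gamma_k=\mathcal E\big((\cos\Phi)^{\alpha n+k}\big),\quad \bar\gamma_k=\bar{\mathcal E}\big((\cos\Phi)^{\alpha n+k}\big),\quad \bar M_k=\bar{\mathcal E}\big((\cot\Phi)^{\alpha n+k}\big),$$ $$\bar M_{k,\lambda}=\bar{\mathcal E}\big((\lambda^{-1}\sqrt n\cot\Phi)^{\alpha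 n+k}\big),\quad \bar\Delta_{k,\lambda}=\sum_{\ell=0}^k(-1)^\ell\binom k\ell\bar M_{\ell,\lambda},\quad P_{\alpha n,k}(x)=\sum_{j=0}^{\lfloor k/2\rfloor}\binom{(\alpha n+k)/2}{j}\frac{x^{k-2j}}{(k-2j)!}.$$ **Coefficients.** With $\beta=\lfloor\alpha/2\rfloor$, the linear equations, for $m=0,\dots,N$, $$\sum_{j=0}^{N}\Gamma\big(\tfrac12+\beta n+m-j\big)\,\Gamma\big(\tfrac{n-1}2+j\big)\,a_{2j}=\begin{cases}\displaystyle 2\,\frac{(2m)!}{n^m}\sum_{m_1+\dots+m_n=m}\ \prod_{i=1}^n\frac{\Gamma(\frac12+\beta+m_i)}{(2m_i)!},&\alpha=2\beta+1,\\[3ex]\displaystyle 2\,\frac{(2m+n)!}{n^{m+n/2}}\sum_{m_1+\dots+m_n=m}\ \prod_{i=1}^n\frac{\Gamma(\frac12+\beta+m_i)}{(2m_i+1)!},&\alpha=2\beta,\end{cases}$$ have a unique solution $(a_0,a_2,\dots,a_{2N})$. With $C=\dfrac{\Gamma(\alpha n)}{\Gamma(\alpha)^n n^{\alpha n/2}}$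 put $$w(t)=C\sum_{j=0}^N a_{2j}\,t^{n-2+2j},\qquad W(t)=C\sum_{j=0}^N a_{2j}\,\frac{t^{n-1+2j}}{n-1+2j}=\int_0^t w(s)\,ds .$$ Then $\Pr\{\tan\Phi\le t\}=W(t)$ for $0\le t\le 1/\sqrt{n-1}$. **Truncated moments.** With $B(p,q;x)=\int_0^x t^{p-1}(1-t)^{q-1}dt$, for every $k\ge0$, $$\bar\gamma_k=\gamma_k-\frac C2\sum_{j=0}^N a_{2j}\,B\Big(\tfrac{n-1}2+j,\ \tfrac{(\alpha-1)n+k+1}2-j;\ \tfrac1n\Big),\qquad \bar M_k=\sum_{j=0}^\infty\binom{(\alpha n+k)/2+j-1}{j}\bar\gamma_{k+2j}.$$ **Distribution of $S$.** For every $r\ge0$ all series and integrals below converge absolutely, and $$\Pr\{\sqrt{n-1}\,S\le r\}=\frac{(r\sqrt n)^{\alpha n}}{\Gamma(\alpha n)}\sum_{k=0}^\infty(-1)^k\frac{\bar\gamma_k}{\alpha n+k}P_{\alpha n,k}(r\sqrt n)+\int_0^{1/\sqrt{n-1}}G_{\alpha n}(r\sqrt n/t)\,w(t)\,dt,\tag{4g}$$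 $$\Pr\{\sqrt{n-1}\,S\le r\}=\frac{(r\sqrt n)^{\alpha n}}{\Gamma(\alpha n)}\sum_{k=0}^\infty\frac{\bar M_k}{\alpha n+k}\frac{(-r\sqrt n)^k}{k!}+W\Big(\tfrac1{\sqrt{n-1}}\Big)G_{\alpha n}\big(r\sqrt{n(n-1)}\big)+\int_{r\sqrt{n(n-1)}}^\infty g_{\alpha n}(x)\,W(r\sqrt n/x)\,dx,\tag{4h}$$ and for every $\lambda>0$ the first summand of (4h), the one with the infinite series, equals $$\sum_{k=0}^\infty\bar\Delta_{k,\lambda}\binom{\alpha n+k-1}{k}G_{\alpha n+k}(\lambda r).\tag{4i}$$ **The choice $\lambda=\sqrt{n(n-1)}$.** For this $\lambda$ all $\bar\Delta_{k,\lambda}$ are nonnegative, all are positive if $n\ge3$, and $\sum_{k}\bar\Delta_{k,\lambda}\binom{\alpha n+k-1}{k}=1-W(1/\sqrt{n-1})$. If moreover $\alpha=1$, put $p=\dfrac{(n-1)!\,b_{n-1}}{\sqrt n\,(n(n-1))^{(n-1)/2}}>0$, where $b_{n-1}=\pi^{(n-1)/2}/\Gamma(\frac{n+1}2)$; then for every $r\ge0$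 $$\Pr\{\sqrt{n-1}\,S\le r\}=p\,G_{n-1}(\lambda r)+\sum_{k=0}^\infty\bar\Delta_{k,\lambda}\binom{n+k-1}{k}G_{n+k}(\lambda r),\qquad p+\sum_{k=0}^\infty\bar\Delta_{k,\lambda}\binom{n+k-1}{k}=1,$$ which is a probability mixture of gamma distribution functions. -/

import Mathlib

open MeasureTheory ProbabilityTheory
open scoped Nat

noncomputable section

namespace GammaVariance

/-! ### The gamma density and distribution function of order `a` (unit scale) -/

/-- The gamma density `g_a(x) = x^(a-1) e^(-x) / Γ(a)`, used for `x ≥ 0`. -/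
def gPdf (a x : ℝ) : ℝ := x ^ (a - 1) * Real.exp (-x) / Real.Gamma a

/-- The gamma distribution function `G_a(x) = ∫_0^x g_a(ξ) dξ`, used for `x ≥ 0`. -/
def gCdf (a x : ℝ) : ℝ := ∫ ξ in (0 : ℝ)..x, gPdf a ξ

/-! ### Sample variance, and the angle between the sample and the diagonal -/

section Sample

variable {Ω : Type*} {n : ℕ}

def sampleMean (X : Fin n → Ω → ℝ) (ω : Ω) : ℝ := (∑ i, X i ω) / n

/-- `S² = (n-1)⁻¹ ∑ (X_i - X̄)²`. -/
def sampleVar (X : Fin n → Ω → ℝ) (ω : Ω) : ℝ :=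
  (∑ i, (X i ω - sampleMean X ω) ^ 2) / ((n : ℝ) - 1)

/-- The sample standard deviation `S`. -/
def sampleStd (X : Fin n → Ω → ℝ) (ω : Ω) : ℝ := Real.sqrt (sampleVar X ω)

/-- `Φ`, the angle between `(X_1, …, X_n)` and `(1, …, 1)` in Euclidean space. -/
def phi (X : Fin n → Ω → ℝ) (ω : Ω) : ℝ :=
  InnerProductGeometry.angle
    (WithLp.toLp 2 (fun i => X i ω) : EuclideanSpace ℝ (Fin n))
    (WithLp.toLp 2 (fun _ => (1 : ℝ)) : EuclideanSpace ℝ (Fin n))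

end Sample

/-- `tan φ_n = 1 / √(n-1)`. -/
def splitTan (n : ℕ) : ℝ := 1 / Real.sqrt ((n : ℝ) - 1)

/-- The angle `φ_n = arctan (1 / √(n-1))` at which the domain of `Φ` is split. -/
def splitAngle (n : ℕ) : ℝ := Real.arctan (splitTan n)

section Moments

variable {Ω : Type*} [MeasurableSpace Ω] {n : ℕ}

/-- The truncated expectation `Ē(f(Φ))`: integration over `Φ ≥ φ_n` only. -/
def truncExp (μ : Measure Ω) (X : Fin n → Ω → ℝ) (f : ℝ → ℝ) : ℝ :=
  ∫ ω in {ω | splitAngle n ≤ phi X ω}, f (phi X ω) ∂μ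

/-- `γ_{α,n,k} = E((cos Φ)^(αn+k))`. -/
def cosMoment (α : ℕ) (μ : Measure Ω) (X : Fin n → Ω → ℝ) (k : ℕ) : ℝ :=
  ∫ ω, Real.cos (phi X ω) ^ (α * n + k) ∂μ

/-- `γ̄_{α,n,k} = Ē((cos Φ)^(αn+k))`. -/
def cosMomentBar (α : ℕ) (μ : Measure Ω) (X : Fin n → Ω → ℝ) (k : ℕ) : ℝ :=
  truncExp μ X (fun θ => Real.cos θ ^ (α * n + k))

/-- `M̄_{α,n,k} = Ē((cot Φ)^(αn+k))`. -/
def cotMomentBar (α : ℕ) (μ : Measure Ω) (X : Fin n → Ω → ℝ) (k : ℕ) : ℝ :=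
  truncExp μ X (fun θ => Real.cot θ ^ (α * n + k))

/-- `M̄_{α,n,k,l} = Ē((l⁻¹ √n cot Φ)^(αn+k))` for a scale factor `l`. -/
def scaledCotMomentBar (α : ℕ) (μ : Measure Ω) (X : Fin n → Ω → ℝ) (l : ℝ) (k : ℕ) : ℝ :=
  truncExp μ X (fun θ => (l⁻¹ * Real.sqrt n * Real.cot θ) ^ (α * n + k))

/-- The alternating `k`-th order difference `Δ̄_{α,n,k,l}` of the scaled moments. -/
def deltaBar (α : ℕ) (μ : Measure Ω) (X : Fin n → Ω → ℝ) (l : ℝ) (k : ℕ) : ℝ :=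
  ∑ i ∈ Finset.range (k + 1), (-1 : ℝ) ^ i * (k.choose i : ℝ) * scaledCotMomentBar α μ X l i

end Moments

/-! ### The polynomial distribution function and density of `tan Φ` on `[0, 1/√(n-1)]` -/

/-- `[(α-1)n/2]`. -/
def degBound (α n : ℕ) : ℕ := (α - 1) * n / 2

/-- The right-hand sides of the linear equations for the coefficients; the natural number `α / 2`
is `β`, where `α = 2β + 1` or `α = 2β`, and the sums run over all `(m_1, …, m_n)` with sum `m`. -/
def coeffRhs (α n m : ℕ) : ℝ :=
  if Odd α then
    2 * ((2 * m)! : ℝ) / (n : ℝ) ^ m *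
      ∑ c ∈ Finset.piAntidiag (Finset.univ : Finset (Fin n)) m,
        ∏ i, Real.Gamma (1 / 2 + ((α / 2 : ℕ) : ℝ) + (c i : ℝ)) / ((2 * c i)! : ℝ)
  else
    2 * ((2 * m + n)! : ℝ) / (n : ℝ) ^ ((m : ℝ) + (n : ℝ) / 2) *
      ∑ c ∈ Finset.piAntidiag (Finset.univ : Finset (Fin n)) m,
        ∏ i, Real.Gamma (1 / 2 + ((α / 2 : ℕ) : ℝ) + (c i : ℝ)) / ((2 * c i + 1)! : ℝ)

/-- `a j` stands for `a_{α,n,2j}`: the linear equations that determine these coefficients. -/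
def IsCoeff (α n : ℕ) (a : Fin (degBound α n + 1) → ℝ) : Prop :=
  ∀ m : ℕ, m ≤ degBound α n →
    ∑ j : Fin (degBound α n + 1),
      Real.Gamma (1 / 2 + ((α / 2 : ℕ) : ℝ) * n + m - (j : ℕ)) *
        Real.Gamma (((n : ℝ) - 1) / 2 + (j : ℕ)) * a j = coeffRhs α n m

/-- `Γ(αn) / (Γ(α)^n n^(αn/2))`. -/
def normConst (α n : ℕ) : ℝ :=
  Real.Gamma ((α : ℝ) * n) / (Real.Gamma (α : ℝ) ^ n * (n : ℝ) ^ ((α : ℝ) * n / 2))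

/-- The polynomial `W_{α,n}(t)` with coefficients built from `a`. -/
def polyW (α n : ℕ) (a : Fin (degBound α n + 1) → ℝ) (t : ℝ) : ℝ :=
  normConst α n * ∑ j : Fin (degBound α n + 1),
    a j * (t ^ (n - 1 + 2 * (j : ℕ)) / ((n : ℝ) - 1 + 2 * (j : ℕ)))

/-- The derivative `w_{α,n}(t)` of the polynomial `W_{α,n}(t)`. -/
def polyw (α n : ℕ) (a : Fin (degBound α n + 1) → ℝ) (t : ℝ) : ℝ :=
  normConst α n * ∑ j : Fin (degBound α n + 1), a j * t ^ (n - 2 + 2 * (j : ℕ))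

/-- The incomplete beta function `B(p,q;x) = ∫_0^x t^(p-1) (1-t)^(q-1) dt`. -/
def incBeta (p q x : ℝ) : ℝ := ∫ t in (0 : ℝ)..x, t ^ (p - 1) * (1 - t) ^ (q - 1)

/-- The polynomials `P_{N,k}(x) = ∑_{j ≤ k/2} binom((N+k)/2, j) x^(k-2j) / (k-2j)!`. -/
def polyP (N k : ℕ) (x : ℝ) : ℝ :=
  ∑ j ∈ Finset.range (k / 2 + 1),
    Ring.choose (((N : ℝ) + k) / 2) j * x ^ (k - 2 * j) / ((k - 2 * j)! : ℝ)

/-- The volume `b_d = π^(d/2) / Γ(d/2 + 1)` of the `d`-dimensional unit ball. -/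
def ballVol (d : ℕ) : ℝ := Real.pi ^ ((d : ℝ) / 2) / Real.Gamma ((d : ℝ) / 2 + 1)

/-- The weight `(n-1)! b_{n-1} / (√n (n(n-1))^((n-1)/2))`. -/
def expWeight (n : ℕ) : ℝ :=
  ((n - 1)! : ℝ) * ballVol (n - 1) /
    (Real.sqrt n * ((n : ℝ) * ((n : ℝ) - 1)) ^ (((n : ℝ) - 1) / 2))

end GammaVariance

end

open GammaVariance

namespace GammaVariance

open Real Set Filter

/-! ### Gamma densities and distribution functions of integral order -/

/-! Write a sample as `x = s(1 + z)` with mean `s` and `z` in the hyperplane of coordinate sum zero.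
The joint gamma density factors into a function of `s` times `∏ (1 + z_i)^(α-1)` on the simplex `1 +
z_i ≥ 0` (`sampleDens_slice`), so the sum of the sample is gamma of order `αn` and independent of
the direction `z`. Since `tan Φ = |z|/√n` and `√(n-1) S = s|z|`, the distribution function of
`√(n-1) S` at `r` is the expectation of `G_{αn}(r√n cot Φ)` (`sampleLaw_sqrt_devSq_le`,
`measureReal_sampleStd_le`). Everything else evaluates this expectation, split at `tan Φ =
1/√(n-1)`.

Below the split, the ball `|z| ≤ √n t` lies inside the simplex. The probability of `tan Φ ≤ t` is
then the integral of a polynomial over a ball; its homogeneous components scale like powers of `t`,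
and the odd ones integrate to zero (`sampleLaw_tan_le_eq_polyW`). The coefficients satisfy the
linear equations because the integral of `∏ x_i^(α-1) (∑ x_i)^p exp(-|x|²)` over `ℝⁿ` can be
computed coordinatewise and along the slices (`gaussMoment_eq_sum`, `gaussMoment_eq_angleCoeff`).
They are unique because the matrix is, after reversal of one index, a Hankel matrix of moments of a
gamma weight (`eq_zero_of_sum_gamma_eq_zero`).

Above the split, `cot Φ` lies between `1/√(n-1)` and `√(n-1)`, so series may be integrated termwise.
The power series of `G_{αn}` gives moments of `cot Φ`; expanding each power of `cot` in powers of
`cos` and regrouping gives moments of `cos Φ`; expanding `G_{αn}(uy)` in gamma distribution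
functions at `y` (`hasSum_gCdf_scale`) gives the differences of scaled moments. With scale
`√(n(n-1))` the factor `u = cot Φ / √(n-1)` lies in `(0, 1]`, so the weights `u^N (1-u)^k` are
nonnegative and the negative binomial series yields their total mass. For `α = 1` the polynomial is
a monomial and the lower part collapses to a multiple of `G_{n-1}` (`exponential_remainder`). -/

lemma gPdf_natCast {N : ℕ} (hN : 1 ≤ N) (x : ℝ) :
    gPdf N x = x ^ (N - 1) * Real.exp (-x) / Real.Gamma N := by
  rw [gPdf, ← Nat.cast_one, ← Nat.cast_sub hN, Real.rpow_natCast]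

/-- With a natural exponent the formula is continuous on all of `ℝ`, so the substitutions below need
no sign conditions. -/
lemma continuous_gPdf {N : ℕ} (hN : 1 ≤ N) : Continuous (gPdf N) := by
  rw [funext (gPdf_natCast hN)]
  fun_prop

lemma gPdf_nonneg (N : ℕ) {x : ℝ} (hx : 0 ≤ x) : 0 ≤ gPdf N x :=
  div_nonneg (mul_nonneg (Real.rpow_nonneg hx _) (Real.exp_pos _).le)
    (Real.Gamma_nonneg_of_nonneg N.cast_nonneg)

lemma continuous_gCdf {N : ℕ} (hN : 1 ≤ N) : Continuous (gCdf N) :=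
  intervalIntegral.continuous_primitive (fun _ _ => (continuous_gPdf hN).intervalIntegrable _ _) 0

lemma gamma_natCast_pos {N : ℕ} (hN : 1 ≤ N) : 0 < Real.Gamma N :=
  Real.Gamma_pos_of_pos (by exact_mod_cast hN)

lemma integrableOn_gPdf {N : ℕ} (hN : 1 ≤ N) : IntegrableOn (gPdf N) (Ioi 0) := by
  have h := (Real.GammaIntegral_convergent (s := N) (by exact_mod_cast hN)).div_const (Real.Gamma N)
  refine (integrableOn_congr_fun (fun x _ => ?_) measurableSet_Ioi).1 h
  simp only [gPdf]; ring

lemma integral_gPdf {N : ℕ} (hN : 1 ≤ N) : ∫ x in Ioi 0, gPdf N x = 1 := by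
  have h : ∀ x, gPdf N x = Real.exp (-x) * x ^ ((N : ℝ) - 1) / Real.Gamma N := fun x => by
    simp only [gPdf]; ring
  simp_rw [h]
  rw [integral_div, ← Real.Gamma_eq_integral (by exact_mod_cast hN),
    div_self (gamma_natCast_pos hN).ne']

lemma gCdf_eq_setIntegral (N : ℕ) {x : ℝ} (hx : 0 ≤ x) :
    gCdf N x = ∫ ξ in Ioc 0 x, gPdf N ξ :=
  intervalIntegral.integral_of_le hx

lemma gCdf_nonneg (N : ℕ) {x : ℝ} (hx : 0 ≤ x) : 0 ≤ gCdf N x :=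
  intervalIntegral.integral_nonneg hx fun _ h => gPdf_nonneg N h.1

lemma gCdf_le_one {N : ℕ} (hN : 1 ≤ N) {x : ℝ} (hx : 0 ≤ x) : gCdf N x ≤ 1 := by
  rw [gCdf_eq_setIntegral N hx, ← integral_gPdf hN]
  exact setIntegral_mono_set (integrableOn_gPdf hN)
    ((ae_restrict_iff' measurableSet_Ioi).2 (ae_of_all _ fun y hy => gPdf_nonneg N (le_of_lt hy)))
    (Ioc_subset_Ioi_self.eventuallyLE)

/-- Bound the factor `exp(-ξ)` by one. The factorial decay in the order supplies the majorant in
`hasSum_delta_gCdf`. -/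
lemma gCdf_le_pow {N : ℕ} (hN : 1 ≤ N) {x : ℝ} (hx : 0 ≤ x) :
    gCdf N x ≤ x ^ N / N ! := by
  have h1 : gCdf N x ≤ ∫ ξ in (0 : ℝ)..x, ξ ^ (N - 1) / Real.Gamma N := by
    refine intervalIntegral.integral_mono_on hx ((continuous_gPdf hN).intervalIntegrable _ _)
      (Continuous.intervalIntegrable (by fun_prop) _ _) fun y hy => ?_
    rw [gPdf_natCast hN]
    have := gamma_natCast_pos hN
    have h0 := hy.1
    gcongr
    exact mul_le_of_le_one_right (pow_nonneg hy.1 _) (Real.exp_le_one_iff.2 (by linarith))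
  refine h1.trans_eq ?_
  rw [intervalIntegral.integral_div, integral_pow]
  obtain ⟨M, rfl⟩ : ∃ M, N = M + 1 := ⟨N - 1, by omega⟩
  have := Nat.factorial_pos M
  simp only [Nat.add_sub_cancel, Nat.cast_succ, Real.Gamma_nat_eq_factorial, Nat.factorial_succ]
  push_cast
  rw [zero_pow (by omega)]
  field_simp
  simp

/-- The distribution function of order `N + 1` in terms of the one of order `N`. -/
lemma gCdf_succ_add {N : ℕ} (hN : 1 ≤ N) (x : ℝ) :
    gCdf (N + 1 : ℕ) x + x ^ N * Real.exp (-x) / N ! = gCdf N x := by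
  -- The difference of two consecutive gamma densities is an exact derivative.
  have hd : ∀ y ∈ uIcc 0 x, HasDerivAt (fun y : ℝ => y ^ N * Real.exp (-y) / N !)
      (gPdf N y - gPdf (N + 1 : ℕ) y) y := fun y _ => by
    have h := (((hasDerivAt_pow N y).mul (hasDerivAt_neg y).exp).div_const (N ! : ℝ))
    refine h.congr_deriv ?_
    rw [gPdf_natCast hN, gPdf_natCast (by omega)]
    obtain ⟨M, rfl⟩ : ∃ M, N = M + 1 := ⟨N - 1, by omega⟩
    have := Nat.factorial_pos M
    simp only [Nat.add_sub_cancel, Nat.cast_succ, Real.Gamma_nat_eq_factorial,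
      Nat.factorial_succ]
    rw [show ((M : ℝ) + 1 + 1) = ((M + 1 : ℕ) : ℝ) + 1 by push_cast; ring,
      Real.Gamma_nat_eq_factorial, Nat.factorial_succ]
    push_cast
    field_simp
    ring
  have h1 := (continuous_gPdf hN).intervalIntegrable (μ := volume) 0 x
  have h2 := (continuous_gPdf (N := N + 1) (by omega)).intervalIntegrable (μ := volume) 0 x
  have h := intervalIntegral.integral_eq_sub_of_hasDerivAt hd (h1.sub h2)
  rw [intervalIntegral.integral_sub h1 h2, zero_pow (by omega)] at h
  simp only [gCdf]
  linear_combination -h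

lemma hasSum_exp (x : ℝ) : HasSum (fun k : ℕ => x ^ k / k !) (Real.exp x) := by
  rw [Real.exp_eq_exp_ℝ]
  exact NormedSpace.expSeries_div_hasSum_exp x

/-- Termwise integration of the exponential series; `∫ u^(N-1+k)` over `[0, 1]` produces the factor
`1/(N+k)`. By `gCdf_eq_kernel` this integral is `G_N` with its leading power split off. -/
lemma hasSum_gCdf_kernel {N : ℕ} (hN : 1 ≤ N) (x : ℝ) :
    HasSum (fun k : ℕ => (-x) ^ k / k ! / ((N : ℝ) + k))
      (∫ u in (0 : ℝ)..1, u ^ (N - 1) * Real.exp (-(x * u))) := by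
  have h := intervalIntegral.hasSum_integral_of_dominated_convergence (a := 0) (b := 1)
    (μ := volume) (F := fun (k : ℕ) (u : ℝ) => u ^ (N - 1) * ((-(x * u)) ^ k / k !))
    (f := fun u => u ^ (N - 1) * Real.exp (-(x * u))) (fun k _ => |x| ^ k / k !)
    (fun k => by apply Continuous.aestronglyMeasurable; fun_prop)
    (fun k => ae_of_all _ fun u hu => ?_)
    (ae_of_all _ fun u _ => (hasSum_exp _).summable) (by simp)
    (ae_of_all _ fun u _ => (hasSum_exp _).mul_left _)
  · refine h.congr_fun fun k => ?_
    have : ∀ u : ℝ, u ^ (N - 1) * ((-(x * u)) ^ k / k !) = (-x) ^ k / k ! * u ^ (N - 1 + k) :=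
      fun u => by rw [← neg_mul, mul_pow, pow_add]; ring
    simp_rw [this]
    rw [intervalIntegral.integral_const_mul, integral_pow]
    obtain ⟨M, rfl⟩ : ∃ M, N = M + 1 := ⟨N - 1, by omega⟩
    push_cast
    simp only [one_pow]
    rw [zero_pow (by omega)]
    ring
  · rw [uIoc_of_le zero_le_one] at hu
    have h1 : |u| ≤ 1 := abs_le.2 ⟨by linarith [hu.1], hu.2⟩
    rw [norm_mul, norm_div, norm_pow, norm_pow, Real.norm_eq_abs, Real.norm_eq_abs, abs_neg,
      abs_mul,
      RCLike.norm_natCast]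
    calc |u| ^ (N - 1) * ((|x| * |u|) ^ k / k !) ≤ 1 * ((|x| * 1) ^ k / k !) := by
          gcongr
          exact pow_le_one₀ (abs_nonneg _) h1
      _ = _ := by simp

lemma gCdf_eq_kernel {N : ℕ} (hN : 1 ≤ N) (x : ℝ) :
    gCdf N x = x ^ N / Real.Gamma N *
      ∫ u in (0 : ℝ)..1, u ^ (N - 1) * Real.exp (-(x * u)) := by
  have h := intervalIntegral.mul_integral_comp_mul_left (a := 0) (b := 1) (f := gPdf N) (c := x)
  rw [mul_zero, mul_one] at h
  rw [gCdf, ← h, ← intervalIntegral.integral_const_mul, ← intervalIntegral.integral_const_mul]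
  refine intervalIntegral.integral_congr fun u _ => ?_
  simp only [gPdf_natCast hN]
  obtain ⟨M, rfl⟩ : ∃ M, N = M + 1 := ⟨N - 1, by omega⟩
  simp only [Nat.add_sub_cancel]
  ring

lemma choose_eq_factorial_div {N : ℕ} (hN : 1 ≤ N) (k : ℕ) :
    ((N + k - 1).choose k : ℝ) = Real.Gamma (N + k : ℕ) / (k ! * Real.Gamma N) := by
  obtain ⟨M, rfl⟩ : ∃ M, N = M + 1 := ⟨N - 1, by omega⟩
  rw [show M + 1 + k - 1 = M + k by omega, show M + 1 + k = (M + k) + 1 by omega]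
  push_cast
  rw [← Nat.cast_add, Real.Gamma_nat_eq_factorial, Real.Gamma_nat_eq_factorial,
    Nat.cast_choose ℝ (Nat.le_add_left k M), Nat.add_sub_cancel]

/-- A gamma distribution function with changed scale is a series of gamma distribution
functions. -/
lemma hasSum_gCdf_scale {N : ℕ} (hN : 1 ≤ N) (u y : ℝ) :
    HasSum (fun k : ℕ => u ^ N * (1 - u) ^ k * ((N + k - 1).choose k : ℝ) * gCdf (N + k : ℕ) y)
      (gCdf N (u * y)) := by
  -- After the substitution `ξ = ux`, the factor `exp(-ux)` is `exp(-x) exp((1-u)x)`, and only the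
  -- second exponential is expanded. On a bounded interval this converges for every real `u`.
  have h := intervalIntegral.hasSum_integral_of_dominated_convergence (a := 0) (b := y)
    (μ := volume)
    (F := fun (k : ℕ) (x : ℝ) => u ^ N * x ^ (N - 1) * Real.exp (-x) / Real.Gamma N *
      (((1 - u) * x) ^ k / k !))
    (f := fun x => u ^ N * x ^ (N - 1) * Real.exp (-x) / Real.Gamma N * Real.exp ((1 - u) * x))
    (fun k x => |u ^ N * x ^ (N - 1) * Real.exp (-x) / Real.Gamma N| * (|(1 - u) * x| ^ k / k !))
    (fun k => by apply Continuous.aestronglyMeasurable; fun_prop)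
    (fun k => ae_of_all _ fun x _ => by
      rw [norm_mul, norm_div (_ ^ k), norm_pow, Real.norm_eq_abs, Real.norm_eq_abs,
        RCLike.norm_natCast])
    (ae_of_all _ fun u _ => (hasSum_exp _).summable.mul_left _)
    (by
      simp_rw [tsum_mul_left, (hasSum_exp _).tsum_eq]
      apply Continuous.intervalIntegrable
      fun_prop)
    (ae_of_all _ fun u _ => (hasSum_exp _).mul_left _)
  have h2 : gCdf N (u * y) = ∫ x in (0 : ℝ)..y,
      u ^ N * x ^ (N - 1) * Real.exp (-x) / Real.Gamma N * Real.exp ((1 - u) * x) := by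
    have h := intervalIntegral.mul_integral_comp_mul_left (a := 0) (b := y) (f := gPdf N) (c := u)
    rw [mul_zero] at h
    rw [gCdf, ← h, ← intervalIntegral.integral_const_mul]
    refine intervalIntegral.integral_congr fun x _ => ?_
    simp only [gPdf_natCast hN]
    obtain ⟨M, rfl⟩ : ∃ M, N = M + 1 := ⟨N - 1, by omega⟩
    simp only [Nat.add_sub_cancel]
    rw [show -(u * x) = -x + (1 - u) * x by ring, Real.exp_add]
    ring
  rw [h2]
  refine h.congr_fun fun k => ?_
  rw [gCdf, ← intervalIntegral.integral_const_mul]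
  refine intervalIntegral.integral_congr fun x _ => ?_
  simp only [gPdf_natCast (show 1 ≤ N + k by omega), choose_eq_factorial_div hN]
  have h1 := (gamma_natCast_pos (show 1 ≤ N + k by omega)).ne'
  have h2 := (gamma_natCast_pos hN).ne'
  obtain ⟨M, rfl⟩ : ∃ M, N = M + 1 := ⟨N - 1, by omega⟩
  rw [show M + 1 + k - 1 = M + k by omega]
  simp only [Nat.add_sub_cancel, mul_pow]
  field_simp
  ring

/-- The binomial series for a negative exponent. -/
lemma hasSum_choose_mul_pow (a : ℝ) {x : ℝ} (hx : |x| < 1) :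
    HasSum (fun j : ℕ => Ring.choose (a + j - 1) j * x ^ j) (1 / (1 - x) ^ a) := by
  have h := (Real.one_div_one_sub_rpow_hasFPowerSeriesOnBall_zero a).hasSum (y := x)
    (by simpa [Metric.mem_eball, edist_dist, ENNReal.ofReal_lt_one] using hx)
  simpa [FormalMultilinearSeries.ofScalars_apply_eq, mul_comm] using h

/-- The negative binomial series. -/
lemma hasSum_nat_choose_mul_pow {N : ℕ} (hN : 1 ≤ N) {x : ℝ} (hx : |x| < 1) :
    HasSum (fun k : ℕ => ((N + k - 1).choose k : ℝ) * x ^ k) (1 / (1 - x) ^ N) := by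
  have h := hasSum_choose_mul_pow N hx
  rw [Real.rpow_natCast] at h
  refine h.congr_fun fun k => ?_
  rw [show ((N : ℝ) + k - 1) = ((N + k - 1 : ℕ) : ℝ) by
    rw [Nat.cast_sub (by omega)]; push_cast; ring, Ring.choose_natCast]

end GammaVariance

namespace GammaVariance

/-! ### The angle between the sample and the diagonal -/

section Angle

variable {n : ℕ}

/-- The angle between `x` and the diagonal. -/
noncomputable def diagAngle (x : Fin n → ℝ) : ℝ :=
  Real.arccos ((∑ i, x i) / (Real.sqrt (∑ i, x i ^ 2) * Real.sqrt n))

/-- The sum of the squared deviations from the mean. -/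
noncomputable def devSq (x : Fin n → ℝ) : ℝ := ∑ i, (x i - (∑ j, x j) / n) ^ 2

lemma phi_eq_diagAngle {Ω : Type*} (X : Fin n → Ω → ℝ) (ω : Ω) :
    phi X ω = diagAngle (fun i => X i ω) := by
  simp [phi, diagAngle, InnerProductGeometry.angle, EuclideanSpace.norm_eq, PiLp.inner_apply]

lemma sqrt_mul_sampleStd {Ω : Type*} (hn : 2 ≤ n) (X : Fin n → Ω → ℝ) (ω : Ω) :
    Real.sqrt ((n : ℝ) - 1) * sampleStd X ω = Real.sqrt (devSq (fun i => X i ω)) := by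
  have h : (0 : ℝ) < n - 1 := by
    have : (2 : ℝ) ≤ n := by exact_mod_cast hn
    linarith
  rw [sampleStd, ← Real.sqrt_mul h.le, sampleVar, mul_div_cancel₀ _ h.ne']
  rfl

lemma measurable_diagAngle : Measurable (diagAngle (n := n)) := by
  unfold diagAngle
  exact Real.measurable_arccos.comp (by fun_prop)

lemma measurable_devSq : Measurable (devSq (n := n)) := by
  unfold devSq
  fun_prop

lemma devSq_eq (hn : n ≠ 0) (x : Fin n → ℝ) :
    devSq x = ∑ i, x i ^ 2 - (∑ i, x i) ^ 2 / n := by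
  have h : (n : ℝ) ≠ 0 := by exact_mod_cast hn
  simp only [devSq, sub_sq, Finset.sum_add_distrib, Finset.sum_sub_distrib, ← Finset.sum_mul,
    ← Finset.mul_sum, Finset.sum_const, Finset.card_univ, Fintype.card_fin, nsmul_eq_mul]
  field_simp
  ring

lemma sum_sq_pos {x : Fin n → ℝ} (hx : 0 < ∑ i, x i) : 0 < ∑ i, x i ^ 2 := by
  obtain ⟨i, hi, h⟩ := Finset.exists_ne_zero_of_sum_ne_zero hx.ne'
  exact Finset.sum_pos' (fun _ _ => sq_nonneg _) ⟨i, hi, by positivity⟩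

lemma natCast_pos_of_sum_pos {x : Fin n → ℝ} (hx : 0 < ∑ i, x i) : 0 < n := by
  rcases Nat.eq_zero_or_pos n with rfl | h
  · simp at hx
  · exact h

lemma diagAngle_nonneg (x : Fin n → ℝ) : 0 ≤ diagAngle x := Real.arccos_nonneg _

lemma diagAngle_lt {x : Fin n → ℝ} (hx : 0 < ∑ i, x i) : diagAngle x < Real.pi / 2 := by
  have h1 := sum_sq_pos hx
  have h2 : (0 : ℝ) < n := by exact_mod_cast natCast_pos_of_sum_pos hx
  rw [diagAngle, Real.arccos_lt_pi_div_two]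
  positivity

/-- By `devSq_eq`, `1 - cos²` is the sum of squared deviations divided by the sum of squares. -/
lemma tan_diagAngle {x : Fin n → ℝ} (hx : 0 < ∑ i, x i) :
    Real.tan (diagAngle x) = Real.sqrt n * Real.sqrt (devSq x) / ∑ i, x i := by
  have h1 := sum_sq_pos hx
  have h2 : (0 : ℝ) < n := by exact_mod_cast natCast_pos_of_sum_pos hx
  rw [diagAngle, Real.tan_arccos, devSq_eq (natCast_pos_of_sum_pos hx).ne', div_pow, mul_pow,
    Real.sq_sqrt h1.le, Real.sq_sqrt h2.le,
    show 1 - (∑ i, x i) ^ 2 / ((∑ i, x i ^ 2) * n) =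
      (∑ i, x i ^ 2 - (∑ i, x i) ^ 2 / n) / ∑ i, x i ^ 2 by field_simp,
    Real.sqrt_div' _ h1.le]
  field_simp

/-- The claim amounts to `∑ x_i² ≤ (∑ x_i)²`, which holds for nonnegative coordinates. -/
lemma tan_diagAngle_le {x : Fin n → ℝ} (hx : ∀ i, 0 ≤ x i) (hs : 0 < ∑ i, x i) :
    Real.tan (diagAngle x) ≤ Real.sqrt ((n : ℝ) - 1) := by
  have h2 : (0 : ℝ) < n := by exact_mod_cast natCast_pos_of_sum_pos hs
  rw [tan_diagAngle hs, ← Real.sqrt_mul h2.le, div_le_iff₀ hs]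
  have h1 : (1 : ℝ) ≤ n := by exact_mod_cast natCast_pos_of_sum_pos hs
  refine Real.sqrt_le_iff.2 ⟨by positivity, ?_⟩
  rw [mul_pow, Real.sq_sqrt (sub_nonneg.2 h1), devSq_eq (natCast_pos_of_sum_pos hs).ne', mul_sub,
    mul_div_cancel₀ _ h2.ne']
  have := Finset.sum_sq_le_sq_sum_of_nonneg (s := Finset.univ) (f := x) fun i _ => hx i
  nlinarith

end Angle

/-! ### Decomposition of `ℝⁿ` along the diagonal -/

section Slices

open scoped Pointwise

variable {n : ℕ}

/-- The hyperplane of vectors with coordinate sum zero. -/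
def zeroSum (n : ℕ) : Submodule ℝ (Fin n → ℝ) :=
  LinearMap.ker (∑ i, LinearMap.proj i : (Fin n → ℝ) →ₗ[ℝ] ℝ)

lemma mem_zeroSum {y : Fin n → ℝ} : y ∈ zeroSum n ↔ ∑ i, y i = 0 := by
  simp [zeroSum, LinearMap.sum_apply]

lemma sum_zeroSum (y : zeroSum n) : ∑ i, (y : Fin n → ℝ) i = 0 := mem_zeroSum.1 y.2

/-- The squared Euclidean norm on the hyperplane. -/
def normSq (y : zeroSum n) : ℝ := ∑ i, (y : Fin n → ℝ) i ^ 2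

/-- `ℝⁿ` as the sum of the diagonal and its orthogonal complement. -/
noncomputable def slice (hn : n ≠ 0) : (ℝ × zeroSum n) ≃L[ℝ] (Fin n → ℝ) :=
  LinearEquiv.toContinuousLinearEquiv
    { toFun := fun p i => p.1 + (p.2 : Fin n → ℝ) i
      map_add' := fun p q => by ext i; simp; ring
      map_smul' := fun r p => by ext i; simp; ring
      invFun := fun x => ((∑ j, x j) / n, ⟨fun i => x i - (∑ j, x j) / n, by
        have : (n : ℝ) ≠ 0 := by exact_mod_cast hn
        rw [mem_zeroSum]
        simp
        field_simp
        simp⟩)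
      left_inv := fun p => by
        have : (n : ℝ) ≠ 0 := by exact_mod_cast hn
        ext <;> simp [Finset.sum_add_distrib, sum_zeroSum, this]
      right_inv := fun x => by ext i; simp }

@[simp] lemma slice_apply (hn : n ≠ 0) (p : ℝ × zeroSum n) (i : Fin n) :
    slice hn p i = p.1 + (p.2 : Fin n → ℝ) i := rfl

lemma finrank_zeroSum (hn : n ≠ 0) : Module.finrank ℝ (zeroSum n) = n - 1 := by
  have h := (slice hn).toLinearEquiv.finrank_eq
  rw [Module.finrank_prod, Module.finrank_self, Module.finrank_fin_fun] at h
  omega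

/-- A Lebesgue measure on the hyperplane. -/
noncomputable abbrev zeroSumVol (n : ℕ) : Measure (zeroSum n) := Measure.addHaar

/-- Two Haar measures on `ℝⁿ` are proportional. The constant is never computed: it is absorbed into
`angleCoeff`, and the linear equations satisfied by those coefficients do not contain it. -/
lemma exists_volume_eq_smul_map (hn : n ≠ 0) :
    ∃ c : NNReal, c ≠ 0 ∧ (volume : Measure (Fin n → ℝ)) =
      c • ((volume : Measure ℝ).prod (zeroSumVol n)).map (slice hn) := by
  have : (((volume : Measure ℝ).prod (zeroSumVol n)).map (slice hn)).IsAddHaarMeasure :=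
    (slice hn).isAddHaarMeasure_map _
  refine ⟨Measure.addHaarScalarFactor volume
    (((volume : Measure ℝ).prod (zeroSumVol n)).map (slice hn)), ?_, ?_⟩
  · exact (Measure.addHaarScalarFactor_pos_of_isAddHaarMeasure _ _).ne'
  · exact Measure.isAddLeftInvariant_eq_smul _ _

/-- The constant that relates Lebesgue measure to the product measure of the decomposition. -/
noncomputable def sliceConst (hn : n ≠ 0) : NNReal := (exists_volume_eq_smul_map hn).choose

lemma sliceConst_ne_zero (hn : n ≠ 0) : sliceConst hn ≠ 0 :=
  (exists_volume_eq_smul_map hn).choose_spec.1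

lemma volume_eq_smul_map (hn : n ≠ 0) : (volume : Measure (Fin n → ℝ)) =
      sliceConst hn • ((volume : Measure ℝ).prod (zeroSumVol n)).map (slice hn) :=
  (exists_volume_eq_smul_map hn).choose_spec.2

lemma integral_eq_slice (hn : n ≠ 0) (f : (Fin n → ℝ) → ℝ) :
    ∫ x, f x = sliceConst hn * ∫ p, f (slice hn p) ∂((volume : Measure ℝ).prod (zeroSumVol n)) := by
  rw [volume_eq_smul_map hn, integral_smul_nnreal_measure,
    (slice hn).toHomeomorph.measurableEmbedding.integral_map (f := slice hn)]
  rfl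

lemma integrable_slice (hn : n ≠ 0) {f : (Fin n → ℝ) → ℝ} (hf : Integrable f) :
    Integrable (fun p => f (slice hn p)) ((volume : Measure ℝ).prod (zeroSumVol n)) := by
  rw [volume_eq_smul_map hn] at hf
  have h := (integrable_smul_measure (c := (sliceConst hn : ENNReal))
    (by exact_mod_cast sliceConst_ne_zero hn) ENNReal.coe_ne_top).1 hf
  exact ((slice hn).toHomeomorph.measurableEmbedding.integrable_map_iff (f := slice hn)).1 h

lemma continuous_normSq : Continuous (normSq (n := n)) := by
  unfold normSq
  exact continuous_finsetSum _ fun i _ =>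
    ((continuous_apply i).comp continuous_subtype_val).pow 2

lemma normSq_nonneg (y : zeroSum n) : 0 ≤ normSq y := Finset.sum_nonneg fun _ _ => sq_nonneg _

lemma normSq_smul (r : ℝ) (y : zeroSum n) : normSq (r • y) = r ^ 2 * normSq y := by
  simp [normSq, mul_pow, Finset.mul_sum]

lemma normSq_eq_zero {y : zeroSum n} : normSq y = 0 ↔ y = 0 := by
  rw [normSq, Finset.sum_eq_zero_iff_of_nonneg fun _ _ => sq_nonneg _]
  refine ⟨fun h => ?_, fun h => by simp [h]⟩
  ext i
  simpa using h i (Finset.mem_univ i)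

/-- The closed ball of squared radius `v` in the hyperplane. -/
def sqBall (n : ℕ) (v : ℝ) : Set (zeroSum n) := {y | normSq y ≤ v}

lemma isClosed_sqBall (v : ℝ) : IsClosed (sqBall n v) :=
  isClosed_le continuous_normSq continuous_const

lemma isCompact_of_coord_bound {S : Set (zeroSum n)} (hS : IsClosed S) (B : ℝ)
    (h : ∀ y ∈ S, ∀ i, |(y : Fin n → ℝ) i| ≤ B) : IsCompact S := by
  refine Metric.isCompact_of_isClosed_isBounded hS
    ((Metric.isBounded_closedBall (x := 0) (r := |B|)).subset fun y hy => ?_)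
  rw [mem_closedBall_zero_iff, Submodule.coe_norm, pi_norm_le_iff_of_nonneg (abs_nonneg B)]
  exact fun i => (h y hy i).trans (le_abs_self B)

lemma isCompact_sqBall (v : ℝ) : IsCompact (sqBall n v) := by
  refine isCompact_of_coord_bound (isClosed_sqBall v) (Real.sqrt v) fun y hy i => ?_
  refine Real.abs_le_sqrt (le_trans ?_ (show normSq y ≤ v from hy))
  exact Finset.single_le_sum (f := fun i => (y : Fin n → ℝ) i ^ 2) (fun _ _ => sq_nonneg _)
    (Finset.mem_univ i)

lemma sum_slice (hn : n ≠ 0) (p : ℝ × zeroSum n) : ∑ i, slice hn p i = n * p.1 := by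
  simp [Finset.sum_add_distrib, sum_zeroSum]

lemma sum_sq_slice (hn : n ≠ 0) (p : ℝ × zeroSum n) :
    ∑ i, slice hn p i ^ 2 = n * p.1 ^ 2 + normSq p.2 := by
  simp [add_sq, Finset.sum_add_distrib, ← Finset.mul_sum, sum_zeroSum, normSq]

lemma devSq_slice (hn : n ≠ 0) (p : ℝ × zeroSum n) : devSq (slice hn p) = normSq p.2 := by
  have : (n : ℝ) ≠ 0 := by exact_mod_cast hn
  rw [devSq_eq hn, sum_slice, sum_sq_slice]
  field_simp
  ring

lemma nontrivial_zeroSum (hn : 2 ≤ n) : Nontrivial (zeroSum n) :=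
  Module.nontrivial_of_finrank_pos (R := ℝ) (by rw [finrank_zeroSum (by omega)]; omega)

lemma ae_ne_zero_zeroSum (hn : 2 ≤ n) : ∀ᵐ y ∂(zeroSumVol n), y ≠ 0 := by
  have := nontrivial_zeroSum hn
  simp [ae_iff]

lemma sqBall_zero : sqBall n 0 = {0} := by
  ext y
  simp only [sqBall, Set.mem_ofPred_eq, Set.mem_singleton_iff, ← normSq_eq_zero]
  exact ⟨fun h => le_antisymm h (normSq_nonneg y), fun h => h.le⟩

lemma smul_sqBall_one {r : ℝ} (hr : 0 < r) : r • sqBall n 1 = sqBall n (r ^ 2) := by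
  ext y
  rw [Set.mem_smul_set_iff_inv_smul_mem₀ hr.ne']
  simp only [sqBall, Set.mem_ofPred_eq, normSq_smul, inv_pow]
  rw [inv_mul_le_iff₀ (by positivity), mul_one]

/-- Integrals of a homogeneous function over balls. -/
lemma setIntegral_sqBall (hn : 2 ≤ n) {q : zeroSum n → ℝ} {j : ℕ}
    (hq : ∀ r : ℝ, 0 < r → ∀ y, q (r • y) = r ^ j * q y) {r : ℝ} (hr : 0 ≤ r) :
    ∫ y in sqBall n (r ^ 2), q y ∂(zeroSumVol n) =
      r ^ (n - 1 + j) * ∫ y in sqBall n 1, q y ∂(zeroSumVol n) := by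
  rcases hr.eq_or_lt with rfl | hr
  -- For radius zero the ball is a point, a null set because the hyperplane is nontrivial, and the
  -- power on the right vanishes since `n ≥ 2`.
  · have := nontrivial_zeroSum hn
    rw [zero_pow two_ne_zero, sqBall_zero, zero_pow (by omega), zero_mul]
    simp
  · have h := Measure.setIntegral_comp_smul_of_pos (zeroSumVol n) q (sqBall n 1) hr
    simp_rw [hq r hr] at h
    rw [smul_sqBall_one hr, integral_const_mul, finrank_zeroSum (by omega), smul_eq_mul,
      eq_inv_mul_iff_mul_eq₀ (by positivity)] at h
    rw [← h]
    ring

/-- The Gaussian integral of a homogeneous function, in terms of the integral over the ball. -/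
lemma integral_mul_exp_neg_normSq (hn : 2 ≤ n) {q : zeroSum n → ℝ} (hc : Continuous q) {j : ℕ}
    (hq : ∀ r : ℝ, 0 < r → ∀ y, q (r • y) = r ^ j * q y) :
    Integrable (fun y => q y * Real.exp (-normSq y)) (zeroSumVol n) ∧
    ∫ y, q y * Real.exp (-normSq y) ∂(zeroSumVol n) =
      Real.Gamma (((n : ℝ) - 1 + j) / 2 + 1) * ∫ y in sqBall n 1, q y ∂(zeroSumVol n) := by
  -- `exp(-|y|²)` is the integral of `exp(-v)` over `v ≥ |y|²`, so the Gaussian weight is a mixture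
  -- of indicators of balls. Homogeneity turns each ball integral into a power of `v`, and a gamma
  -- integral remains.
  have hexp : ∀ y : zeroSum n, q y * Real.exp (-normSq y) =
      ∫ v in Set.Ioi (0 : ℝ), (sqBall n v).indicator q y * Real.exp (-v) := fun y => by
    have h1 : ∀ v, (sqBall n v).indicator q y * Real.exp (-v) =
        (Set.Ici (normSq y)).indicator (fun v => q y * Real.exp (-v)) v := fun v => by
      by_cases h : normSq y ≤ v
      · rw [Set.indicator_of_mem (show y ∈ sqBall n v from h), Set.indicator_of_mem
          (show v ∈ Set.Ici (normSq y) from h)]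
      · rw [Set.indicator_of_notMem (show y ∉ sqBall n v from h), zero_mul,
          Set.indicator_of_notMem (show v ∉ Set.Ici (normSq y) from h)]
    simp_rw [h1]
    rw [← integral_Ici_eq_integral_Ioi, setIntegral_indicator measurableSet_Ici,
      Set.inter_eq_right.2 (Set.Ici_subset_Ici.2 (normSq_nonneg y)), integral_Ici_eq_integral_Ioi,
      integral_const_mul, integral_exp_neg_Ioi]
  -- Stated for a general `g` because it is applied to `q` and, for integrability, to `‖q‖`.
  have hscale : ∀ g : zeroSum n → ℝ, (∀ r : ℝ, 0 < r → ∀ y, g (r • y) = r ^ j * g y) →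
      ∀ v ∈ Set.Ioi (0 : ℝ), ∫ y, (sqBall n v).indicator g y * Real.exp (-v) ∂(zeroSumVol n) =
        Real.exp (-v) * v ^ (((n : ℝ) - 1 + j) / 2 + 1 - 1) *
          ∫ y in sqBall n 1, g y ∂(zeroSumVol n) := fun g hg v hv => by
    rw [integral_mul_const, integral_indicator (isClosed_sqBall v).measurableSet]
    have := setIntegral_sqBall hn hg (Real.sqrt_nonneg v)
    rw [Real.sq_sqrt (le_of_lt hv)] at this
    rw [this, Real.sqrt_eq_rpow, ← Real.rpow_natCast, ← Real.rpow_mul (le_of_lt hv)]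
    push_cast [Nat.cast_sub (show 1 ≤ n by omega)]
    ring_nf
  have hpos : (0 : ℝ) < ((n : ℝ) - 1 + j) / 2 + 1 := by
    have : (2 : ℝ) ≤ n := by exact_mod_cast hn
    have : (0 : ℝ) ≤ j := j.cast_nonneg
    linarith
  have hint : Integrable (fun p : ℝ × zeroSum n => (sqBall n p.1).indicator q p.2 *
      Real.exp (-p.1)) ((volume.restrict (Set.Ioi 0)).prod (zeroSumVol n)) := by
    have hm : AEStronglyMeasurable (fun p : ℝ × zeroSum n => (sqBall n p.1).indicator q p.2 *
        Real.exp (-p.1)) ((volume.restrict (Set.Ioi 0)).prod (zeroSumVol n)) := by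
      refine (Measurable.mul ?_ (by fun_prop)).aestronglyMeasurable
      have : (fun p : ℝ × zeroSum n => (sqBall n p.1).indicator q p.2) =
          {p : ℝ × zeroSum n | normSq p.2 ≤ p.1}.indicator (fun p => q p.2) := by
        ext p
        rfl
      rw [this]
      exact (hc.measurable.comp measurable_snd).indicator
        (measurableSet_le (continuous_normSq.measurable.comp measurable_snd) measurable_fst)
    refine (integrable_prod_iff hm).2 ⟨ae_of_all _ fun v => ?_, ?_⟩
    · have h : Integrable ((sqBall n v).indicator q) (zeroSumVol n) :=
        (integrable_indicator_iff (isClosed_sqBall v).measurableSet).2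
          (hc.continuousOn.integrableOn_compact (isCompact_sqBall v))
      exact h.mul_const (Real.exp (-v))
    · have hn' : ∀ v ∈ Set.Ioi (0 : ℝ), ∫ y, ‖(sqBall n v).indicator q y * Real.exp (-v)‖
          ∂(zeroSumVol n) = Real.exp (-v) * v ^ (((n : ℝ) - 1 + j) / 2 + 1 - 1) *
          ∫ y in sqBall n 1, ‖q y‖ ∂(zeroSumVol n) := fun v hv => by
        rw [← hscale (fun y => ‖q y‖) (fun r hr y => by
          rw [hq r hr, norm_mul, norm_pow, Real.norm_of_nonneg hr.le]) v hv]
        refine integral_congr_ae (ae_of_all _ fun y => ?_)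
        simp only [norm_mul, Real.norm_of_nonneg (Real.exp_pos _).le,
          norm_indicator_eq_indicator_norm]
      refine (integrableOn_congr_fun hn' measurableSet_Ioi).2 ?_
      exact (Real.GammaIntegral_convergent hpos).mul_const _
  refine ⟨?_, ?_⟩
  · have := hint.integral_prod_right
    simpa only [← hexp] using this
  · simp_rw [hexp]
    rw [← integral_integral_swap (f := fun v y => (sqBall n v).indicator q y * Real.exp (-v)) hint,
      setIntegral_congr_fun measurableSet_Ioi (hscale q hq), integral_mul_const,
      ← Real.Gamma_eq_integral hpos]

end Slices

/-! ### The law of a gamma sample along the slices -/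

lemma integrable_gammaPDFReal {a : ℝ} (ha : 0 < a) : Integrable (gammaPDFReal a 1) := by
  refine ⟨(measurable_gammaPDFReal a 1).aestronglyMeasurable, ?_⟩
  rw [hasFiniteIntegral_iff_ofReal (ae_of_all _ fun x => gammaPDFReal_nonneg ha one_pos x)]
  have := lintegral_gammaPDF_eq_one ha one_pos
  simp only [gammaPDF] at this
  simp [this]

section Law

variable {n : ℕ}

/-- The joint density of independent gamma variables. -/
noncomputable def sampleDens (α n : ℕ) (x : Fin n → ℝ) : ℝ := ∏ i, gammaPDFReal (α : ℝ) 1 (x i)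

lemma measurable_sampleDens (α : ℕ) : Measurable (sampleDens α n) := by
  unfold sampleDens
  exact Finset.measurable_fun_prod _ fun i _ =>
    (measurable_gammaPDFReal _ _).comp (measurable_pi_apply i)

lemma sampleDens_nonneg {α : ℕ} (hα : 1 ≤ α) (x : Fin n → ℝ) : 0 ≤ sampleDens α n x :=
  Finset.prod_nonneg fun _ _ => gammaPDFReal_nonneg (by exact_mod_cast hα) one_pos _

lemma integrable_sampleDens {α : ℕ} (hα : 1 ≤ α) : Integrable (sampleDens α n) :=
  Integrable.fintype_prod (f := fun _ => gammaPDFReal (α : ℝ) 1)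
    fun _ => integrable_gammaPDFReal (by exact_mod_cast hα)

lemma pi_gammaMeasure {α : ℕ} (hα : 1 ≤ α) :
    Measure.pi (fun _ : Fin n => gammaMeasure (α : ℝ) 1) =
      (volume : Measure (Fin n → ℝ)).withDensity fun x => ENNReal.ofReal (sampleDens α n x) := by
  have h0 : (0 : ℝ) < α := by exact_mod_cast hα
  have : IsProbabilityMeasure (gammaMeasure (α : ℝ) 1) :=
    isProbabilityMeasure_gammaMeasure h0 one_pos
  refine Measure.pi_eq fun s hs => ?_
  rw [withDensity_apply _ (MeasurableSet.univ_pi hs),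
    ← ofReal_integral_eq_lintegral_ofReal (integrable_sampleDens hα).integrableOn
      (ae_of_all _ fun x => sampleDens_nonneg hα x), volume_pi, Measure.restrict_pi_pi]
  simp only [sampleDens]
  rw [integral_fintype_prod_eq_prod (fun _ => gammaPDFReal (α : ℝ) 1),
    ENNReal.ofReal_prod_of_nonneg fun i _ =>
      integral_nonneg fun x => gammaPDFReal_nonneg h0 one_pos x]
  refine Finset.prod_congr rfl fun i _ => ?_
  rw [gammaMeasure, withDensity_apply _ (hs i),
    ofReal_integral_eq_lintegral_ofReal (integrable_gammaPDFReal h0).integrableOn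
      (ae_of_all _ fun x => gammaPDFReal_nonneg h0 one_pos x)]
  rfl

lemma integral_pi_gammaMeasure {α : ℕ} (hα : 1 ≤ α) (F : (Fin n → ℝ) → ℝ) :
    ∫ x, F x ∂(Measure.pi fun _ : Fin n => gammaMeasure (α : ℝ) 1) =
      ∫ x, sampleDens α n x * F x := by
  rw [pi_gammaMeasure hα, integral_withDensity_eq_integral_toReal_smul
    (measurable_sampleDens α).ennreal_ofReal (ae_of_all _ fun _ => ENNReal.ofReal_lt_top)]
  refine integral_congr_ae (ae_of_all _ fun x => ?_)
  simp only [ENNReal.toReal_ofReal (sampleDens_nonneg hα x), smul_eq_mul]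

/-- The density of the direction of the sample, without its normalisation. -/
noncomputable def dirDens (α n : ℕ) (z : zeroSum n) : ℝ :=
  {z : zeroSum n | ∀ i, 0 ≤ 1 + (z : Fin n → ℝ) i}.indicator
    (fun z => ∏ i, (1 + (z : Fin n → ℝ) i) ^ (α - 1)) z

lemma continuous_coord (i : Fin n) : Continuous fun z : zeroSum n => (z : Fin n → ℝ) i :=
  (continuous_apply i).comp continuous_subtype_val

lemma isClosed_simplex : IsClosed {z : zeroSum n | ∀ i, 0 ≤ 1 + (z : Fin n → ℝ) i} := by
  rw [Set.ofPred_forall]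
  exact isClosed_iInter fun i => isClosed_le continuous_const
    (continuous_const.add (continuous_coord i))

/-- Nonnegative numbers `1 + z_i` with sum `n` are at most `n`. -/
lemma isCompact_simplex : IsCompact {z : zeroSum n | ∀ i, 0 ≤ 1 + (z : Fin n → ℝ) i} := by
  refine isCompact_of_coord_bound isClosed_simplex (n + 1) fun z hz i => abs_le.2 ⟨?_, ?_⟩
  · have := hz i
    have : (0 : ℝ) ≤ n := n.cast_nonneg
    linarith [hz i]
  · have h := Finset.single_le_sum (f := fun i => 1 + (z : Fin n → ℝ) i) (fun i _ => hz i)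
      (Finset.mem_univ i)
    simp only [Finset.sum_add_distrib, sum_zeroSum] at h
    simp at h
    linarith

lemma integrable_dirDens (α : ℕ) : Integrable (dirDens α n) (zeroSumVol n) := by
  refine (integrable_indicator_iff isClosed_simplex.measurableSet).2
    (Continuous.continuousOn ?_ |>.integrableOn_compact isCompact_simplex)
  exact continuous_finsetProd _ fun i _ => (continuous_const.add (continuous_coord i)).pow _

/-- The coordinates are `s(1 + z_i)` and their sum is `ns`, so the exponential depends on `s` alone.
This factorisation is the independence of size and direction. -/
lemma sampleDens_slice {α : ℕ} (hα : 1 ≤ α) (hn : n ≠ 0) {s : ℝ} (hs : 0 < s) (z : zeroSum n) :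
    sampleDens α n (slice hn (s, s • z)) =
      s ^ ((α - 1) * n) * Real.exp (-(n * s)) / Real.Gamma α ^ n * dirDens α n z := by
  have hc : ∀ i, slice hn (s, s • z) i = s * (1 + (z : Fin n → ℝ) i) := fun i => by
    simp [mul_add]
  have hpos : ∀ i, 0 ≤ s * (1 + (z : Fin n → ℝ) i) ↔ 0 ≤ 1 + (z : Fin n → ℝ) i :=
    fun i => mul_nonneg_iff_of_pos_left hs
  by_cases h : ∀ i, 0 ≤ 1 + (z : Fin n → ℝ) i
  · rw [dirDens, Set.indicator_of_mem (by exact h), sampleDens]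
    have h1 : ∀ i, gammaPDFReal (α : ℝ) 1 (slice hn (s, s • z) i) =
        s ^ (α - 1) * (1 + (z : Fin n → ℝ) i) ^ (α - 1) / Real.Gamma α *
          Real.exp (-(s * (1 + (z : Fin n → ℝ) i))) := fun i => by
      rw [hc, gammaPDFReal, if_pos ((hpos i).2 (h i)), Real.one_rpow,
        show (α : ℝ) - 1 = (α - 1 : ℕ) by push_cast [Nat.cast_sub hα]; ring,
        Real.rpow_natCast, mul_pow, one_mul]
      ring
    simp_rw [h1]
    rw [Finset.prod_mul_distrib, ← Real.exp_sum, Finset.prod_div_distrib, Finset.prod_mul_distrib,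
      Finset.prod_const, Finset.prod_const, Finset.sum_neg_distrib, ← Finset.mul_sum,
      Finset.sum_add_distrib, sum_zeroSum]
    simp only [Finset.card_univ, Fintype.card_fin, Finset.sum_const, nsmul_eq_mul]
    rw [← pow_mul]
    ring_nf
  · rw [dirDens, Set.indicator_of_notMem (by exact h), mul_zero, sampleDens]
    push Not at h
    obtain ⟨i, hi⟩ := h
    refine Finset.prod_eq_zero (Finset.mem_univ i) ?_
    rw [hc, gammaPDFReal, if_neg]
    rw [hpos]
    exact not_le.2 hi

lemma sampleDens_slice_of_neg {α : ℕ} (hn : n ≠ 0) {s : ℝ} (hs : s < 0) (y : zeroSum n) :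
    sampleDens α n (slice hn (s, y)) = 0 := by
  have h : ∃ i, slice hn (s, y) i < 0 := by
    by_contra! h
    have h1 := Finset.sum_nonneg fun i (_ : i ∈ Finset.univ) => h i
    rw [sum_slice] at h1
    have : (0 : ℝ) < n := by exact_mod_cast Nat.pos_of_ne_zero hn
    nlinarith
  obtain ⟨i, hi⟩ := h
  exact Finset.prod_eq_zero (Finset.mem_univ i) (by rw [gammaPDFReal, if_neg (not_le.2 hi)])

lemma integrableOn_pow_mul_exp (N : ℕ) {b : ℝ} (hb : 0 < b) :
    IntegrableOn (fun s : ℝ => s ^ (N - 1) * Real.exp (-(b * s))) (Set.Ioi 0) := by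
  have h := integrableOn_rpow_mul_exp_neg_mul_rpow (p := 1) (s := (N - 1 : ℕ))
    (lt_of_lt_of_le (by norm_num) (Nat.cast_nonneg _)) one_pos hb
  refine (integrableOn_congr_fun (fun x _ => ?_) measurableSet_Ioi).1 h
  simp [Real.rpow_natCast]

lemma integral_pow_mul_exp {N : ℕ} (hN : 1 ≤ N) {b : ℝ} (hb : 0 < b) :
    ∫ s in Set.Ioi (0 : ℝ), s ^ (N - 1) * Real.exp (-(b * s)) = Real.Gamma N / b ^ N := by
  have h := Real.integral_rpow_mul_exp_neg_mul_Ioi (a := N) (by exact_mod_cast hN) hb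
  rw [← Nat.cast_one, ← Nat.cast_sub hN] at h
  simp_rw [Real.rpow_natCast] at h
  rw [h]
  simp
  ring

/-- Expectations with respect to a gamma sample as integrals over directions and sizes. -/
lemma integral_gamma_sample {α : ℕ} (hα : 1 ≤ α) (hn : 2 ≤ n) {F : (Fin n → ℝ) → ℝ}
    (hF : Measurable F) (hF1 : ∀ x, |F x| ≤ 1) :
    ∫ x, F x ∂(Measure.pi fun _ : Fin n => gammaMeasure (α : ℝ) 1) =
      sliceConst (show n ≠ 0 by omega) / Real.Gamma α ^ n * ∫ z, dirDens α n z *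
        (∫ s in Set.Ioi (0 : ℝ), s ^ (α * n - 1) * Real.exp (-(n * s)) *
          F (slice (show n ≠ 0 by omega) (s, s • z))) ∂(zeroSumVol n) := by
  have hn0 : n ≠ 0 := by omega
  have hN : 1 ≤ α * n := Nat.mul_pos hα (by omega)
  have hint : Integrable (fun x => sampleDens α n x * F x) :=
    (integrable_sampleDens hα).mul_bdd (c := 1) hF.aestronglyMeasurable
      (ae_of_all _ hF1)
  rw [integral_pi_gammaMeasure hα, integral_eq_slice hn0, integral_prod _
    (integrable_slice hn0 hint),
    ← setIntegral_eq_integral_of_ae_compl_eq_zero (s := Set.Ioi (0 : ℝ)), div_mul_eq_mul_div,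
    mul_div_assoc]
  swap
  · have : ∀ᵐ s : ℝ, s ≠ 0 := by simp [ae_iff]
    filter_upwards [this] with s hs hs'
    have hs0 : s < 0 := lt_of_le_of_ne (not_lt.1 hs') hs
    simp [sampleDens_slice_of_neg hn0 hs0]
  congr 1
  have h1 : ∀ s ∈ Set.Ioi (0 : ℝ), ∫ y, sampleDens α n (slice hn0 (s, y)) * F (slice hn0 (s, y))
      ∂(zeroSumVol n) = ∫ z, s ^ (α * n - 1) * Real.exp (-(n * s)) / Real.Gamma α ^ n *
        (dirDens α n z * F (slice hn0 (s, s • z))) ∂(zeroSumVol n) := fun s hs => by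
    have hs : 0 < s := hs
    -- The substitution `y = sz` in the hyperplane contributes `s^(n-1)`, which raises the exponent
    -- `(α-1)n` to `αn - 1`.
    have h := Measure.integral_comp_smul_of_nonneg (zeroSumVol n)
      (fun y => sampleDens α n (slice hn0 (s, y)) * F (slice hn0 (s, y))) s (hR := hs.le)
    rw [finrank_zeroSum hn0, smul_eq_mul, eq_inv_mul_iff_mul_eq₀ (by positivity)] at h
    rw [← h, ← integral_const_mul]
    refine integral_congr_ae (ae_of_all _ fun z => ?_)
    simp only [sampleDens_slice hα hn0 hs]
    have : α * n - 1 = (n - 1) + (α - 1) * n := by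
      obtain ⟨a, rfl⟩ : ∃ a, α = a + 1 := ⟨α - 1, by omega⟩
      rw [Nat.add_sub_cancel, add_mul]
      omega
    rw [this, pow_add]
    ring
  rw [setIntegral_congr_fun measurableSet_Ioi h1]
  have hm : Measurable fun p : ℝ × zeroSum n => F (slice hn0 (p.1, p.1 • p.2)) := by
    refine hF.comp ((slice hn0).continuous.measurable.comp ?_)
    exact (Continuous.prodMk continuous_fst (continuous_fst.smul continuous_snd)).measurable
  have h2 : Integrable (fun p : ℝ × zeroSum n => p.1 ^ (α * n - 1) * Real.exp (-(n * p.1)) /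
      Real.Gamma α ^ n * (dirDens α n p.2 * F (slice hn0 (p.1, p.1 • p.2))))
      ((volume.restrict (Set.Ioi 0)).prod (zeroSumVol n)) := by
    have h := (((integrableOn_pow_mul_exp (α * n) (b := n) (by positivity)).div_const
      (Real.Gamma α ^ n)).mul_prod (integrable_dirDens (n := n) α)).mul_bdd (c := 1)
      hm.aestronglyMeasurable (ae_of_all _ fun p => hF1 _)
    refine h.congr (ae_of_all _ fun p => ?_)
    simp only
    ring
  rw [integral_integral_swap (f := fun s z => s ^ (α * n - 1) * Real.exp (-(n * s)) /
      Real.Gamma α ^ n * (dirDens α n z * F (slice hn0 (s, s • z)))) h2, ← integral_div]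
  refine integral_congr_ae (ae_of_all _ fun z => ?_)
  simp only
  rw [mul_div_assoc, ← integral_div, ← integral_const_mul]
  refine integral_congr_ae (ae_of_all _ fun s => ?_)
  simp only
  ring

end Law

/-! ### Deviation and tangent of the angle in terms of size and direction -/

section Consequences

variable {n : ℕ}

/-- The law of a sample of `n` independent gamma variables of order `α`. -/
noncomputable abbrev sampleLaw (α n : ℕ) : Measure (Fin n → ℝ) :=
  Measure.pi fun _ : Fin n => gammaMeasure (α : ℝ) 1

lemma isProbabilityMeasure_sampleLaw {α : ℕ} (hα : 1 ≤ α) :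
    IsProbabilityMeasure (sampleLaw α n) := by
  have : IsProbabilityMeasure (gammaMeasure (α : ℝ) 1) :=
    isProbabilityMeasure_gammaMeasure (by exact_mod_cast hα) one_pos
  infer_instance

lemma tan_diagAngle_slice (hn : n ≠ 0) {s : ℝ} (hs : 0 < s) (z : zeroSum n) :
    Real.tan (diagAngle (slice hn (s, s • z))) = Real.sqrt (normSq z) / Real.sqrt n := by
  have h0 : (0 : ℝ) < n := by exact_mod_cast Nat.pos_of_ne_zero hn
  have h1 := Real.sqrt_pos.2 h0
  rw [tan_diagAngle (by rw [sum_slice]; positivity), devSq_slice, sum_slice, normSq_smul,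
    Real.sqrt_mul (sq_nonneg s), Real.sqrt_sq hs.le, div_eq_div_iff (by positivity) h1.ne']
  nth_rewrite 3 [← Real.mul_self_sqrt h0.le]
  simp only
  ring

lemma sqrt_devSq_slice (hn : n ≠ 0) {s : ℝ} (hs : 0 < s) (z : zeroSum n) :
    Real.sqrt (devSq (slice hn (s, s • z))) = s * Real.sqrt (normSq z) := by
  rw [devSq_slice, normSq_smul, Real.sqrt_mul (sq_nonneg s), Real.sqrt_sq hs.le]

lemma measurable_tan_diagAngle : Measurable fun x : Fin n → ℝ => Real.tan (diagAngle x) := by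
  simp_rw [Real.tan_eq_sin_div_cos]
  exact (Real.measurable_sin.comp measurable_diagAngle).div
    (Real.measurable_cos.comp measurable_diagAngle)

/-- A scaled incomplete gamma integral. -/
lemma integral_pow_mul_exp_Ioc {N : ℕ} (hN : 1 ≤ N) {b y : ℝ} (hb : 0 < b) (hy : 0 ≤ y) :
    ∫ s in Set.Ioc 0 y, s ^ (N - 1) * Real.exp (-(b * s)) =
      Real.Gamma N / b ^ N * gCdf N (b * y) := by
  have hg := gamma_natCast_pos hN
  have h := intervalIntegral.mul_integral_comp_mul_left (a := 0) (b := y) (f := gPdf N) (c := b)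
  rw [mul_zero] at h
  rw [gCdf, ← h, ← intervalIntegral.integral_of_le hy, ← intervalIntegral.integral_const_mul,
    ← intervalIntegral.integral_const_mul]
  refine intervalIntegral.integral_congr fun s _ => ?_
  simp only [gPdf_natCast hN]
  obtain ⟨M, rfl⟩ : ∃ M, N = M + 1 := ⟨N - 1, by omega⟩
  simp only [Nat.add_sub_cancel]
  field_simp
  ring

/-- The distribution of the size of the deviation is a mixture of gamma distributions over the
angle. -/
lemma sampleLaw_sqrt_devSq_le {α : ℕ} (hα : 1 ≤ α) (hn : 2 ≤ n) {r : ℝ} (hr : 0 ≤ r) :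
    (sampleLaw α n).real {x | Real.sqrt (devSq x) ≤ r} =
      ∫ x, gCdf (α * n : ℕ) |r * Real.sqrt n * (Real.tan (diagAngle x))⁻¹| ∂(sampleLaw α n) := by
  have hn0 : n ≠ 0 := by omega
  have hN : 1 ≤ α * n := Nat.mul_pos hα (by omega)
  have hpos : (0 : ℝ) < n := by exact_mod_cast Nat.pos_of_ne_zero hn0
  have hS : MeasurableSet {x : Fin n → ℝ | Real.sqrt (devSq x) ≤ r} :=
    measurableSet_le measurable_devSq.sqrt measurable_const
  rw [← integral_indicator_one hS,
    integral_gamma_sample hα hn (measurable_one.indicator hS)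
      (fun x => by by_cases h : x ∈ {x : Fin n → ℝ | Real.sqrt (devSq x) ≤ r} <;> simp [h]),
    integral_gamma_sample hα hn]
  · congr 1
    refine integral_congr_ae ?_
    -- The direction `z = 0` must be excluded, since the bound on `s` is `r/|z|`.
    filter_upwards [ae_ne_zero_zeroSum hn] with z hz
    have hq : 0 < normSq z := lt_of_le_of_ne (normSq_nonneg z) fun h => hz (normSq_eq_zero.1 h.symm)
    have hq' := Real.sqrt_pos.2 hq
    have hn' := Real.sqrt_pos.2 hpos
    congr 1
    have h1 : ∀ s ∈ Set.Ioi (0 : ℝ), s ^ (α * n - 1) * Real.exp (-(n * s)) *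
        {x : Fin n → ℝ | Real.sqrt (devSq x) ≤ r}.indicator 1 (slice hn0 (s, s • z)) =
        (Set.Iic (r / Real.sqrt (normSq z))).indicator
          (fun s => s ^ (α * n - 1) * Real.exp (-(n * s))) s := fun s hs => by
      by_cases h : s ≤ r / Real.sqrt (normSq z)
      · rw [Set.indicator_of_mem (s := Set.Iic _) (by exact h), Set.indicator_of_mem]
        · simp
        · show Real.sqrt _ ≤ r
          rwa [sqrt_devSq_slice hn0 hs, ← le_div_iff₀ hq']
      · rw [Set.indicator_of_notMem (s := Set.Iic _) (by exact h), Set.indicator_of_notMem]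
        · simp
        · show ¬ Real.sqrt _ ≤ r
          rwa [sqrt_devSq_slice hn0 hs, ← le_div_iff₀ hq']
    -- The angle is constant along the ray through `z`, so this side is a complete gamma integral
    -- times a constant, while the other side is the incomplete integral up to `r/|z|`.
    have h2 : ∀ s ∈ Set.Ioi (0 : ℝ), s ^ (α * n - 1) * Real.exp (-(n * s)) *
        gCdf (α * n : ℕ) |r * Real.sqrt n * (Real.tan (diagAngle (slice hn0 (s, s • z))))⁻¹| =
        s ^ (α * n - 1) * Real.exp (-(n * s)) *
          gCdf (α * n : ℕ) (n * (r / Real.sqrt (normSq z))) := fun s hs => by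
      rw [tan_diagAngle_slice hn0 hs, abs_of_nonneg (by positivity), inv_div]
      congr 2
      nth_rewrite 3 [← Real.mul_self_sqrt hpos.le]
      ring
    rw [setIntegral_congr_fun measurableSet_Ioi h1, setIntegral_congr_fun measurableSet_Ioi h2,
      integral_mul_const, integral_pow_mul_exp hN hpos, setIntegral_indicator measurableSet_Iic,
      Set.Ioi_inter_Iic, integral_pow_mul_exp_Ioc hN hpos (by positivity)]
  · exact (continuous_gCdf hN).measurable.comp
      (measurable_norm.comp (measurable_const.mul measurable_tan_diagAngle.inv))
  -- The bound is required at every `x`, also where the tangent is negative; hence the absolute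
  -- value in the integrand.
  · intro x
    rw [abs_of_nonneg (gCdf_nonneg _ (abs_nonneg _))]
    exact gCdf_le_one hN (abs_nonneg _)

/-- Apply Cauchy–Schwarz to the other `n - 1` coordinates, whose sum is `-z_i`. The inequality
determines which balls fit into the simplex. -/
lemma coord_sq_le (hn : 2 ≤ n) (z : zeroSum n) (i : Fin n) :
    n * (z : Fin n → ℝ) i ^ 2 ≤ (n - 1) * normSq z := by
  have h1 := Finset.add_sum_erase Finset.univ (fun i => (z : Fin n → ℝ) i) (Finset.mem_univ i)
  have h2 := Finset.add_sum_erase Finset.univ (fun i => (z : Fin n → ℝ) i ^ 2) (Finset.mem_univ i)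
  rw [sum_zeroSum] at h1
  have h3 := sq_sum_le_card_mul_sum_sq (s := Finset.univ.erase i) (f := (z : Fin n → ℝ))
  rw [Finset.card_erase_of_mem (Finset.mem_univ i), Finset.card_univ, Fintype.card_fin,
    Nat.cast_sub (by omega), Nat.cast_one] at h3
  rw [show ∑ j ∈ Finset.univ.erase i, (z : Fin n → ℝ) j = -(z : Fin n → ℝ) i by linarith] at h3
  rw [normSq, ← h2]
  linarith

lemma splitTan_pos (hn : 2 ≤ n) : 0 < splitTan n := by
  have : (2 : ℝ) ≤ n := by exact_mod_cast hn
  exact one_div_pos.2 (Real.sqrt_pos.2 (by linarith))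

lemma splitTan_sq (hn : 2 ≤ n) : splitTan n ^ 2 = 1 / ((n : ℝ) - 1) := by
  have : (2 : ℝ) ≤ n := by exact_mod_cast hn
  rw [splitTan, div_pow, Real.sq_sqrt (by linarith), one_pow]

/-- Near the diagonal, the distribution function of the tangent of the angle is the integral of a
polynomial over a ball. -/
lemma sampleLaw_tan_le {α : ℕ} (hα : 1 ≤ α) (hn : 2 ≤ n) {t : ℝ} (ht : 0 ≤ t)
    (ht' : t ≤ splitTan n) :
    (sampleLaw α n).real {x | Real.tan (diagAngle x) ≤ t} =
      sliceConst (show n ≠ 0 by omega) / Real.Gamma α ^ n *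
        (Real.Gamma (α * n : ℕ) / (n : ℝ) ^ (α * n)) *
        ∫ z in sqBall n ((Real.sqrt n * t) ^ 2), ∏ i, (1 + (z : Fin n → ℝ) i) ^ (α - 1)
          ∂(zeroSumVol n) := by
  have hn0 : n ≠ 0 := by omega
  have hN : 1 ≤ α * n := Nat.mul_pos hα (by omega)
  have hpos : (0 : ℝ) < n := by exact_mod_cast Nat.pos_of_ne_zero hn0
  have h2n : (2 : ℝ) ≤ n := by exact_mod_cast hn
  have hn' := Real.sqrt_pos.2 hpos
  have hS : MeasurableSet {x : Fin n → ℝ | Real.tan (diagAngle x) ≤ t} :=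
    measurableSet_le measurable_tan_diagAngle measurable_const
  rw [← integral_indicator_one hS,
    integral_gamma_sample hα hn (measurable_one.indicator hS)
      (fun x => by by_cases h : x ∈ {x : Fin n → ℝ | Real.tan (diagAngle x) ≤ t} <;> simp [h]),
    mul_assoc]
  congr 1
  rw [← integral_const_mul, ← integral_indicator (isClosed_sqBall _).measurableSet]
  refine integral_congr_ae (ae_of_all _ fun z => ?_)
  have hiff : z ∈ sqBall n ((Real.sqrt n * t) ^ 2) ↔ Real.sqrt (normSq z) / Real.sqrt n ≤ t := by
    rw [div_le_iff₀ hn', mul_comm t, Real.sqrt_le_left (by positivity)]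
    rfl
  by_cases h : z ∈ sqBall n ((Real.sqrt n * t) ^ 2)
  · have h1 : ∀ s ∈ Set.Ioi (0 : ℝ), s ^ (α * n - 1) * Real.exp (-(n * s)) *
        {x : Fin n → ℝ | Real.tan (diagAngle x) ≤ t}.indicator 1 (slice hn0 (s, s • z)) =
          s ^ (α * n - 1) * Real.exp (-(n * s)) := fun s hs => by
      rw [Set.indicator_of_mem]
      · simp
      · show Real.tan _ ≤ t
        rwa [tan_diagAngle_slice hn0 hs, ← hiff]
    -- The ball lies in the simplex: `|z|² ≤ nt²` and `t² ≤ 1/(n-1)` give `|z_i| ≤ 1`. This is where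
    -- the splitting value enters.
    have h2 : ∀ i, 0 ≤ 1 + (z : Fin n → ℝ) i := fun i => by
      have h3 := coord_sq_le hn z i
      have h4 : normSq z ≤ (Real.sqrt n * t) ^ 2 := h
      rw [mul_pow, Real.sq_sqrt hpos.le] at h4
      have h5 : t ^ 2 ≤ 1 / ((n : ℝ) - 1) := by
        rw [← splitTan_sq hn]
        gcongr
      rw [le_div_iff₀ (by linarith)] at h5
      have h6 : (n : ℝ) * (z : Fin n → ℝ) i ^ 2 ≤ n * 1 := by nlinarith
      have h7 : (z : Fin n → ℝ) i ^ 2 ≤ 1 := le_of_mul_le_mul_left h6 hpos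
      linarith [(abs_le.1 ((sq_le_one_iff_abs_le_one _).1 h7)).1]
    simp only
    rw [Set.indicator_of_mem h, setIntegral_congr_fun measurableSet_Ioi h1,
      integral_pow_mul_exp hN hpos, dirDens, Set.indicator_of_mem (by exact h2)]
    ring
  · have h1 : ∀ s ∈ Set.Ioi (0 : ℝ), s ^ (α * n - 1) * Real.exp (-(n * s)) *
        {x : Fin n → ℝ | Real.tan (diagAngle x) ≤ t}.indicator 1 (slice hn0 (s, s • z)) =
          0 := fun s hs => by
      rw [Set.indicator_of_notMem]
      · simp
      · show ¬ Real.tan _ ≤ t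
        rwa [tan_diagAngle_slice hn0 hs, ← hiff]
    simp only
    rw [Set.indicator_of_notMem h, setIntegral_congr_fun measurableSet_Ioi h1]
    simp

/-! ### Almost sure properties of the sample -/

lemma measurable_gammaPDF (a r : ℝ) : Measurable (gammaPDF a r) :=
  (measurable_gammaPDFReal a r).ennreal_ofReal

lemma ae_sampleLaw_pos {α : ℕ} (hα : 1 ≤ α) : ∀ᵐ x ∂(sampleLaw α n), ∀ i, 0 < x i := by
  have : IsProbabilityMeasure (gammaMeasure (α : ℝ) 1) :=
    isProbabilityMeasure_gammaMeasure (by exact_mod_cast hα) one_pos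
  rw [ae_all_iff]
  intro i
  have h : ∀ᵐ x ∂(gammaMeasure (α : ℝ) 1), 0 < x := by
    have h0 : ∀ᵐ x : ℝ, x ≠ 0 := by simp [ae_iff]
    rw [gammaMeasure, ae_withDensity_iff (measurable_gammaPDF _ _)]
    filter_upwards [h0] with x hx hx'
    by_contra h
    exact hx' (gammaPDF_of_neg (lt_of_le_of_ne (not_lt.1 h) hx))
  exact (measurePreserving_eval (fun _ : Fin n => gammaMeasure
    (α : ℝ) 1) i).quasiMeasurePreserving.ae h

lemma gammaMeasure_pos {α : ℕ} (hα : 1 ≤ α) {s : Set ℝ} (hs : IsOpen s) (hne : s.Nonempty)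
    (hs0 : s ⊆ Set.Ioi 0) : 0 < gammaMeasure (α : ℝ) 1 s := by
  rw [gammaMeasure, withDensity_apply _ hs.measurableSet, setLIntegral_pos_iff
    (measurable_gammaPDF _ _)]
  refine lt_of_lt_of_le (hs.measure_pos volume hne) (measure_mono fun x hx => ⟨?_, hx⟩)
  have := gammaPDFReal_pos (a := (α : ℝ)) (by exact_mod_cast hα) one_pos (hs0 hx)
  simp [gammaPDF, this]

/-- In dimension at least three the angle exceeds the splitting angle with positive probability. -/
lemma sampleLaw_splitTan_lt_pos {α : ℕ} (hα : 1 ≤ α) (hn : 3 ≤ n) :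
    0 < sampleLaw α n {x | splitTan n < Real.tan (diagAngle x)} := by
  have : IsProbabilityMeasure (gammaMeasure (α : ℝ) 1) :=
    isProbabilityMeasure_gammaMeasure (by exact_mod_cast hα) one_pos
  have hn0 : 0 < n := by omega
  have h3 : (3 : ℝ) ≤ n := by exact_mod_cast hn
  let i₀ : Fin n := ⟨0, hn0⟩
  -- Samples in this box are close to a coordinate axis, whose angle to the diagonal has tangent
  -- `√(n-1)`. The claim reduces to `(∑ x_i)² < (n-1) ∑ x_i²`; the bound `3n` makes the other
  -- coordinates contribute less than a third of the first one, and `16/9 < 2 ≤ n - 1`. For `n = 2`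
  -- the largest tangent equals the splitting value.
  let s : Fin n → Set ℝ := fun i => if i = i₀ then Set.Ioi (3 * n : ℝ) else Set.Ioo 0 1
  have hs : 0 < sampleLaw α n (Set.univ.pi s) := by
    rw [Measure.pi_pi]
    refine pos_iff_ne_zero.2 (Finset.prod_ne_zero_iff.2 fun i _ => (ne_of_gt ?_))
    by_cases h : i = i₀
    · simp only [s, h, if_true]
      exact gammaMeasure_pos hα isOpen_Ioi ⟨3 * n + 1, by simp⟩ (Set.Ioi_subset_Ioi (by positivity))
    · simp only [s, h, if_false]
      exact gammaMeasure_pos hα isOpen_Ioo ⟨1 / 2, by norm_num, by norm_num⟩ fun x hx => hx.1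
  refine hs.trans_le (measure_mono fun x hx => ?_)
  have h0 : 3 * (n : ℝ) < x i₀ := by
    have := hx i₀ trivial
    simpa [s] using this
  have h1 : ∀ i ≠ i₀, 0 < x i ∧ x i < 1 := fun i hi => by
    have := hx i trivial
    simpa [s, hi] using this
  have hsum := Finset.add_sum_erase Finset.univ x (Finset.mem_univ i₀)
  have hle : ∑ i ∈ Finset.univ.erase i₀, x i ≤ n := by
    calc _ ≤ ∑ i ∈ Finset.univ.erase i₀, (1 : ℝ) :=
          Finset.sum_le_sum fun i hi => (h1 i (Finset.ne_of_mem_erase hi)).2.le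
      _ = (n - 1 : ℕ) := by simp
      _ ≤ n := by exact_mod_cast Nat.sub_le _ _
  have hge : 0 ≤ ∑ i ∈ Finset.univ.erase i₀, x i :=
    Finset.sum_nonneg fun i hi => (h1 i (Finset.ne_of_mem_erase hi)).1.le
  have hT : 0 < ∑ i, x i := by linarith
  have hsq : x i₀ ^ 2 ≤ ∑ i, x i ^ 2 :=
    Finset.single_le_sum (f := fun i => x i ^ 2) (fun _ _ => sq_nonneg _) (Finset.mem_univ i₀)
  show splitTan n < Real.tan _
  rw [tan_diagAngle hT, lt_div_iff₀ hT, ← Real.sqrt_mul (by positivity)]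
  refine Real.lt_sqrt_of_sq_lt ?_
  rw [mul_pow, splitTan_sq (by omega), devSq_eq (by omega), mul_sub, mul_div_cancel₀ _
    (by positivity),
    lt_sub_iff_add_lt, one_div_mul_eq_div, div_add' _ _ _ (by linarith), div_lt_iff₀ (by linarith)]
  have hT' : ∑ i, x i ≤ 4 / 3 * x i₀ := by linarith
  have h4 : (∑ i, x i) ^ 2 ≤ (4 / 3 * x i₀) ^ 2 := by gcongr
  have h5 : 2 * x i₀ ^ 2 ≤ (n - 1) * ∑ i, x i ^ 2 := by
    have : 2 * x i₀ ^ 2 ≤ 2 * ∑ i, x i ^ 2 := by linarith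
    nlinarith [sq_nonneg (x i₀)]
  have h6 : 0 < x i₀ ^ 2 := by nlinarith
  nlinarith

end Consequences

/-! ### Homogeneous components of the density and the polynomial distribution function -/

section Coefficients

variable {n : ℕ}

open Polynomial in
/-- The density along a ray, as a polynomial in the distance from the diagonal. -/
noncomputable def rayPoly (α : ℕ) (z : zeroSum n) : Polynomial ℝ :=
  ∏ i, (1 + C ((z : Fin n → ℝ) i) * X) ^ (α - 1)

/-- The homogeneous components of the density. -/
noncomputable def rayCoeff (α j : ℕ) (z : zeroSum n) : ℝ := (rayPoly α z).coeff j

lemma eval_rayPoly (α : ℕ) (z : zeroSum n) (u : ℝ) :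
    (rayPoly α z).eval u = ∏ i, (1 + (z : Fin n → ℝ) i * u) ^ (α - 1) := by
  simp [rayPoly, Polynomial.eval_prod]

lemma natDegree_rayPoly_le (α : ℕ) (z : zeroSum n) :
    (rayPoly α z).natDegree ≤ (α - 1) * n := by
  refine (Polynomial.natDegree_prod_le _ _).trans ?_
  calc _ ≤ ∑ i : Fin n, (α - 1) := Finset.sum_le_sum fun i _ => by
        refine Polynomial.natDegree_pow_le.trans ?_
        have : (1 + Polynomial.C ((z : Fin n → ℝ) i) * Polynomial.X).natDegree ≤ 1 := by
          compute_degree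
        nlinarith
    _ = _ := by simp [mul_comm]

lemma rayCoeff_smul (α j : ℕ) (r : ℝ) (z : zeroSum n) :
    rayCoeff α j (r • z) = r ^ j * rayCoeff α j z := by
  have h : rayPoly α (r • z) = (rayPoly α z).comp (Polynomial.C r * Polynomial.X) := by
    simp only [rayPoly, Polynomial.prod_comp, Polynomial.pow_comp, Polynomial.add_comp,
      Polynomial.one_comp, Polynomial.mul_comp, Polynomial.C_comp, Polynomial.X_comp]
    refine Finset.prod_congr rfl fun i _ => ?_
    simp
    ring
  rw [rayCoeff, h, Polynomial.comp_C_mul_X_coeff, mul_comm]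
  rfl

/-- Continuity of all coefficients passes from polynomial factors to products and powers. -/
lemma continuous_rayCoeff (α j : ℕ) : Continuous (rayCoeff (n := n) α j) := by
  have hmul : ∀ p q : zeroSum n → Polynomial ℝ, (∀ j, Continuous fun z => (p z).coeff j) →
      (∀ j, Continuous fun z => (q z).coeff j) → ∀ j, Continuous fun z => (p z * q z).coeff j :=
    fun p q hp hq j => by
      simp_rw [Polynomial.coeff_mul]
      exact continuous_finsetSum _ fun k _ => (hp _).mul (hq _)
  have hone : ∀ j, Continuous fun _ : zeroSum n => (1 : Polynomial ℝ).coeff j :=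
    fun _ => continuous_const
  have hpow : ∀ p : zeroSum n → Polynomial ℝ, (∀ j, Continuous fun z => (p z).coeff j) →
      ∀ k j, Continuous fun z => (p z ^ k).coeff j := fun p hp k => by
    induction k with
    | zero => simpa using hone
    | succ k ih => simpa only [pow_succ] using hmul _ _ ih hp
  have hfac : ∀ (i : Fin n) (j : ℕ), Continuous fun z : zeroSum n =>
      (1 + Polynomial.C ((z : Fin n → ℝ) i) * Polynomial.X).coeff j := fun i j => by
    simp only [Polynomial.coeff_add, Polynomial.coeff_C_mul]
    exact continuous_const.add ((continuous_coord i).mul continuous_const)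
  have hprod : ∀ (S : Finset (Fin n)) (j : ℕ), Continuous fun z : zeroSum n =>
      (∏ i ∈ S, (1 + Polynomial.C ((z : Fin n → ℝ) i) * Polynomial.X) ^ (α - 1)).coeff j :=
    fun S => by
      induction S using Finset.induction_on with
      | empty => simpa using hone
      | insert i S hi ih =>
        simpa only [Finset.prod_insert hi] using hmul _ _ (hpow _ (hfac i) _) ih
  exact hprod Finset.univ j

lemma prod_one_add_eq (α : ℕ) (z : zeroSum n) :
    ∏ i, (1 + (z : Fin n → ℝ) i) ^ (α - 1) =
      ∑ j ∈ Finset.range ((α - 1) * n + 1), rayCoeff α j z := by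
  have h := eval_rayPoly α z 1
  rw [Polynomial.eval_eq_sum_range' (Nat.lt_succ_of_le (natDegree_rayPoly_le α z))] at h
  simpa [rayCoeff] using h.symm

lemma prod_add_eq (α : ℕ) (s : ℝ) (z : zeroSum n) :
    ∏ i, (s + (z : Fin n → ℝ) i) ^ (α - 1) =
      ∑ j ∈ Finset.range ((α - 1) * n + 1), rayCoeff α j z * s ^ ((α - 1) * n - j) := by
  have hc : (fun s : ℝ => ∏ i, (s + (z : Fin n → ℝ) i) ^ (α - 1)) =
      fun s => ∑ j ∈ Finset.range ((α - 1) * n + 1), rayCoeff α j z * s ^ ((α - 1) * n - j) := by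
    -- For `s ≠ 0` evaluate the ray polynomial at `1/s` and multiply by `s^((α-1)n)`; continuity
    -- covers `s = 0`.
    refine Continuous.ext_on (dense_compl_singleton (0 : ℝ)) (by fun_prop) (by fun_prop) ?_
    intro s hs
    have hs : s ≠ 0 := hs
    have h := eval_rayPoly α z s⁻¹
    rw [Polynomial.eval_eq_sum_range' (Nat.lt_succ_of_le (natDegree_rayPoly_le α z))] at h
    have h1 : ∀ i, (s + (z : Fin n → ℝ) i) ^ (α - 1) =
        s ^ (α - 1) * (1 + (z : Fin n → ℝ) i * s⁻¹) ^ (α - 1) := fun i => by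
      rw [← mul_pow]
      congr 1
      field_simp
    simp only [h1]
    rw [Finset.prod_mul_distrib, ← h, Finset.prod_const, Finset.card_univ, Fintype.card_fin,
      ← pow_mul, Finset.mul_sum]
    refine Finset.sum_congr rfl fun j hj => ?_
    rw [rayCoeff, pow_sub₀ _ hs (by simpa [Nat.lt_succ_iff] using hj), inv_pow]
    ring
  exact congr_fun hc s

/-- The integral of a homogeneous component over the unit ball. -/
noncomputable def rayMoment (α n j : ℕ) : ℝ := ∫ z in sqBall n 1, rayCoeff α j z ∂(zeroSumVol n)

/-- The reflection `z ↦ -z` preserves the ball and the measure and changes the sign of an odd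
component. Hence only coefficients of even index occur. -/
lemma rayMoment_of_odd (α n : ℕ) {j : ℕ} (hj : Odd j) : rayMoment α n j = 0 := by
  have h : ∫ z, (sqBall n 1).indicator (rayCoeff α j) z ∂(zeroSumVol n) =
      -∫ z, (sqBall n 1).indicator (rayCoeff α j) z ∂(zeroSumVol n) := by
    conv_lhs => rw [← integral_neg_eq_self]
    rw [← integral_neg]
    refine integral_congr_ae (ae_of_all _ fun z => ?_)
    have h1 : -z ∈ sqBall n 1 ↔ z ∈ sqBall n 1 := by
      simp [sqBall, normSq]
    have h2 : rayCoeff α j (-z) = -rayCoeff α j z := by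
      rw [← neg_one_smul ℝ z, rayCoeff_smul, hj.neg_one_pow, neg_one_mul]
    by_cases h : z ∈ sqBall n 1
    · simp only [Set.indicator_of_mem h, Set.indicator_of_mem (h1.2 h), h2]
    · simp only [Set.indicator_of_notMem h, Set.indicator_of_notMem (mt h1.1 h), neg_zero]
  rw [rayMoment, ← integral_indicator (isClosed_sqBall _).measurableSet]
  linarith

lemma sum_range_of_odd_eq_zero (K : ℕ) {f : ℕ → ℝ} (hf : ∀ j, Odd j → f j = 0) :
    ∑ j ∈ Finset.range (K + 1), f j = ∑ i : Fin (K / 2 + 1), f (2 * (i : ℕ)) := by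
  rw [Fin.sum_univ_eq_sum_range (fun i => f (2 * i))]
  symm
  refine Finset.sum_of_injOn (fun i => 2 * i) (fun a _ b _ h => by simpa using h) ?_ ?_
    (fun _ _ => rfl)
  · intro i hi
    simp only [Finset.coe_range, Set.mem_Iio] at hi ⊢
    omega
  · intro j hj hj'
    refine hf j (Nat.not_even_iff_odd.1 fun ⟨i, hi⟩ => hj' ⟨i, ?_, by simp only; omega⟩)
    simp only [Finset.coe_range, Set.mem_Iio, Finset.mem_range] at hj ⊢
    omega

/-- The coefficients `a_{α,n,2j}` of the density of `tan Φ`. -/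
noncomputable def angleCoeff (α : ℕ) (hn : n ≠ 0) (j : ℕ) : ℝ :=
  sliceConst hn * ((n : ℝ) - 1 + 2 * j) * rayMoment α n (2 * j) *
    Real.sqrt n ^ (n - 1 + 2 * j) / Real.sqrt n ^ (α * n)

lemma normConst_eq {α : ℕ} (n : ℕ) :
    normConst α n = Real.Gamma (α * n : ℕ) / (Real.Gamma α ^ n * Real.sqrt n ^ (α * n)) := by
  rw [normConst, Real.sqrt_eq_rpow, ← Real.rpow_natCast (_ ^ (1 / 2 : ℝ)), ← Real.rpow_mul
    (by positivity)]
  push_cast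
  congr 3
  ring

/-- The distribution function of `tan Φ` near zero. -/
lemma sampleLaw_tan_le_eq_polyW {α : ℕ} (hα : 1 ≤ α) (hn : 2 ≤ n) {t : ℝ} (ht : 0 ≤ t)
    (ht' : t ≤ splitTan n) :
    (sampleLaw α n).real {x | Real.tan (diagAngle x) ≤ t} =
      polyW α n (fun j => angleCoeff α (show n ≠ 0 by omega) j) t := by
  have hpos : (0 : ℝ) < n := by exact_mod_cast (show 0 < n by omega)
  have h2n : (2 : ℝ) ≤ n := by exact_mod_cast hn
  have hn' := Real.sqrt_pos.2 hpos
  have hG := gamma_natCast_pos hα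
  rw [sampleLaw_tan_le hα hn ht ht']
  simp_rw [prod_one_add_eq]
  rw [integral_finsetSum _ fun j _ =>
    (continuous_rayCoeff α j).continuousOn.integrableOn_compact (isCompact_sqBall _)]
  simp_rw [setIntegral_sqBall hn (fun r _ y => rayCoeff_smul α _ r y)
    (show 0 ≤ Real.sqrt n * t by positivity)]
  change _ * ∑ j ∈ Finset.range ((α - 1) * n + 1), (Real.sqrt n * t) ^ (n - 1 + j) *
    rayMoment α n j = _
  rw [sum_range_of_odd_eq_zero ((α - 1) * n)
    (f := fun j => (Real.sqrt n * t) ^ (n - 1 + j) * rayMoment α n j)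
    (fun j hj => by simp only [rayMoment_of_odd α n hj, mul_zero])]
  rw [polyW, normConst_eq, Finset.mul_sum, Finset.mul_sum]
  refine Finset.sum_congr rfl fun j _ => ?_
  have h3 : (0 : ℝ) < (n : ℝ) - 1 + 2 * (j : ℕ) := by
    have : (0 : ℝ) ≤ (j : ℕ) := Nat.cast_nonneg _
    linarith
  -- One half of this power belongs to `normConst`, the other to `angleCoeff`.
  have h4 : (n : ℝ) ^ (α * n) = Real.sqrt n ^ (α * n) * Real.sqrt n ^ (α * n) := by
    rw [← mul_pow, Real.mul_self_sqrt hpos.le]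
  rw [angleCoeff, h4, mul_pow]
  field_simp

end Coefficients

/-! ### The linear equations -/

lemma integrable_pow_mul_exp_neg_sq (k : ℕ) {b : ℝ} (hb : 0 < b) :
    Integrable fun x : ℝ => x ^ k * Real.exp (-(b * x ^ 2)) := by
  have h := integrable_rpow_mul_exp_neg_mul_sq hb (s := k)
    (lt_of_lt_of_le (by norm_num) (Nat.cast_nonneg k))
  simpa [Real.rpow_natCast] using h

lemma integral_even_pow_mul_exp_neg_sq (k : ℕ) {b : ℝ} (hb : 0 < b) :
    ∫ x : ℝ, x ^ (2 * k) * Real.exp (-(b * x ^ 2)) =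
      Real.Gamma (1 / 2 + k) / Real.sqrt b ^ (2 * k + 1) := by
  have h1 := integral_comp_abs (f := fun x => x ^ (2 * k) * Real.exp (-(b * x ^ 2)))
  simp only [pow_mul, sq_abs] at h1
  simp only [pow_mul]
  rw [h1]
  have h := integral_rpow_mul_exp_neg_mul_rpow (p := 2) (q := (2 * k : ℕ)) two_pos
    (lt_of_lt_of_le (by norm_num) (Nat.cast_nonneg _)) hb
  have h2 : ∀ x : ℝ, x ^ ((2 * k : ℕ) : ℝ) * Real.exp (-b * x ^ (2 : ℝ)) =
      (x ^ 2) ^ k * Real.exp (-(b * x ^ 2)) := fun x => by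
    rw [Real.rpow_natCast, pow_mul, Real.rpow_two, neg_mul]
  simp_rw [h2] at h
  rw [h, Real.sqrt_eq_rpow, ← Real.rpow_natCast (_ ^ (1 / 2 : ℝ)), ← Real.rpow_mul hb.le,
    show -(((2 * k : ℕ) : ℝ) + 1) / 2 = -(1 / 2 * ((2 * k + 1 : ℕ) : ℝ)) by push_cast; ring,
    Real.rpow_neg hb.le, show (((2 * k : ℕ) : ℝ) + 1) / 2 = 1 / 2 + k by push_cast; ring]
  ring

lemma integral_odd_pow_mul_exp_neg_sq {k : ℕ} (hk : Odd k) (b : ℝ) :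
    ∫ x : ℝ, x ^ k * Real.exp (-(b * x ^ 2)) = 0 := by
  have h : ∫ x : ℝ, x ^ k * Real.exp (-(b * x ^ 2)) =
      -∫ x : ℝ, x ^ k * Real.exp (-(b * x ^ 2)) := by
    conv_lhs => rw [← integral_neg_eq_self]
    rw [← integral_neg]
    refine integral_congr_ae (ae_of_all _ fun x => ?_)
    simp only [hk.neg_pow, neg_sq, neg_mul]
  linarith

section LinearEquations

variable {n : ℕ}

/-- The Gaussian integral from which the linear equations are derived. -/
noncomputable def gaussMoment (α n p : ℕ) : ℝ :=
  ∫ x : Fin n → ℝ, (∏ i, x i ^ (α - 1)) * (∑ i, x i) ^ p * Real.exp (-∑ i, x i ^ 2)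

lemma gaussMoment_eq_multinomial (α p : ℕ) :
    gaussMoment α n p = ∑ k ∈ Finset.piAntidiag (Finset.univ : Finset (Fin n)) p,
      (Nat.multinomial Finset.univ k : ℝ) *
        ∏ i, ∫ x : ℝ, x ^ (α - 1 + k i) * Real.exp (-(1 * x ^ 2)) := by
  have h : ∀ x : Fin n → ℝ, (∏ i, x i ^ (α - 1)) * (∑ i, x i) ^ p * Real.exp (-∑ i, x i ^ 2) =
      ∑ k ∈ Finset.piAntidiag (Finset.univ : Finset (Fin n)) p,
        (Nat.multinomial Finset.univ k : ℝ) *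
          ∏ i, (x i ^ (α - 1 + k i) * Real.exp (-(1 * x i ^ 2))) := fun x => by
    rw [Finset.sum_pow_eq_sum_piAntidiag, Finset.mul_sum, Finset.sum_mul]
    refine Finset.sum_congr rfl fun k _ => ?_
    simp only [pow_add, Finset.prod_mul_distrib, one_mul]
    rw [← Real.exp_sum, Finset.sum_neg_distrib]
    ring
  simp_rw [gaussMoment, h]
  rw [integral_finsetSum]
  · refine Finset.sum_congr rfl fun k _ => ?_
    rw [integral_const_mul, integral_fintype_prod_volume_eq_prod
      (fun i (x : ℝ) => x ^ (α - 1 + k i) * Real.exp (-(1 * x ^ 2)))]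
  · intro k _
    refine Integrable.const_mul ?_ _
    exact Integrable.fintype_prod
      (f := fun i (x : ℝ) => x ^ (α - 1 + k i) * Real.exp (-(1 * x ^ 2)))
      fun i => integrable_pow_mul_exp_neg_sq _ one_pos

/-- The number `δ` encodes the parity of `α` and treats both cases at once: `δ = 0` for `α = 2β + 1`
and `δ = 1` for `α = 2β`. A one-dimensional Gaussian moment vanishes unless its exponent `α - 1 +
k_i` is even, that is, unless `k_i = 2c_i + δ`; the total degree `2m + nδ` is chosen accordingly. -/
lemma gaussMoment_eq_sum {α β δ : ℕ} (hα : 1 ≤ α) (hαβ : α + δ = 2 * β + 1) (hδ : δ ≤ 1) (m : ℕ) :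
    gaussMoment α n (2 * m + n * δ) = ((2 * m + n * δ)! : ℝ) *
      ∑ c ∈ Finset.piAntidiag (Finset.univ : Finset (Fin n)) m,
        ∏ i, Real.Gamma (1 / 2 + β + c i) / ((2 * c i + δ)! : ℝ) := by
  rw [gaussMoment_eq_multinomial, Finset.mul_sum]
  symm
  have hinj : Function.Injective fun (c : Fin n → ℕ) i => 2 * c i + δ := fun a b hab => by
    ext i
    have := congr_fun hab i
    simp only at this
    omega
  refine Finset.sum_of_injOn (fun c i => 2 * c i + δ) hinj.injOn ?_ ?_ ?_
  · intro c hc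
    simp only [Finset.mem_coe, Finset.mem_piAntidiag] at hc ⊢
    refine ⟨?_, fun _ _ => Finset.mem_univ _⟩
    rw [Finset.sum_add_distrib, ← Finset.mul_sum, hc.1]
    simp
  · intro k hk hk'
    by_cases hodd : ∃ i, Odd (α - 1 + k i)
    · obtain ⟨i, hi⟩ := hodd
      rw [Finset.prod_eq_zero (Finset.mem_univ i) (integral_odd_pow_mul_exp_neg_sq hi 1), mul_zero]
    · push Not at hodd
      refine absurd ⟨fun i => (k i - δ) / 2, ?_, ?_⟩ hk'
      · have hpar : ∀ i, 2 * ((k i - δ) / 2) + δ = k i := fun i => by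
          obtain ⟨l, hl⟩ := Nat.not_odd_iff_even.1 (hodd i)
          omega
        simp only [Finset.mem_coe, Finset.mem_piAntidiag] at hk ⊢
        refine ⟨?_, fun _ _ => Finset.mem_univ _⟩
        have h1 : ∑ i, (2 * ((k i - δ) / 2) + δ) = 2 * m + n * δ := by
          rw [Finset.sum_congr rfl fun i _ => hpar i]
          exact hk.1
        rw [Finset.sum_add_distrib, ← Finset.mul_sum] at h1
        simp at h1
        exact h1
      · ext i
        obtain ⟨l, hl⟩ := Nat.not_odd_iff_even.1 (hodd i)
        simp only
        omega
  · intro c hc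
    simp only [Finset.mem_piAntidiag] at hc
    have hmom : ∀ i, ∫ x : ℝ, x ^ (α - 1 + (2 * c i + δ)) * Real.exp (-(1 * x ^ 2)) =
        Real.Gamma (1 / 2 + β + c i) := fun i => by
      rw [show α - 1 + (2 * c i + δ) = 2 * (β + c i) by omega,
        integral_even_pow_mul_exp_neg_sq _ one_pos]
      push_cast
      rw [Real.sqrt_one, one_pow, div_one, add_assoc]
    simp only [hmom]
    have hms := Nat.multinomial_spec (Finset.univ : Finset (Fin n)) (fun i => 2 * c i + δ)
    rw [Finset.sum_add_distrib, ← Finset.mul_sum, hc.1] at hms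
    simp only [Finset.sum_const, Finset.card_univ, Fintype.card_fin, smul_eq_mul] at hms
    rw [← hms, Finset.prod_div_distrib]
    push_cast
    have : ∏ i, ((2 * c i + δ)! : ℝ) ≠ 0 :=
      Finset.prod_ne_zero_iff.2 fun i _ => by exact_mod_cast Nat.factorial_ne_zero _
    field_simp

/-- On a slice the coordinate sum is `ns` and the squared norm is `ns² + |z|²`, so each homogeneous
component of the product separates into an `s`-integral and an integral over the hyperplane. -/
lemma gaussMoment_eq_slice (α p : ℕ) (hn : 2 ≤ n) :
    gaussMoment α n p = sliceConst (show n ≠ 0 by omega) *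
      ∑ j ∈ Finset.range ((α - 1) * n + 1), (n : ℝ) ^ p *
        ((∫ s : ℝ, s ^ ((α - 1) * n - j + p) * Real.exp (-(n * s ^ 2))) *
          (Real.Gamma (((n : ℝ) - 1 + j) / 2 + 1) * rayMoment α n j)) := by
  have hn0 : n ≠ 0 := by omega
  have hpos : (0 : ℝ) < n := by exact_mod_cast (show 0 < n by omega)
  rw [gaussMoment, integral_eq_slice hn0]
  congr 1
  have h : ∀ q : ℝ × zeroSum n, (∏ i, slice hn0 q i ^ (α - 1)) * (∑ i, slice hn0 q i) ^ p *
      Real.exp (-∑ i, slice hn0 q i ^ 2) = ∑ j ∈ Finset.range ((α - 1) * n + 1),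
        (n : ℝ) ^ p * ((q.1 ^ ((α - 1) * n - j + p) * Real.exp (-(n * q.1 ^ 2))) *
          (rayCoeff α j q.2 * Real.exp (-normSq q.2))) := fun q => by
    simp only [sum_slice, sum_sq_slice]
    simp only [slice_apply]
    rw [prod_add_eq, neg_add, Real.exp_add, mul_pow, Finset.sum_mul, Finset.sum_mul]
    refine Finset.sum_congr rfl fun j _ => ?_
    rw [pow_add]
    ring
  simp_rw [h]
  rw [integral_finsetSum]
  · refine Finset.sum_congr rfl fun j _ => ?_
    rw [integral_const_mul, integral_prod_mul (fun s : ℝ => s ^ ((α - 1) * n - j + p) *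
      Real.exp (-(n * s ^ 2))) (fun z : zeroSum n => rayCoeff α j z * Real.exp (-normSq z)),
      (integral_mul_exp_neg_normSq hn (continuous_rayCoeff α j)
        fun r _ y => rayCoeff_smul α j r y).2]
    rfl
  · intro j _
    refine Integrable.const_mul ?_ _
    exact (integrable_pow_mul_exp_neg_sq _ hpos).mul_prod
      (integral_mul_exp_neg_normSq hn (continuous_rayCoeff α j)
        fun r _ y => rayCoeff_smul α j r y).1

lemma gaussMoment_eq_angleCoeff {α β δ : ℕ} (hα : 1 ≤ α) (hαβ : α + δ = 2 * β + 1)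
    (hn : 2 ≤ n) (m : ℕ) :
    2 * gaussMoment α n (2 * m + n * δ) / Real.sqrt n ^ (2 * m + n * δ) =
      ∑ j : Fin (degBound α n + 1), Real.Gamma (1 / 2 + β * n + m - (j : ℕ)) *
        Real.Gamma (((n : ℝ) - 1) / 2 + (j : ℕ)) * angleCoeff α (show n ≠ 0 by omega) j := by
  have hn0 : n ≠ 0 := by omega
  have hpos : (0 : ℝ) < n := by exact_mod_cast (show 0 < n by omega)
  have h2n : (2 : ℝ) ≤ n := by exact_mod_cast hn
  have hsq := Real.sqrt_pos.2 hpos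
  rw [gaussMoment_eq_slice _ _ hn, sum_range_of_odd_eq_zero ((α - 1) * n)
    (f := fun j => (n : ℝ) ^ (2 * m + n * δ) *
        ((∫ s : ℝ, s ^ ((α - 1) * n - j + (2 * m + n * δ)) * Real.exp (-(n * s ^ 2))) *
          (Real.Gamma (((n : ℝ) - 1 + j) / 2 + 1) * rayMoment α n j)))
    (fun j hj => by simp only [rayMoment_of_odd α n hj, mul_zero]),
    Finset.mul_sum, Finset.mul_sum, Finset.sum_div]
  refine Finset.sum_congr rfl fun j _ => ?_
  have hj : 2 * (j : ℕ) ≤ (α - 1) * n := by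
    have := j.2
    omega
  have hK : (α - 1) * n + n * δ = 2 * (β * n) := by
    obtain ⟨a, rfl⟩ : ∃ a, α = a + 1 := ⟨α - 1, by omega⟩
    rw [Nat.add_sub_cancel]
    have : a + δ = 2 * β := by omega
    calc a * n + n * δ = (a + δ) * n := by ring
      _ = _ := by rw [this]; ring
  have hjm : (j : ℕ) ≤ β * n + m := by omega
  -- The exponent of `s` is even by the choice of the degree `2m + nδ`, so the `s`-integral is a
  -- gamma value and does not vanish.
  rw [show (α - 1) * n - 2 * (j : ℕ) + (2 * m + n * δ) = 2 * (β * n + m - (j : ℕ)) by omega,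
    integral_even_pow_mul_exp_neg_sq _ hpos, angleCoeff]
  have h1 : (1 / 2 + ((β * n + m - (j : ℕ) : ℕ) : ℝ)) = 1 / 2 + β * n + m - (j : ℕ) := by
    rw [Nat.cast_sub hjm]
    push_cast
    ring
  have hj0 : (0 : ℝ) ≤ (j : ℕ) := Nat.cast_nonneg _
  have h2 : Real.Gamma (((n : ℝ) - 1 + (2 * (j : ℕ) : ℕ)) / 2 + 1) =
      ((n : ℝ) - 1 + 2 * (j : ℕ)) / 2 * Real.Gamma (((n : ℝ) - 1) / 2 + (j : ℕ)) := by
    rw [show ((n : ℝ) - 1 + (2 * (j : ℕ) : ℕ)) / 2 = ((n : ℝ) - 1) / 2 + (j : ℕ) by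
      push_cast; ring, Real.Gamma_add_one (by
        have : (0 : ℝ) < (n - 1) / 2 + (j : ℕ) := by linarith
        exact this.ne')]
    ring
  rw [h1, h2]
  have h3 : (n : ℝ) ^ (2 * m + n * δ) =
      Real.sqrt n ^ (2 * m + n * δ) * Real.sqrt n ^ (2 * m + n * δ) := by
    rw [← mul_pow, Real.mul_self_sqrt hpos.le]
  have hpow : Real.sqrt n ^ (2 * m + n * δ) * Real.sqrt n ^ (α * n) =
      Real.sqrt n ^ (n - 1 + 2 * (j : ℕ)) *
        Real.sqrt n ^ (2 * (β * n + m - (j : ℕ)) + 1) := by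
    rw [← pow_add, ← pow_add]
    congr 1
    have : α * n = (α - 1) * n + n := by
      obtain ⟨a, rfl⟩ : ∃ a, α = a + 1 := ⟨α - 1, by omega⟩
      rw [Nat.add_sub_cancel]
      ring
    omega
  have e1 : Real.sqrt n ^ (2 * m + n * δ) / Real.sqrt n ^ (2 * (β * n + m - (j : ℕ)) + 1) =
      Real.sqrt n ^ (n - 1 + 2 * (j : ℕ)) / Real.sqrt n ^ (α * n) := by
    rw [div_eq_div_iff (by positivity) (by positivity), hpow]
  have h4 : Real.sqrt n ^ (2 * m + n * δ) ≠ 0 := by positivity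
  rw [h3, mul_div_assoc (_ * _ * _) (Real.sqrt n ^ (n - 1 + 2 * (j : ℕ))), ← e1]
  field_simp

lemma coeffRhs_eq_gaussMoment {α β δ : ℕ} (hα : 1 ≤ α) (hαβ : α + δ = 2 * β + 1) (hδ : δ ≤ 1)
    (n m : ℕ) :
    coeffRhs α n m = 2 * gaussMoment α n (2 * m + n * δ) / Real.sqrt n ^ (2 * m + n * δ) := by
  rw [gaussMoment_eq_sum hα hαβ hδ, coeffRhs, show α / 2 = β by omega]
  obtain rfl | rfl : δ = 0 ∨ δ = 1 := by omega
  · rw [if_pos (show Odd α from ⟨β, hαβ⟩), mul_zero, add_zero, pow_mul, Real.sq_sqrt n.cast_nonneg]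
    simp only [add_zero]
    ring
  · rw [if_neg (by rw [Nat.not_odd_iff_even]; exact ⟨β, by omega⟩), mul_one, pow_add, pow_mul,
      Real.sq_sqrt n.cast_nonneg, Real.sqrt_eq_rpow, ← Real.rpow_natCast (_ ^ (1 / 2 : ℝ)),
      ← Real.rpow_mul n.cast_nonneg, show (1 / 2 * (n : ℝ)) = n / 2 by ring]
    rcases Nat.eq_zero_or_pos n with rfl | h
    · simp
      rcases Nat.eq_zero_or_pos m with rfl | h
      · simp
      · simp [h.ne']
    · rw [Real.rpow_add (by exact_mod_cast h), Real.rpow_natCast]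
      ring

lemma isCoeff_angleCoeff {α : ℕ} (hα : 1 ≤ α) (hn : 2 ≤ n) :
    IsCoeff α n fun j => angleCoeff α (show n ≠ 0 by omega) j := by
  intro m _
  obtain ⟨δ, hδ, h⟩ : ∃ δ ≤ 1, α + δ = 2 * (α / 2) + 1 := by
    rcases Nat.even_or_odd' α with ⟨k, h | h⟩
    · exact ⟨1, le_rfl, by omega⟩
    · exact ⟨0, zero_le_one, by omega⟩
  rw [coeffRhs_eq_gaussMoment hα h hδ, gaussMoment_eq_angleCoeff hα h hn]

end LinearEquations

/-- Hankel matrices of values of the gamma function are regular. -/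
lemma eq_zero_of_sum_gamma_eq_zero {c : ℝ} (hc : 0 < c) (N : ℕ) (v : ℕ → ℝ)
    (h : ∀ m ≤ N, ∑ j ∈ Finset.range (N + 1), Real.Gamma (c + m + j) * v j = 0) :
    ∀ j ≤ N, v j = 0 := by
  -- The quadratic form of the matrix at `v` is the integral of `p(x)² x^(c-1) exp(-x)` over `x >
  -- 0`. If it is zero, `p` vanishes almost everywhere on a half-line and is the zero polynomial.
  let p : Polynomial ℝ := ∑ j ∈ Finset.range (N + 1), Polynomial.C (v j) * Polynomial.X ^ j
  have hp : ∀ x, p.eval x = ∑ j ∈ Finset.range (N + 1), v j * x ^ j := fun x => by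
    simp [p, Polynomial.eval_finsetSum]
  have hG : ∀ k : ℕ, IntegrableOn (fun x : ℝ => x ^ k * (Real.exp (-x) * x ^ (c - 1))) (Set.Ioi 0) ∧
      ∫ x in Set.Ioi (0 : ℝ), x ^ k * (Real.exp (-x) * x ^ (c - 1)) = Real.Gamma
        (c + k) := fun k => by
    have hck : 0 < c + k := by positivity
    have hfun : ∀ x ∈ Set.Ioi (0 : ℝ), Real.exp (-x) * x ^ (c + k - 1) =
        x ^ k * (Real.exp (-x) * x ^ (c - 1)) := fun x hx => by
      rw [show c + k - 1 = c - 1 + k by ring, Real.rpow_add hx, Real.rpow_natCast]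
      ring
    refine ⟨(integrableOn_congr_fun hfun measurableSet_Ioi).1
      (Real.GammaIntegral_convergent hck), ?_⟩
    rw [Real.Gamma_eq_integral hck, setIntegral_congr_fun measurableSet_Ioi hfun]
  have hsq : ∀ x, p.eval x ^ 2 * (Real.exp (-x) * x ^ (c - 1)) =
      ∑ m ∈ Finset.range (N + 1), ∑ j ∈ Finset.range (N + 1),
        v m * v j * (x ^ (m + j) * (Real.exp (-x) * x ^ (c - 1))) := fun x => by
    rw [sq, hp, Finset.sum_mul_sum, Finset.sum_mul]
    refine Finset.sum_congr rfl fun m _ => ?_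
    rw [Finset.sum_mul]
    refine Finset.sum_congr rfl fun j _ => ?_
    ring
  have hint : IntegrableOn (fun x => p.eval x ^ 2 * (Real.exp (-x) * x ^ (c - 1))) (Set.Ioi 0) := by
    simp_rw [hsq]
    exact integrable_finsetSum _ fun m _ => integrable_finsetSum _ fun j _ => (hG _).1.const_mul _
  have h0 : ∫ x in Set.Ioi (0 : ℝ), p.eval x ^ 2 * (Real.exp (-x) * x ^ (c - 1)) = 0 := by
    simp_rw [hsq]
    rw [integral_finsetSum _ fun m _ => integrable_finsetSum _ fun j _ => (hG _).1.const_mul _]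
    refine Finset.sum_eq_zero fun m hm => ?_
    rw [integral_finsetSum _ fun j _ => (hG _).1.const_mul _]
    have := h m (Nat.lt_succ_iff.1 (Finset.mem_range.1 hm))
    simp_rw [integral_const_mul, (hG _).2]
    rw [← mul_zero (v m), ← this, Finset.mul_sum]
    refine Finset.sum_congr rfl fun j _ => ?_
    push_cast
    rw [add_assoc]
    ring
  rw [setIntegral_eq_zero_iff_of_nonneg_ae ((ae_restrict_iff' measurableSet_Ioi).2
    (ae_of_all _ fun x hx => mul_nonneg (sq_nonneg _)
      (mul_nonneg (Real.exp_pos _).le (Real.rpow_nonneg (le_of_lt hx) _)))) hint] at h0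
  have hp0 : p = 0 := by
    by_contra hne
    have hae : ∀ᵐ x ∂(volume.restrict (Set.Ioi (0 : ℝ))), p.IsRoot x := by
      filter_upwards [h0, ae_restrict_mem measurableSet_Ioi] with x hx hx'
      have h1 : Real.exp (-x) * x ^ (c - 1) ≠ 0 :=
        (mul_pos (Real.exp_pos _) (Real.rpow_pos_of_pos hx' _)).ne'
      exact pow_eq_zero_iff two_ne_zero |>.1 ((mul_eq_zero.1 hx).resolve_right h1)
    have hfin : volume.restrict (Set.Ioi (0 : ℝ)) {x | p.IsRoot x} = 0 :=
      (Polynomial.finite_setOfPred_isRoot hne).measure_zero _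
    have h2 : volume.restrict (Set.Ioi (0 : ℝ)) Set.univ = 0 := by
      rw [← Set.union_compl_self {x | p.IsRoot x}]
      exact measure_union_null hfin hae
    simp at h2
  intro j hj
  have := congr_arg (fun q => Polynomial.coeff q j) hp0
  simpa [p, Polynomial.finsetSum_coeff, Polynomial.coeff_C_mul, Polynomial.coeff_X_pow,
    Nat.lt_succ_iff.2 hj] using this

/-- Reversing the index `j` turns the first gamma factor into the Hankel form `Γ(c + m + j)`, where
`c > 0` since `degBound α n ≤ (α/2) n`. The second gamma factor is nonzero and is absorbed into the
unknowns. -/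
lemma IsCoeff.unique {α n : ℕ} (hn : 2 ≤ n) {a b : Fin (degBound α n + 1) → ℝ}
    (ha : IsCoeff α n a) (hb : IsCoeff α n b) : b = a := by
  have h2n : (2 : ℝ) ≤ n := by exact_mod_cast hn
  have hNle : degBound α n ≤ α / 2 * n := by
    rw [degBound, Nat.div_le_iff_le_mul_add_pred two_pos]
    rcases Nat.even_or_odd' α with ⟨k, h | h⟩
    · rw [h, Nat.mul_div_cancel_left _ two_pos]
      have : (2 * k - 1) * n ≤ 2 * k * n := Nat.mul_le_mul_right _ (Nat.sub_le _ _)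
      nlinarith
    · rw [h, show (2 * k + 1) / 2 = k by omega, Nat.add_sub_cancel]
      nlinarith
  let v : ℕ → ℝ := fun j => if h : degBound α n - j < degBound α n + 1 then
    Real.Gamma (((n : ℝ) - 1) / 2 + (degBound α n - j : ℕ)) * (b ⟨degBound α n - j,
      h⟩ - a ⟨degBound α n - j, h⟩) else 0
  have hc : (0 : ℝ) < 1 / 2 + (α / 2 : ℕ) * n - degBound α n := by
    have : ((degBound α n : ℕ) : ℝ) ≤ (α / 2 : ℕ) * n := by exact_mod_cast hNle
    linarith
  have hv := eq_zero_of_sum_gamma_eq_zero hc (degBound α n) v fun m hm => by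
    have h1 : ∑ j : Fin (degBound α n + 1), Real.Gamma (1 / 2 + ((α / 2 : ℕ) : ℝ) * n + m -
      (j : ℕ)) *
        Real.Gamma (((n : ℝ) - 1) / 2 + (j : ℕ)) * (b j - a j) = 0 := by
      simp_rw [mul_sub]
      rw [Finset.sum_sub_distrib, ha m hm, hb m hm, sub_self]
    rw [← h1, ← Equiv.sum_comp Fin.revPerm, ← Fin.sum_univ_eq_sum_range
      (fun j => Real.Gamma (1 / 2 + ((α / 2 : ℕ) : ℝ) * n - degBound α n + m + j) * v j)]
    refine Finset.sum_congr rfl fun j _ => ?_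
    have hj : (j : ℕ) ≤ degBound α n := Nat.lt_succ_iff.1 j.2
    have hr : (Fin.rev j : Fin (degBound α n + 1)) = ⟨degBound α n - j, by omega⟩ := by
      ext
      simp [Fin.val_rev]
    simp only [v, Fin.revPerm_apply, hr, dif_pos (show degBound α n -
      (j : ℕ) < degBound α n + 1 by omega)]
    rw [Nat.cast_sub hj, mul_assoc]
    congr 2
    ring
  ext j
  have hj : (j : ℕ) ≤ degBound α n := Nat.lt_succ_iff.1 j.2
  have h2 := hv (degBound α n - j) (Nat.sub_le _ _)
  have h3 : degBound α n - (degBound α n - (j : ℕ)) = j := by omega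
  simp only [v, h3, dif_pos j.2] at h2
  have h4 : Real.Gamma (((n : ℝ) - 1) / 2 + (j : ℕ)) ≠ 0 := by
    have : (0 : ℝ) ≤ (j : ℕ) := Nat.cast_nonneg _
    exact (Real.Gamma_pos_of_pos (by linarith)).ne'
  exact sub_eq_zero.1 ((mul_eq_zero.1 h2).resolve_left h4)

/-! ### Series for truncated expectations -/

/-- Dominated convergence with a majorant that does not depend on the angle: the form in which the
series below are integrated against its law. -/
lemma hasSum_integral_of_bound {Ω ι : Type*} [MeasurableSpace Ω] [Countable ι] {ν : Measure Ω}
    [IsFiniteMeasure ν] {F : ι → Ω → ℝ} {f : Ω → ℝ} {b : ι → ℝ} (hb : Summable b)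
    (hF : ∀ k, AEStronglyMeasurable (F k) ν) (h : ∀ᵐ θ ∂ν, ∀ k, |F k θ| ≤ b k)
    (hs : ∀ᵐ θ ∂ν, HasSum (fun k => F k θ) (f θ)) :
    HasSum (fun k => ∫ θ, F k θ ∂ν) (∫ θ, f θ ∂ν) :=
  hasSum_integral_of_dominated_convergence (fun k _ => b k) hF
    (fun k => h.mono fun _ hθ => hθ k) (ae_of_all _ fun _ => hb) (integrable_const _) hs

lemma choose_add_sub_one_nonneg {a : ℝ} (ha : 0 < a) (j : ℕ) : 0 ≤ Ring.choose (a + j - 1) j := by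
  have h := Ring.factorial_nsmul_multichoose_eq_ascPochhammer a j
  rw [Polynomial.ascPochhammer_smeval_eq_eval, nsmul_eq_mul] at h
  have h1 : Ring.choose (a + j - 1) j = Ring.multichoose a j := by
    rw [Ring.choose]
    congr 1
    ring
  rw [h1]
  have h2 := ascPochhammer_pos j a ha
  rw [← h] at h2
  exact (pos_of_mul_pos_right h2 (by positivity)).le

/-- The absorption identity for a real upper index. It converts the coefficients of the binomial
series of `cot^p` into those of `polyP`. -/
lemma mul_choose_sub_one (s : ℝ) (j : ℕ) :
    s * Ring.choose (s - 1) j = (s - j) * Ring.choose s j := by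
  have h1 := Ring.descPochhammer_eq_factorial_smul_choose (s - 1) j
  have h2 := Ring.descPochhammer_eq_factorial_smul_choose s j
  rw [Polynomial.descPochhammer_smeval_eq_ascPochhammer,
    Polynomial.ascPochhammer_smeval_eq_eval, nsmul_eq_mul] at h1 h2
  have h3 := congr_arg (Polynomial.eval (s - j)) (ascPochhammer_succ_left ℝ j)
  rw [ascPochhammer_succ_eval] at h3
  simp only [Polynomial.eval_mul, Polynomial.eval_X, Polynomial.eval_comp, Polynomial.eval_add,
    Polynomial.eval_one] at h3
  rw [show s - 1 - j + 1 = s - j by ring] at h1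
  rw [h1, h2, sub_add_cancel] at h3
  have h4 : (j ! : ℝ) ≠ 0 := by exact_mod_cast j.factorial_ne_zero
  exact mul_left_cancel₀ h4 (by linarith)

/-- The conditions on an angle in the upper part of the range. -/
structure IsUpperAngle (n : ℕ) (θ : ℝ) : Prop where
  pos : 0 < θ
  lt : θ < Real.pi / 2
  le_tan : splitTan n ≤ Real.tan θ
  tan_le : Real.tan θ ≤ Real.sqrt ((n : ℝ) - 1)

namespace IsUpperAngle

variable {n : ℕ} {θ : ℝ}

lemma cos_pos (h : IsUpperAngle n θ) : 0 < Real.cos θ :=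
  Real.cos_pos_of_mem_Ioo ⟨by linarith [h.pos, Real.pi_pos], h.lt⟩

lemma sin_pos (h : IsUpperAngle n θ) : 0 < Real.sin θ :=
  Real.sin_pos_of_pos_of_lt_pi h.pos (by linarith [h.lt, Real.pi_pos])

lemma cot_pos (h : IsUpperAngle n θ) : 0 < Real.cot θ := by
  rw [Real.cot_eq_cos_div_sin]
  exact div_pos h.cos_pos h.sin_pos

lemma cot_le (h : IsUpperAngle n θ) (hn : 2 ≤ n) : Real.cot θ ≤ Real.sqrt ((n : ℝ) - 1) := by
  rw [← Real.tan_inv_eq_cot, ← inv_inv (Real.sqrt _)]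
  refine inv_anti₀ ?_ ?_
  · rw [← one_div]
    exact splitTan_pos hn
  · rw [← one_div]
    exact h.le_tan

lemma le_cot (h : IsUpperAngle n θ) (hn : 2 ≤ n) : splitTan n ≤ Real.cot θ := by
  rw [← Real.tan_inv_eq_cot, splitTan, one_div]
  exact inv_anti₀ ((splitTan_pos hn).trans_le h.le_tan) h.tan_le

/-- `cos² = 1/(1 + tan²)` with `tan² ≥ 1/(n-1)`. The bound is the geometric ratio that dominates the
cosine series. -/
lemma cos_sq_le (h : IsUpperAngle n θ) (hn : 2 ≤ n) : Real.cos θ ^ 2 ≤ 1 - 1 / n := by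
  have h2 : (2 : ℝ) ≤ n := by exact_mod_cast hn
  have h1 := pow_le_pow_left₀ (splitTan_pos hn).le h.le_tan 2
  rw [splitTan_sq hn, Real.tan_eq_sin_div_cos, div_pow, div_le_div_iff₀ (by linarith)
    (pow_pos h.cos_pos 2), Real.sin_sq] at h1
  rw [le_sub_iff_add_le, ← le_sub_iff_add_le', div_le_iff₀ (by linarith)]
  linarith

/-- `cot^p = cos^p (1 - cos²)^(-p/2)`, expanded by the binomial series. -/
lemma hasSum_cot_pow (h : IsUpperAngle n θ) (p : ℕ) :
    HasSum (fun j : ℕ => Ring.choose ((p : ℝ) / 2 + j - 1) j * Real.cos θ ^ (p + 2 * j))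
      (Real.cot θ ^ p) := by
  have hc : |Real.cos θ ^ 2| < 1 := by
    rw [abs_of_nonneg (sq_nonneg _)]
    have := Real.sin_sq_add_cos_sq θ
    have := pow_pos h.sin_pos 2
    linarith
  have hs := (hasSum_choose_mul_pow ((p : ℝ) / 2) hc).mul_left (Real.cos θ ^ p)
  have h1 : Real.cos θ ^ p * (1 / (1 - Real.cos θ ^ 2) ^ ((p : ℝ) / 2)) = Real.cot θ ^ p := by
    rw [← Real.sin_sq, Real.cot_eq_cos_div_sin, div_pow, ← Real.rpow_natCast (Real.sin θ) 2,
      ← Real.rpow_mul h.sin_pos.le, show ((2 : ℕ) : ℝ) * (p / 2) = p by push_cast; ring,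
      Real.rpow_natCast]
    ring
  rw [h1] at hs
  refine hs.congr_fun fun j => ?_
  rw [pow_add, pow_mul]
  ring

end IsUpperAngle

lemma measurable_cot : Measurable Real.cot := by
  rw [show Real.cot = fun θ => Real.cos θ / Real.sin θ from funext Real.cot_eq_cos_div_sin]
  exact Real.measurable_cos.div Real.measurable_sin

/-! ### Termwise integration over the upper angles -/

section Series

variable {n : ℕ} {ν : Measure ℝ}

lemma one_sub_inv_mem (hn : 2 ≤ n) : 0 ≤ 1 - 1 / (n : ℝ) ∧ |1 - 1 / (n : ℝ)| < 1 := by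
  have h2 : (2 : ℝ) ≤ n := by exact_mod_cast hn
  have h3 : 0 < 1 / (n : ℝ) := by positivity
  have h4 : 1 / (n : ℝ) ≤ 1 := by rw [div_le_one (by linarith)]; linarith
  refine ⟨by linarith, ?_⟩
  rw [abs_of_nonneg (by linarith)]
  linarith

lemma cos_pow_le (hn : 2 ≤ n) {θ : ℝ} (h : IsUpperAngle n θ) (p j : ℕ) :
    |Real.cos θ ^ (p + 2 * j)| ≤ (1 - 1 / (n : ℝ)) ^ j := by
  rw [abs_of_nonneg (pow_nonneg h.cos_pos.le _), pow_add, pow_mul]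
  calc _ ≤ 1 * (1 - 1 / (n : ℝ)) ^ j := by
        have h1 := h.cos_sq_le hn
        gcongr
        exact pow_le_one₀ h.cos_pos.le (Real.cos_le_one θ)
    _ = _ := one_mul _

/-- The common value of the series in `cos` and in `cot` moments. -/
noncomputable def upperKernel (ν : Measure ℝ) (N : ℕ) (x : ℝ) : ℝ :=
  ∫ θ, Real.cot θ ^ N * (∫ u in (0 : ℝ)..1, u ^ (N - 1) * Real.exp (-(x * Real.cot θ * u))) ∂ν

lemma mul_upperKernel {N : ℕ} (hN : 1 ≤ N) (x : ℝ) :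
    x ^ N / Real.Gamma N * upperKernel ν N x = ∫ θ, gCdf N (x * Real.cot θ) ∂ν := by
  rw [upperKernel, ← integral_const_mul]
  refine integral_congr_ae (ae_of_all _ fun θ => ?_)
  simp only
  rw [gCdf_eq_kernel hN, mul_pow]
  ring

variable [IsFiniteMeasure ν]

lemma hasSum_cotMoment (hn : 2 ≤ n) (hν : ∀ᵐ θ ∂ν, IsUpperAngle n θ) (p : ℕ) :
    HasSum (fun j : ℕ => Ring.choose ((p : ℝ) / 2 + j - 1) j *
      ∫ θ, Real.cos θ ^ (p + 2 * j) ∂ν) (∫ θ, Real.cot θ ^ p ∂ν) := by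
  simp_rw [← integral_const_mul]
  refine hasSum_integral_of_bound
    (b := fun j => |Ring.choose ((p : ℝ) / 2 + j - 1) j * (1 - 1 / (n : ℝ)) ^ j|)
    (hasSum_choose_mul_pow _ (one_sub_inv_mem hn).2).summable.abs
    (fun j => by fun_prop) ?_ (hν.mono fun θ h => h.hasSum_cot_pow p)
  filter_upwards [hν] with θ h j
  rw [abs_mul, abs_mul, abs_of_nonneg (pow_nonneg (one_sub_inv_mem hn).1 j)]
  exact mul_le_mul_of_nonneg_left (cos_pow_le hn h p j) (abs_nonneg _)

/-- On the truncated range `cot` is at most `√(n-1)`, so an exponential series dominates. -/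
lemma hasSum_cotMoment_series (hn : 2 ≤ n) (hν : ∀ᵐ θ ∂ν, IsUpperAngle n θ) {N : ℕ} (hN : 1 ≤ N)
    (x : ℝ) :
    HasSum (fun k : ℕ => (∫ θ, Real.cot θ ^ (N + k) ∂ν) / ((N : ℝ) + k) * ((-x) ^ k / k !))
      (upperKernel ν N x) := by
  have h1 : ∀ k : ℕ, (∫ θ, Real.cot θ ^ (N + k) ∂ν) / ((N : ℝ) + k) * ((-x) ^ k / k !) =
      ∫ θ, (-x) ^ k / k ! / ((N : ℝ) + k) * Real.cot θ ^ (N + k) ∂ν := fun k => by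
    rw [integral_const_mul]
    ring
  simp_rw [h1]
  set B := Real.sqrt ((n : ℝ) - 1)
  refine hasSum_integral_of_bound (b := fun k : ℕ => B ^ N * ((|x| * B) ^ k / k !))
    ((hasSum_exp _).summable.mul_left _)
    (fun k => ((measurable_cot.pow_const _).const_mul _).aestronglyMeasurable) ?_ ?_
  · filter_upwards [hν] with θ h k
    have hc := h.cot_pos
    have hB := h.cot_le hn
    rw [abs_mul, abs_div, abs_div, abs_pow, abs_neg, abs_of_pos (pow_pos hc _), Nat.abs_cast,
      abs_of_nonneg (by positivity : (0 : ℝ) ≤ N + k)]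
    have h3 : (1 : ℝ) ≤ N + k := by
      have : (1 : ℝ) ≤ N := by exact_mod_cast hN
      have : (0 : ℝ) ≤ k := k.cast_nonneg
      linarith
    calc _ ≤ |x| ^ k / k ! * B ^ (N + k) :=
          mul_le_mul (div_le_self (by positivity) h3) (pow_le_pow_left₀ hc.le hB _)
            (by positivity) (by positivity)
      _ = _ := by rw [mul_pow, pow_add]; ring
  · filter_upwards [hν] with θ h
    refine ((hasSum_gCdf_kernel hN (x * Real.cot θ)).mul_left
      (Real.cot θ ^ N)).congr_fun fun k => ?_
    rw [← neg_mul, mul_pow, pow_add]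
    ring

/-- Each power of `cot` in the kernel series is expanded in powers of `cos`. The double series
converges absolutely: with `cos²` replaced by `1 - 1/n`, the inner sum is `√n^(N+k)`, and the outer
sum is again exponential. -/
lemma hasSum_cosMoment_pairs (hn : 2 ≤ n) (hν : ∀ᵐ θ ∂ν, IsUpperAngle n θ) {N : ℕ} (hN : 1 ≤ N)
    (x : ℝ) :
    HasSum (fun q : ℕ × ℕ => (-x) ^ q.1 / (q.1)! / ((N : ℝ) + q.1) *
      Ring.choose (((N + q.1 : ℕ) : ℝ) / 2 + q.2 - 1) q.2 *
        ∫ θ, Real.cos θ ^ (N + q.1 + 2 * q.2) ∂ν) (upperKernel ν N x) := by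
  have h2n : (2 : ℝ) ≤ n := by exact_mod_cast hn
  have hN1 : (1 : ℝ) ≤ N := by exact_mod_cast hN
  have hch : ∀ k j : ℕ, 0 ≤ Ring.choose (((N + k : ℕ) : ℝ) / 2 + j - 1) j := fun k j =>
    choose_add_sub_one_nonneg (by push_cast; positivity) j
  have hsum : ∀ k : ℕ, HasSum (fun j : ℕ => |x| ^ k / k ! *
      (Ring.choose (((N + k : ℕ) : ℝ) / 2 + j - 1) j * (1 - 1 / (n : ℝ)) ^ j))
      (|x| ^ k / k ! * Real.sqrt n ^ (N + k)) := fun k => by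
    have h := hasSum_choose_mul_pow (((N + k : ℕ) : ℝ) / 2) (one_sub_inv_mem hn).2
    have h1 : 1 / (1 - (1 - 1 / (n : ℝ))) ^ (((N + k : ℕ) : ℝ) / 2) = Real.sqrt n ^ (N + k) := by
      rw [sub_sub_cancel, Real.div_rpow zero_le_one (by linarith), Real.one_rpow, one_div_one_div,
        Real.sqrt_eq_rpow, ← Real.rpow_natCast (_ ^ (1 / 2 : ℝ)), ← Real.rpow_mul (by linarith)]
      congr 1
      ring
    rw [h1] at h
    exact h.mul_left _
  have hbs : Summable fun q : ℕ × ℕ => |x| ^ q.1 / (q.1)! *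
      (Ring.choose (((N + q.1 : ℕ) : ℝ) / 2 + q.2 - 1) q.2 * (1 - 1 / (n : ℝ)) ^ q.2) := by
    refine (summable_prod_of_nonneg fun q => mul_nonneg (by positivity)
      (mul_nonneg (hch _ _) (pow_nonneg (one_sub_inv_mem hn).1 _))).2
      ⟨fun k => (hsum k).summable, ?_⟩
    simp_rw [fun k => (hsum k).tsum_eq]
    refine ((hasSum_exp (|x| * Real.sqrt n)).summable.mul_left (Real.sqrt n ^ N)).congr fun k => ?_
    rw [mul_pow, pow_add]
    ring
  have hbound : ∀ θ, IsUpperAngle n θ → ∀ q : ℕ × ℕ, |(-x) ^ q.1 / (q.1)! / ((N : ℝ) + q.1) *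
      Ring.choose (((N + q.1 : ℕ) : ℝ) / 2 + q.2 - 1) q.2 * Real.cos θ ^ (N + q.1 + 2 * q.2)| ≤
      |x| ^ q.1 / (q.1)! *
        (Ring.choose (((N + q.1 : ℕ) : ℝ) / 2 + q.2 - 1) q.2 * (1 - 1 / (n : ℝ)) ^ q.2) := by
    intro θ h q
    have h0 := hch q.1 q.2
    have h3 : (1 : ℝ) ≤ N + q.1 := by
      have : (0 : ℝ) ≤ q.1 := q.1.cast_nonneg
      linarith
    rw [abs_mul, abs_mul, abs_div, abs_div, abs_pow, abs_neg, Nat.abs_cast, abs_of_nonneg h0,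
      abs_of_nonneg (by positivity : (0 : ℝ) ≤ N + q.1), mul_assoc]
    exact mul_le_mul (div_le_self (by positivity) h3)
      (mul_le_mul_of_nonneg_left (cos_pow_le hn h _ _) h0) (by positivity) (by positivity)
  simp_rw [← integral_const_mul]
  refine hasSum_integral_of_bound hbs (fun q => by fun_prop) (hν.mono fun θ h => hbound θ h) ?_
  filter_upwards [hν] with θ h
  have hs := (Summable.of_norm_bounded (E := ℝ) hbs (by exact hbound θ h)).hasSum
  have h1 : ∀ k : ℕ, HasSum (fun j : ℕ => (-x) ^ k / k ! / ((N : ℝ) + k) *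
      Ring.choose (((N + k : ℕ) : ℝ) / 2 + j - 1) j * Real.cos θ ^ (N + k + 2 * j))
      ((-x) ^ k / k ! / ((N : ℝ) + k) * Real.cot θ ^ (N + k)) := fun k => by
    simp_rw [mul_assoc]
    exact (h.hasSum_cot_pow (N + k)).mul_left _
  have h2 := hs.prod_fiberwise h1
  have h3 : HasSum (fun k : ℕ => (-x) ^ k / k ! / ((N : ℝ) + k) * Real.cot θ ^ (N + k))
      (Real.cot θ ^ N * ∫ u in (0 : ℝ)..1, u ^ (N - 1) * Real.exp (-(x * Real.cot θ * u))) := by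
    refine ((hasSum_gCdf_kernel hN (x * Real.cot θ)).mul_left
      (Real.cot θ ^ N)).congr_fun fun k => ?_
    rw [← neg_mul, mul_pow, pow_add]
    ring
  rwa [h2.unique h3] at hs

/-- The pairs `(k, j)` are regrouped by `m = k + 2j`, which fixes the power of the cosine. By
`mul_choose_sub_one`, the binomial with upper index `(N+m)/2 - 1` divided by `N + k` equals the one
with upper index `(N+m)/2` divided by `N + m`, and the inner finite sum becomes `polyP`. -/
lemma hasSum_cosMoment_series (hn : 2 ≤ n) (hν : ∀ᵐ θ ∂ν, IsUpperAngle n θ) {N : ℕ} (hN : 1 ≤ N)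
    (x : ℝ) :
    HasSum (fun k : ℕ => (-1 : ℝ) ^ k * ((∫ θ, Real.cos θ ^ (N + k) ∂ν) / ((N : ℝ) + k)) *
      polyP N k x) (upperKernel ν N x) := by
  have hN1 : (1 : ℝ) ≤ N := by exact_mod_cast hN
  have hp := hasSum_cosMoment_pairs hn hν hN x
  let F : ℕ × ℕ → ℝ := fun q => (-x) ^ q.1 / (q.1)! / ((N : ℝ) + q.1) *
      Ring.choose (((N + q.1 : ℕ) : ℝ) / 2 + q.2 - 1) q.2 *
        ∫ θ, Real.cos θ ^ (N + q.1 + 2 * q.2) ∂ν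
  -- The family after the injection `(k, j) ↦ (k + 2j, j)`, extended by zero off its range.
  let G : ℕ × ℕ → ℝ := fun q => if 2 * q.2 ≤ q.1 then F (q.1 - 2 * q.2, q.2) else 0
  let e : ℕ × ℕ → ℕ × ℕ := fun q => (q.1 + 2 * q.2, q.2)
  have he : Function.Injective e := fun p q hpq => by
    simp only [e, Prod.mk.injEq] at hpq
    ext <;> omega
  have hGe : G ∘ e = F := by
    ext q
    simp [G, e]
  have hG0 : ∀ q ∉ Set.range e, G q = 0 := fun q hq => by
    refine if_neg fun h => hq ⟨(q.1 - 2 * q.2, q.2), ?_⟩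
    ext
    · simp only [e]
      omega
    · rfl
  have hG : HasSum G (upperKernel ν N x) := by
    rw [← he.hasSum_iff hG0, hGe]
    exact hp
  refine hG.prod_fiberwise fun m => ?_
  have hfin : HasSum (fun j => G (m, j)) (∑ j ∈ Finset.range (m / 2 + 1), G (m, j)) :=
    hasSum_sum_of_ne_finset_zero fun j hj => if_neg (by simp only [Finset.mem_range] at hj ⊢; omega)
  convert hfin using 1
  rw [polyP, Finset.mul_sum]
  refine Finset.sum_congr rfl fun j hj => ?_
  have hj : 2 * j ≤ m := by
    have := Finset.mem_range.1 hj
    omega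
  simp only [G, F, if_pos hj]
  obtain ⟨k, rfl⟩ := Nat.exists_eq_add_of_le hj
  have hc := mul_choose_sub_one ((((N : ℝ) + (2 * j + k : ℕ))) / 2) j
  rw [show N + (2 * j + k - 2 * j) + 2 * j = N + (2 * j + k) by omega,
    show 2 * j + k - 2 * j = k by omega, show (((N + k : ℕ) : ℝ) / 2 + j - 1) =
      ((N : ℝ) + (2 * j + k : ℕ)) / 2 - 1 by push_cast; ring, neg_pow x, pow_add (-1 : ℝ), pow_mul]
  have h1 : ((N : ℝ) + (2 * j + k : ℕ)) / 2 - j = ((N : ℝ) + k) / 2 := by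
    push_cast
    ring
  rw [h1] at hc
  have h2 : (N : ℝ) + k ≠ 0 := by positivity
  have h3 : (N : ℝ) + (2 * j + k : ℕ) ≠ 0 := by positivity
  have h4 : (Ring.choose (((N : ℝ) + (2 * j + k : ℕ)) / 2 - 1) j) =
      ((N : ℝ) + k) / (N + (2 * j + k : ℕ)) * Ring.choose (((N : ℝ) + (2 * j + k : ℕ)) / 2) j := by
    rw [div_mul_eq_mul_div, eq_div_iff h3]
    linarith
  rw [h4, neg_one_sq, one_pow, one_mul]
  field_simp

/-- The binomial theorem for `(1 - f)^k` under the integral: differences of moments become integrals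
whose sign can be read off. -/
lemma sum_alternating_moments {f : ℝ → ℝ} {B : ℝ} (hf : Measurable f) (hB : ∀ᵐ θ ∂ν, |f θ| ≤ B)
    (N k : ℕ) :
    ∑ i ∈ Finset.range (k + 1), (-1 : ℝ) ^ i * (k.choose i : ℝ) * ∫ θ, f θ ^ (N + i) ∂ν =
      ∫ θ, f θ ^ N * (1 - f θ) ^ k ∂ν := by
  have hint : ∀ i, Integrable (fun θ => f θ ^ i) ν := fun i => by
    refine Integrable.of_bound (hf.pow_const i).aestronglyMeasurable (B ^ i) ?_
    filter_upwards [hB] with θ h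
    rw [norm_pow]
    exact pow_le_pow_left₀ (abs_nonneg _) h i
  simp_rw [← integral_const_mul]
  rw [← integral_finsetSum _ fun i _ => (hint _).const_mul _]
  refine integral_congr_ae (ae_of_all _ fun θ => ?_)
  simp only
  rw [sub_eq_neg_add, add_pow, Finset.mul_sum]
  refine Finset.sum_congr rfl fun i _ => ?_
  rw [neg_pow, pow_add, one_pow]
  ring

/-- `hasSum_gCdf_scale` integrated over the random factor `f`. Boundedness of `f` suffices, without
`f ≤ 1`, because `gCdf_le_pow` gives factorial decay; this is why every positive scale is
admissible. -/
lemma hasSum_delta_gCdf {f : ℝ → ℝ} {B : ℝ} (hf : Measurable f) (hB : ∀ᵐ θ ∂ν, |f θ| ≤ B)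
    {N : ℕ} (hN : 1 ≤ N) {y : ℝ} (hy : 0 ≤ y) :
    HasSum (fun k : ℕ => (∫ θ, f θ ^ N * (1 - f θ) ^ k ∂ν) * ((N + k - 1).choose k : ℝ) *
      gCdf (N + k : ℕ) y) (∫ θ, gCdf N (f θ * y) ∂ν) := by
  simp_rw [← integral_mul_const]
  refine hasSum_integral_of_bound
    (b := fun k : ℕ => |B| ^ N * y ^ N / (N - 1)! * (((1 + |B|) * y) ^ k / k !))
    ((hasSum_exp _).summable.mul_left _)
    (fun k => by
      apply Measurable.aestronglyMeasurable
      fun_prop) ?_ (ae_of_all _ fun θ => hasSum_gCdf_scale hN _ _)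
  filter_upwards [hB] with θ h k
  have h0 : |f θ| ≤ |B| := h.trans (le_abs_self B)
  have h1 : |1 - f θ| ≤ 1 + |B| := by
    refine (abs_sub _ _).trans ?_
    rw [abs_one]
    linarith
  have h2 := gCdf_le_pow (show 1 ≤ N + k by omega) hy
  have h3 := gCdf_nonneg (N + k) hy
  rw [abs_mul, abs_mul, abs_mul, abs_pow, abs_pow, Nat.abs_cast, abs_of_nonneg h3]
  have h4 : ((N + k - 1).choose k : ℝ) * (y ^ (N + k) / (N + k)!) ≤
      y ^ N / (N - 1)! * (y ^ k / k !) := by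
    obtain ⟨M, rfl⟩ : ∃ M, N = M + 1 := ⟨N - 1, by omega⟩
    rw [show M + 1 + k - 1 = M + k by omega, Nat.cast_choose ℝ (Nat.le_add_left k M),
      Nat.add_sub_cancel, Nat.add_sub_cancel, show M + 1 + k = (M + k) + 1 by omega,
      Nat.factorial_succ]
    push_cast
    have h5 : (0 : ℝ) < (M + k)! := by exact_mod_cast Nat.factorial_pos _
    have h6 : (1 : ℝ) ≤ (M : ℝ) + k + 1 := by
      have : (0 : ℝ) ≤ (M : ℝ) + k := by positivity
      linarith
    calc _ = y ^ (M + k + 1) / (M ! * k !) / ((M : ℝ) + k + 1) := by field_simp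
      _ ≤ y ^ (M + k + 1) / (M ! * k !) := div_le_self (by positivity) h6
      _ = _ := by rw [show M + k + 1 = M + 1 + k by omega, pow_add]; ring
  calc _ ≤ |B| ^ N * (1 + |B|) ^ k * ((N + k - 1).choose k : ℝ) * (y ^ (N + k) / (N + k)!) := by
        gcongr
    _ ≤ |B| ^ N * (1 + |B|) ^ k * (y ^ N / (N - 1)! * (y ^ k / k !)) := by
        rw [mul_assoc (_ * _)]
        gcongr
    _ = _ := by rw [mul_pow]; ring

/-- For fixed `f` the weights sum to one by the negative binomial series. The positive lower bound
`b` makes the convergence uniformly geometric. -/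
lemma hasSum_delta_mass {f : ℝ → ℝ} {b : ℝ} (hf : Measurable f) (hb : 0 < b)
    (hB : ∀ᵐ θ ∂ν, b ≤ f θ ∧ f θ ≤ 1) {N : ℕ} (hN : 1 ≤ N) :
    HasSum (fun k : ℕ => (∫ θ, f θ ^ N * (1 - f θ) ^ k ∂ν) * ((N + k - 1).choose k : ℝ))
      (ν.real Set.univ) := by
  have hone : ν.real Set.univ = ∫ _, (1 : ℝ) ∂ν := by simp
  rw [hone]
  -- The zero measure is treated apart because `b ≤ 1` is read off at a point.
  rcases eq_zero_or_neZero ν with rfl | hne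
  · simp [hasSum_zero]
  obtain ⟨θ₀, h₀⟩ := hB.exists
  have hb1 : |1 - b| < 1 := by
    rw [abs_of_nonneg (by linarith [h₀.1, h₀.2])]
    linarith
  simp_rw [← integral_mul_const]
  refine hasSum_integral_of_bound
    (b := fun k : ℕ => ((N + k - 1).choose k : ℝ) * (1 - b) ^ k)
    (hasSum_nat_choose_mul_pow hN hb1).summable
    (fun k => by
      apply Measurable.aestronglyMeasurable
      fun_prop) ?_ ?_
  · filter_upwards [hB] with θ h k
    have h1 : 0 ≤ 1 - f θ := by linarith [h.2]
    have h0 : 0 < f θ := hb.trans_le h.1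
    rw [abs_of_nonneg (by positivity)]
    calc _ ≤ 1 * (1 - b) ^ k * ((N + k - 1).choose k : ℝ) := by
          gcongr
          · exact pow_le_one₀ h0.le h.2
          · exact h.1
      _ = _ := by ring
  · filter_upwards [hB] with θ h
    have h0 : 0 < f θ := hb.trans_le h.1
    have h1 : |1 - f θ| < 1 := by
      rw [abs_of_nonneg (by linarith [h.2])]
      linarith
    have hs := (hasSum_nat_choose_mul_pow hN h1).mul_left (f θ ^ N)
    rw [sub_sub_cancel, mul_one_div, div_self (by positivity)] at hs
    refine hs.congr_fun fun k => ?_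
    ring

end Series

/-! ### The lower part of the range of the angle -/

section Lower

variable {α n : ℕ} {a : Fin (degBound α n + 1) → ℝ}

lemma continuous_polyw : Continuous (polyw α n a) := by
  unfold polyw
  fun_prop

lemma hasDerivAt_polyW (hn : 2 ≤ n) (t : ℝ) : HasDerivAt (polyW α n a) (polyw α n a t) t := by
  have h2 : (2 : ℝ) ≤ n := by exact_mod_cast hn
  refine HasDerivAt.const_mul _ (HasDerivAt.fun_sum fun j _ => HasDerivAt.const_mul _ ?_)
  have h := (hasDerivAt_pow (n - 1 + 2 * (j : ℕ)) t).div_const ((n : ℝ) - 1 + 2 * (j : ℕ))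
  refine h.congr_deriv ?_
  have h3 : (n : ℝ) - 1 + 2 * (j : ℕ) ≠ 0 := by
    have : (0 : ℝ) ≤ (j : ℕ) := Nat.cast_nonneg _
    exact ne_of_gt (by linarith)
  rw [show n - 1 + 2 * (j : ℕ) - 1 = n - 2 + 2 * (j : ℕ) by omega]
  push_cast [Nat.cast_sub (show 1 ≤ n by omega)]
  field_simp

lemma polyW_zero (hn : 2 ≤ n) : polyW α n a 0 = 0 := by
  rw [polyW, Finset.sum_eq_zero, mul_zero]
  intro j _
  rw [zero_pow (by omega), zero_div, mul_zero]

lemma continuous_polyW : Continuous (polyW α n a) := by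
  unfold polyW
  fun_prop

lemma integral_polyw (hn : 2 ≤ n) (t : ℝ) : ∫ s in (0 : ℝ)..t, polyw α n a s = polyW α n a t := by
  rw [intervalIntegral.integral_eq_sub_of_hasDerivAt (fun s _ => hasDerivAt_polyW hn s)
    (continuous_polyw.intervalIntegrable _ _), polyW_zero hn, sub_zero]

/-- The properties of the law of the angle `Φ` that determine the law of the sample variance. -/
structure IsAngleLaw (α n : ℕ) (a : Fin (degBound α n + 1) → ℝ) (κ : Measure ℝ) : Prop where
  ae_mem : ∀ᵐ θ ∂κ, 0 ≤ θ ∧ θ < Real.pi / 2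
  ae_tan_le : ∀ᵐ θ ∂κ, Real.tan θ ≤ Real.sqrt ((n : ℝ) - 1)
  tan_le : ∀ t, 0 ≤ t → t ≤ splitTan n → κ.real {θ | Real.tan θ ≤ t} = polyW α n a t

lemma measurable_tan : Measurable Real.tan := by
  rw [show Real.tan = fun θ => Real.sin θ / Real.cos θ from funext Real.tan_eq_sin_div_cos]
  exact Real.measurable_sin.div Real.measurable_cos

lemma measurableSet_tan_le (t : ℝ) : MeasurableSet {θ | Real.tan θ ≤ t} :=
  measurableSet_le measurable_tan measurable_const

namespace IsAngleLaw

variable {κ : Measure ℝ} [IsProbabilityMeasure κ]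

lemma ae_tan_pos (h : IsAngleLaw α n a κ) (hn : 2 ≤ n) : ∀ᵐ θ ∂κ, 0 < Real.tan θ := by
  have h1 := h.tan_le 0 le_rfl (splitTan_pos hn).le
  rw [polyW_zero hn, measureReal_eq_zero_iff] at h1
  simpa [ae_iff] using h1

lemma ae_mem_Ioo (h : IsAngleLaw α n a κ) (hn : 2 ≤ n) :
    ∀ᵐ θ ∂κ, 0 < θ ∧ θ < Real.pi / 2 := by
  filter_upwards [h.ae_mem, h.ae_tan_pos hn] with θ h1 h2
  refine ⟨lt_of_le_of_ne h1.1 fun h0 => ?_, h1.2⟩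
  rw [← h0, Real.tan_zero] at h2
  exact lt_irrefl _ h2

lemma monotoneOn_polyW (h : IsAngleLaw α n a κ) :
    MonotoneOn (polyW α n a) (Set.Icc 0 (splitTan n)) := fun s hs t ht hst => by
  rw [← h.tan_le s hs.1 hs.2, ← h.tan_le t ht.1 ht.2]
  exact measureReal_mono fun θ (hθ : Real.tan θ ≤ s) => hθ.trans hst

/-- The sign comes from the monotonicity of a distribution function, not from the coefficients. -/
lemma polyw_nonneg (h : IsAngleLaw α n a κ) (hn : 2 ≤ n) {t : ℝ} (ht : t ∈ Set.Ioo 0 (splitTan n)) :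
    0 ≤ polyw α n a t := by
  rw [← (hasDerivAt_polyW hn t).deriv,
    ← derivWithin_of_mem_nhds (Icc_mem_nhds ht.1 ht.2)]
  exact h.monotoneOn_polyW.derivWithin_nonneg

/-- An atom at the splitting value would be a jump of the continuous polynomial. Its absence makes
strict and weak inequalities in the truncation interchangeable. -/
lemma measure_tan_eq (h : IsAngleLaw α n a κ) (hn : 2 ≤ n) :
    κ {θ | Real.tan θ = splitTan n} = 0 := by
  have h0 := splitTan_pos hn
  rw [← measureReal_eq_zero_iff]
  refine le_antisymm ?_ measureReal_nonneg
  have hle : ∀ᶠ t in nhdsWithin (splitTan n) (Set.Iio (splitTan n)),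
      κ.real {θ | Real.tan θ = splitTan n} ≤ polyW α n a (splitTan n) - polyW α n a t := by
    filter_upwards [Ioo_mem_nhdsLT h0] with t ht
    have hsub : {θ | Real.tan θ ≤ t} ⊆ {θ | Real.tan θ ≤ splitTan n} :=
      fun θ (hθ : Real.tan θ ≤ t) => hθ.trans ht.2.le
    rw [← h.tan_le t ht.1.le ht.2.le, ← h.tan_le _ h0.le le_rfl,
      ← measureReal_sdiff hsub (measurableSet_tan_le t)]
    refine measureReal_mono fun θ (hθ : Real.tan θ = splitTan n) => ⟨hθ.le, ?_⟩
    show ¬ Real.tan θ ≤ t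
    rw [hθ]
    exact not_le.2 ht.2
  have hlim : Filter.Tendsto (fun t => polyW α n a (splitTan n) - polyW α n a t)
      (nhdsWithin (splitTan n) (Set.Iio (splitTan n))) (nhds 0) := by
    have := ((continuous_const (y := polyW α n a (splitTan n))).sub
      (continuous_polyW (a := a))).tendsto (splitTan n)
    simp only [Pi.sub_apply, sub_self] at this
    exact this.mono_left nhdsWithin_le_nhds
  exact ge_of_tendsto hlim hle

lemma splitAngle_le_iff {θ : ℝ} (h : 0 < θ ∧ θ < Real.pi / 2) :
    splitAngle n ≤ θ ↔ splitTan n ≤ Real.tan θ := by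
  rw [splitAngle, ← Real.arctan_le_arctan_iff (y := Real.tan θ),
    Real.arctan_tan (by linarith [h.1, Real.pi_pos]) h.2]

lemma Ici_ae_eq (h : IsAngleLaw α n a κ) (hn : 2 ≤ n) :
    Set.Ici (splitAngle n) =ᵐ[κ] ({θ | Real.tan θ ≤ splitTan n}ᶜ : Set ℝ) := by
  have h1 : ∀ᵐ θ ∂κ, Real.tan θ ≠ splitTan n := by
    simpa [ae_iff] using h.measure_tan_eq hn
  filter_upwards [h.ae_mem_Ioo hn, h1] with θ h2 h3
  refine propext ?_
  show splitAngle n ≤ θ ↔ ¬ Real.tan θ ≤ splitTan n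
  rw [splitAngle_le_iff h2, not_le]
  exact ⟨fun h => lt_of_le_of_ne h h3.symm, le_of_lt⟩

lemma ae_isUpperAngle (h : IsAngleLaw α n a κ) (hn : 2 ≤ n) :
    ∀ᵐ θ ∂(κ.restrict (Set.Ici (splitAngle n))), IsUpperAngle n θ := by
  filter_upwards [ae_restrict_of_ae (h.ae_mem_Ioo hn), ae_restrict_of_ae h.ae_tan_le,
    ae_restrict_mem measurableSet_Ici] with θ h1 h2 h3
  exact ⟨h1.1, h1.2, (splitAngle_le_iff h1).1 h3, h2⟩

lemma measureReal_upper (h : IsAngleLaw α n a κ) (hn : 2 ≤ n) :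
    (κ.restrict (Set.Ici (splitAngle n))).real Set.univ = 1 - polyW α n a (splitTan n) := by
  rw [measureReal_restrict_apply_univ, measureReal_congr (h.Ici_ae_eq hn),
    probReal_compl_eq_one_sub (measurableSet_tan_le _),
    h.tan_le _ (splitTan_pos hn).le le_rfl]

/-- The law of `tan Φ` below the splitting value has the polynomial density. -/
lemma map_tan_restrict (h : IsAngleLaw α n a κ) (hn : 2 ≤ n) :
    (κ.restrict {θ | Real.tan θ ≤ splitTan n}).map Real.tan =
      (volume.restrict (Set.Ioo 0 (splitTan n))).withDensity
        fun t => ENNReal.ofReal (polyw α n a t) := by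
  have h0 := splitTan_pos hn
  have hint : ∀ s, IntegrableOn (polyw α n a) (Set.Ioo 0 s) := fun s =>
    (continuous_polyw.continuousOn.integrableOn_compact isCompact_Icc).mono_set
      Set.Ioo_subset_Icc_self
  have hint' : Integrable (polyw α n a) (volume.restrict (Set.Ioo 0 (splitTan n))) := hint _
  have hfin : IsFiniteMeasure ((volume.restrict (Set.Ioo 0 (splitTan n))).withDensity
        fun t => ENNReal.ofReal (polyw α n a t)) :=
    isFiniteMeasure_withDensity_ofReal hint'.2
  -- Two finite measures on the line agree if they agree on half-lines, where both sides are values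
  -- of the polynomial.
  refine Measure.ext_of_Iic _ _ fun t => ?_
  rw [Measure.map_apply measurable_tan measurableSet_Iic,
    Measure.restrict_apply (measurable_tan measurableSet_Iic),
    withDensity_apply _ measurableSet_Iic, Measure.restrict_restrict measurableSet_Iic]
  have hset : Real.tan ⁻¹' Set.Iic t ∩ {θ | Real.tan θ ≤ splitTan n} =
      {θ | Real.tan θ ≤ min t (splitTan n)} := by
    ext θ
    simp
  rw [hset]
  rcases lt_or_ge t 0 with ht | ht
  · have h1 : κ {θ | Real.tan θ ≤ min t (splitTan n)} = 0 := by
      refine measure_mono_null (fun θ hθ => ?_) (h.ae_tan_pos hn)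
      exact not_lt.2 ((le_trans (show Real.tan θ ≤ _ from hθ) (min_le_left _ _)).trans ht.le)
    have h2 : Set.Iic t ∩ Set.Ioo 0 (splitTan n) = ∅ := by
      ext s
      simp only [Set.mem_inter_iff, Set.mem_Iic, Set.mem_Ioo, Set.mem_empty_iff_false, iff_false]
      intro hs
      linarith [hs.1, hs.2.1]
    rw [h1, h2]
    simp
  · have hm : 0 ≤ min t (splitTan n) := le_min ht h0.le
    have hae : (Set.Iic t ∩ Set.Ioo 0 (splitTan n) : Set ℝ) =ᵐ[volume]
        Set.Ioc 0 (min t (splitTan n)) := by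
      have : ∀ᵐ s : ℝ, s ≠ splitTan n := by simp [ae_iff]
      filter_upwards [this] with s hs
      refine propext ?_
      show s ≤ t ∧ 0 < s ∧ s < splitTan n ↔ 0 < s ∧ s ≤ min t (splitTan n)
      rw [le_min_iff]
      exact ⟨fun h => ⟨h.2.1, h.1, h.2.2.le⟩, fun h => ⟨h.2.1, h.1, lt_of_le_of_ne h.2.2 hs⟩⟩
    rw [← ofReal_integral_eq_lintegral_ofReal
      (hint'.mono_measure (Measure.restrict_mono Set.inter_subset_right le_rfl))
      ((ae_restrict_iff' (measurableSet_Iic.inter measurableSet_Ioo)).2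
        (ae_of_all _ fun s hs => h.polyw_nonneg hn hs.2)), setIntegral_congr_set hae,
      ← intervalIntegral.integral_of_le hm, integral_polyw hn,
      ← h.tan_le _ hm (min_le_right _ _), ofReal_measureReal]

lemma integral_lower (h : IsAngleLaw α n a κ) (hn : 2 ≤ n) {g : ℝ → ℝ} (hg : Measurable g) :
    ∫ θ in {θ | Real.tan θ ≤ splitTan n}, g (Real.tan θ) ∂κ =
      ∫ t in (0 : ℝ)..splitTan n, g t * polyw α n a t := by
  rw [← integral_map measurable_tan.aemeasurable hg.aestronglyMeasurable,
    h.map_tan_restrict hn, integral_withDensity_eq_integral_toReal_smul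
      (continuous_polyw.measurable.ennreal_ofReal) (ae_of_all _ fun _ => ENNReal.ofReal_lt_top),
    intervalIntegral.integral_of_le (splitTan_pos hn).le, integral_Ioc_eq_integral_Ioo]
  refine setIntegral_congr_fun measurableSet_Ioo fun t ht => ?_
  simp only [ENNReal.toReal_ofReal (h.polyw_nonneg hn ht), smul_eq_mul, mul_comm]

lemma integral_split (h : IsAngleLaw α n a κ) (hn : 2 ≤ n) {f : ℝ → ℝ} (hf : Integrable f κ) :
    ∫ θ, f θ ∂κ = ∫ θ in Set.Ici (splitAngle n), f θ ∂κ +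
      ∫ θ in {θ | Real.tan θ ≤ splitTan n}, f θ ∂κ := by
  rw [setIntegral_congr_set (h.Ici_ae_eq hn), add_comm,
    integral_add_compl (measurableSet_tan_le _) hf]

lemma integrable_gCdf_cot (h : IsAngleLaw α n a κ) (hn : 2 ≤ n) {N : ℕ} (hN : 1 ≤ N) {x : ℝ}
    (hx : 0 ≤ x) : Integrable (fun θ => gCdf N (x * Real.cot θ)) κ := by
  refine Integrable.of_bound ((continuous_gCdf hN).measurable.comp
    (measurable_const.mul measurable_cot)).aestronglyMeasurable 1 ?_
  filter_upwards [h.ae_tan_pos hn] with θ hθ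
  have hc : 0 ≤ x * Real.cot θ := by
    rw [← Real.tan_inv_eq_cot]
    positivity
  rw [Real.norm_of_nonneg (gCdf_nonneg N hc)]
  exact gCdf_le_one hN hc

lemma integral_gCdf_cot (h : IsAngleLaw α n a κ) (hn : 2 ≤ n) {N : ℕ} (hN : 1 ≤ N) {x : ℝ}
    (hx : 0 ≤ x) :
    ∫ θ, gCdf N (x * Real.cot θ) ∂κ =
      x ^ N / Real.Gamma N * upperKernel (κ.restrict (Set.Ici (splitAngle n))) N x +
        ∫ t in (0 : ℝ)..splitTan n, gCdf N (x / t) * polyw α n a t := by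
  rw [h.integral_split hn (h.integrable_gCdf_cot hn hN hx), mul_upperKernel hN]
  congr 1
  have hg : Measurable fun t : ℝ => gCdf N (x / t) :=
    (continuous_gCdf hN).measurable.comp (measurable_const.div measurable_id)
  rw [← h.integral_lower hn hg]
  simp_rw [← Real.tan_inv_eq_cot, div_eq_mul_inv]

end IsAngleLaw

lemma intervalIntegrable_gCdf_mul_polyw (hn : 2 ≤ n) {N : ℕ} (hN : 1 ≤ N) {x : ℝ}
    (hx : 0 ≤ x) :
    IntervalIntegrable (fun t => gCdf N (x / t) * polyw α n a t) volume 0 (splitTan n) := by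
  rw [intervalIntegrable_iff_integrableOn_Ioc_of_le (splitTan_pos hn).le]
  have hg : Measurable fun t : ℝ => gCdf N (x / t) :=
    (continuous_gCdf hN).measurable.comp (measurable_const.div measurable_id)
  refine Integrable.bdd_mul (c := 1) ?_ hg.aestronglyMeasurable
    ((ae_restrict_iff' measurableSet_Ioc).2 (ae_of_all _ fun t ht => ?_))
  · exact (continuous_polyw.continuousOn.integrableOn_compact isCompact_Icc).mono_set
      Set.Ioc_subset_Icc_self
  · have h0 : 0 ≤ x / t := div_nonneg hx ht.1.le
    rw [Real.norm_of_nonneg (gCdf_nonneg N h0)]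
    exact gCdf_le_one hN h0

/-- Exchange of the integrations over the angle and over the size of the sample. -/
lemma integral_gCdf_mul_polyw (hn : 2 ≤ n) {N : ℕ} (hN : 1 ≤ N) {x : ℝ} (hx : 0 ≤ x) :
    IntegrableOn (fun y => gPdf N y * polyW α n a (x / y)) (Set.Ioi (x / splitTan n)) ∧
    ∫ t in (0 : ℝ)..splitTan n, gCdf N (x / t) * polyw α n a t =
      polyW α n a (splitTan n) * gCdf N (x / splitTan n) +
        ∫ y in Set.Ioi (x / splitTan n), gPdf N y * polyW α n a (x / y) := by
  have h0 := splitTan_pos hn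
  have hx0 : 0 ≤ x / splitTan n := div_nonneg hx h0.le
  have hw : IntegrableOn (polyw α n a) (Set.Ioc 0 (splitTan n)) :=
    (continuous_polyw.continuousOn.integrableOn_compact isCompact_Icc).mono_set
      Set.Ioc_subset_Icc_self
  have hS : MeasurableSet {q : ℝ × ℝ | q.1 * q.2 ≤ x} :=
    measurableSet_le (measurable_fst.mul measurable_snd) measurable_const
  -- The density of the pair (tangent, size) restricted to `ty ≤ x`. Integrating over `y` first
  -- gives the left-hand integrand; integrating over `t` first gives `polyW` at `min (splitTan n) (x
  -- / y)`, and the minimum changes branch at `y = x / splitTan n`.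
  let F : ℝ → ℝ → ℝ := fun t y =>
    {q : ℝ × ℝ | q.1 * q.2 ≤ x}.indicator (fun q => polyw α n a q.1 * gPdf N q.2) (t, y)
  have hF : Integrable (fun q : ℝ × ℝ => F q.1 q.2)
      ((volume.restrict (Set.Ioc 0 (splitTan n))).prod (volume.restrict (Set.Ioi 0))) :=
    (Integrable.mul_prod hw (integrableOn_gPdf hN)).indicator hS
  have h1 : ∀ t ∈ Set.Ioc 0 (splitTan n), ∫ y in Set.Ioi 0, F t y =
      gCdf N (x / t) * polyw α n a t := fun t ht => by
    have h2 : ∀ y, F t y = (Set.Iic (x / t)).indicator (fun y => polyw α n a t * gPdf N y) y :=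
      fun y => by
        have hiff : y ≤ x / t ↔ t * y ≤ x := by rw [le_div_iff₀ ht.1, mul_comm]
        by_cases h : t * y ≤ x
        · simp only [F]
          rw [Set.indicator_of_mem (s := {q : ℝ × ℝ | q.1 * q.2 ≤ x}) (by exact h),
            Set.indicator_of_mem (s := Set.Iic _) (hiff.2 h)]
        · simp only [F]
          rw [Set.indicator_of_notMem (s := {q : ℝ × ℝ | q.1 * q.2 ≤ x}) (by exact h),
            Set.indicator_of_notMem (s := Set.Iic _) (fun h' => h (hiff.1 h'))]
    simp_rw [h2]
    rw [setIntegral_indicator measurableSet_Iic, Set.Ioi_inter_Iic, integral_const_mul,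
      ← gCdf_eq_setIntegral N (div_nonneg hx ht.1.le), mul_comm]
  have h3 : ∀ y ∈ Set.Ioi (0 : ℝ), ∫ t in Set.Ioc 0 (splitTan n), F t y =
      gPdf N y * polyW α n a (min (splitTan n) (x / y)) := fun y hy => by
    have hy : 0 < y := hy
    have h2 : ∀ t, F t y = (Set.Iic (x / y)).indicator (fun t => gPdf N y * polyw α n a t) t :=
      fun t => by
        have hiff : t ≤ x / y ↔ t * y ≤ x := le_div_iff₀ hy
        by_cases h : t * y ≤ x
        · simp only [F]
          rw [Set.indicator_of_mem (s := {q : ℝ × ℝ | q.1 * q.2 ≤ x}) (by exact h),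
            Set.indicator_of_mem (s := Set.Iic _) (hiff.2 h), mul_comm]
        · simp only [F]
          rw [Set.indicator_of_notMem (s := {q : ℝ × ℝ | q.1 * q.2 ≤ x}) (by exact h),
            Set.indicator_of_notMem (s := Set.Iic _) (fun h' => h (hiff.1 h'))]
    simp_rw [h2]
    rw [setIntegral_indicator measurableSet_Iic, Set.Ioc_inter_Iic, integral_const_mul,
      ← intervalIntegral.integral_of_le (le_min h0.le (div_nonneg hx hy.le)), integral_polyw hn]
  have hI : IntegrableOn (fun y => gPdf N y * polyW α n a (min (splitTan n) (x / y)))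
      (Set.Ioi 0) := by
    refine (integrableOn_congr_fun (fun y hy => ?_) measurableSet_Ioi).1 hF.integral_prod_right
    exact h3 y hy
  have h4 : ∀ y ∈ Set.Ioi (x / splitTan n), gPdf N y * polyW α n a (min (splitTan n) (x / y)) =
      gPdf N y * polyW α n a (x / y) := fun y hy => by
    have hy : x / splitTan n < y := hy
    have hy0 : 0 < y := hx0.trans_lt hy
    rw [min_eq_right]
    rw [div_lt_iff₀ h0] at hy
    rw [div_le_iff₀ hy0, mul_comm]
    exact hy.le
  have h5 : ∀ y ∈ Set.Ioc 0 (x / splitTan n),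
      gPdf N y * polyW α n a (min (splitTan n) (x / y)) =
      polyW α n a (splitTan n) * gPdf N y := fun y hy => by
    have hy' := hy.2
    rw [min_eq_left, mul_comm]
    rw [le_div_iff₀ h0] at hy'
    rw [le_div_iff₀ hy.1, mul_comm]
    exact hy'
  refine ⟨(integrableOn_congr_fun h4 measurableSet_Ioi).1
    (hI.mono_set (Set.Ioi_subset_Ioi hx0)), ?_⟩
  rw [intervalIntegral.integral_of_le h0.le, ← setIntegral_congr_fun measurableSet_Ioc h1,
    integral_integral_swap hF, setIntegral_congr_fun measurableSet_Ioi h3,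
    ← Set.Ioc_union_Ioi_eq_Ioi hx0, setIntegral_union
      (Set.Ioc_disjoint_Ioi le_rfl) measurableSet_Ioi
      (hI.mono_set Set.Ioc_subset_Ioi_self) (hI.mono_set (Set.Ioi_subset_Ioi hx0)),
    setIntegral_congr_fun measurableSet_Ioi h4, setIntegral_congr_fun measurableSet_Ioc h5,
    integral_const_mul, gCdf_eq_setIntegral N hx0]

end Lower

/-! ### Incomplete beta integrals -/

/-- `t²/(1+t²)` is the squared sine of the angle with tangent `t`; at `t² = 1/(n-1)` it equals
`1/n`. -/
lemma image_sq_div_one_add_sq {n : ℕ} (hn : 2 ≤ n) :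
    (fun t : ℝ => t ^ 2 / (1 + t ^ 2)) '' Set.Ioo 0 (splitTan n) = Set.Ioo 0 (1 / (n : ℝ)) := by
  have h2 : (2 : ℝ) ≤ n := by exact_mod_cast hn
  have h0 := splitTan_pos hn
  have hsq := splitTan_sq hn
  ext x
  constructor
  · rintro ⟨t, ht, rfl⟩
    have h1 : t ^ 2 < 1 / ((n : ℝ) - 1) := by
      rw [← hsq]
      exact pow_lt_pow_left₀ ht.2 ht.1.le two_ne_zero
    have h3 := pow_pos ht.1 2
    refine ⟨by positivity, ?_⟩
    rw [lt_div_iff₀ (by linarith)] at h1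
    rw [div_lt_div_iff₀ (by positivity) (by linarith)]
    linarith
  · rintro ⟨hx0, hx1⟩
    rw [lt_div_iff₀ (by linarith)] at hx1
    have h1 : 0 < 1 - x := by nlinarith
    refine ⟨Real.sqrt (x / (1 - x)), ⟨Real.sqrt_pos.2 (by positivity), ?_⟩, ?_⟩
    · rw [Real.sqrt_lt' h0, hsq, div_lt_div_iff₀ h1 (by linarith)]
      linarith
    · simp only
      rw [Real.sq_sqrt (by positivity)]
      field_simp
      ring

/-- The substitution `x = t²/(1+t²)`, with `1 - x = 1/(1+t²)`, turns the integral into an incomplete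
beta integral. -/
lemma integral_cos_pow_mul_pow {α n : ℕ} (hn : 2 ≤ n) (k j : ℕ) :
    ∫ t in (0 : ℝ)..splitTan n, (Real.sqrt (1 + t ^ 2))⁻¹ ^ (α * n + k) * t ^ (n - 2 + 2 * j) =
      1 / 2 * incBeta (((n : ℝ) - 1) / 2 + j) ((((α : ℝ) - 1) * n + k + 1) / 2 - j) (1 / n) := by
  have h2 : (2 : ℝ) ≤ n := by exact_mod_cast hn
  have h0 := splitTan_pos hn
  rw [incBeta, intervalIntegral.integral_of_le h0.le, intervalIntegral.integral_of_le
    (by positivity),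
    integral_Ioc_eq_integral_Ioo, integral_Ioc_eq_integral_Ioo, ← image_sq_div_one_add_sq hn]
  have hd : ∀ t ∈ Set.Ioo 0 (splitTan n), HasDerivWithinAt (fun t : ℝ => t ^ 2 / (1 + t ^ 2))
      (2 * t / (1 + t ^ 2) ^ 2) (Set.Ioo 0 (splitTan n)) t := fun t _ => by
    have h3 : (1 + t ^ 2) ≠ 0 := by positivity
    have h := ((hasDerivAt_pow 2 t).div ((hasDerivAt_pow 2 t).const_add 1) h3)
    refine (h.congr_deriv ?_).hasDerivWithinAt
    push_cast
    ring
  have hinj : Set.InjOn (fun t : ℝ => t ^ 2 / (1 + t ^ 2)) (Set.Ioo 0 (splitTan n)) :=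
    fun s hs t ht hst => by
      simp only at hst
      rw [div_eq_div_iff (by positivity) (by positivity)] at hst
      exact (pow_left_inj₀ hs.1.le ht.1.le two_ne_zero).1 (by linarith)
  rw [integral_image_eq_integral_abs_deriv_smul measurableSet_Ioo hd hinj, ← integral_const_mul]
  refine setIntegral_congr_fun measurableSet_Ioo fun t ht => ?_
  have ht0 := ht.1
  have hD : 0 < 1 + t ^ 2 := by positivity
  simp only [smul_eq_mul]
  rw [abs_of_pos (by positivity), show 1 - t ^ 2 / (1 + t ^ 2) = (1 + t ^ 2)⁻¹ by field_simp; ring,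
    Real.div_rpow (by positivity) hD.le, Real.inv_rpow hD.le, ← Real.rpow_natCast t 2,
    ← Real.rpow_mul ht0.le, inv_pow, Real.sqrt_eq_rpow, ← Real.rpow_natCast (_ ^ (1 / 2 : ℝ)),
    ← Real.rpow_mul (by positivity), ← Real.rpow_natCast t (n - 2 + 2 * j)]
  set D := 1 + t ^ ((2 : ℕ) : ℝ) with hDdef
  have hD : 0 < D := by positivity
  have e1 : t ^ (((n - 2 + 2 * j : ℕ) : ℝ)) =
      t * t ^ (((2 : ℕ) : ℝ) * (((n : ℝ) - 1) / 2 + j - 1)) := by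
    have h3 := Real.rpow_add ht0 1 (((2 : ℕ) : ℝ) * (((n : ℝ) - 1) / 2 + j - 1))
    rw [Real.rpow_one] at h3
    rw [← h3]
    congr 1
    push_cast [Nat.cast_sub hn]
    ring
  have e2 : D ^ (1 / 2 * ((α * n + k : ℕ) : ℝ)) = D ^ 2 * (D ^ (((n : ℝ) - 1) / 2 + j - 1) *
      D ^ ((((α : ℝ) - 1) * n + k + 1) / 2 - j - 1)) := by
    rw [← Real.rpow_natCast D 2, ← Real.rpow_add hD, ← Real.rpow_add hD]
    congr 1
    push_cast
    ring
  rw [e1, e2]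
  have h3 := Real.rpow_pos_of_pos hD (((n : ℝ) - 1) / 2 + j - 1)
  have h4 := Real.rpow_pos_of_pos hD ((((α : ℝ) - 1) * n + k + 1) / 2 - j - 1)
  field_simp

section

variable {α n : ℕ} {a : Fin (degBound α n + 1) → ℝ} {κ : Measure ℝ} [IsProbabilityMeasure κ]

lemma IsAngleLaw.upper_cosMoment (h : IsAngleLaw α n a κ) (hn : 2 ≤ n) (k : ℕ) :
    ∫ θ in Set.Ici (splitAngle n), Real.cos θ ^ (α * n + k) ∂κ =
      ∫ θ, Real.cos θ ^ (α * n + k) ∂κ - normConst α n * (1 / 2) *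
        ∑ j : Fin (degBound α n + 1), a j * incBeta (((n : ℝ) - 1) / 2 + (j : ℕ))
          ((((α : ℝ) - 1) * n + k + 1) / 2 - (j : ℕ)) (1 / (n : ℝ)) := by
  have hint : Integrable (fun θ => Real.cos θ ^ (α * n + k)) κ := by
    refine Integrable.of_bound (by fun_prop) 1 (ae_of_all _ fun θ => ?_)
    rw [norm_pow]
    exact pow_le_one₀ (norm_nonneg _) (Real.abs_cos_le_one θ)
  have hg : Measurable fun t : ℝ => (Real.sqrt (1 + t ^ 2))⁻¹ ^ (α * n + k) := by fun_prop
  rw [h.integral_split hn hint, add_sub_assoc, left_eq_add, sub_eq_zero]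
  -- On `(0, π/2)` the cosine is a function of the tangent, so the lower part can be integrated
  -- against the polynomial density.
  have h1 : ∫ θ in {θ | Real.tan θ ≤ splitTan n}, Real.cos θ ^ (α * n + k) ∂κ =
      ∫ θ in {θ | Real.tan θ ≤ splitTan n},
        (Real.sqrt (1 + Real.tan θ ^ 2))⁻¹ ^ (α * n + k) ∂κ := by
    refine integral_congr_ae (ae_restrict_of_ae ?_)
    filter_upwards [h.ae_mem_Ioo hn] with θ hθ
    rw [Real.inv_sqrt_one_add_tan_sq
      (Real.cos_pos_of_mem_Ioo ⟨by linarith [hθ.1, Real.pi_pos], hθ.2⟩)]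
  rw [h1, h.integral_lower hn hg]
  have h2 : ∀ t : ℝ, (Real.sqrt (1 + t ^ 2))⁻¹ ^ (α * n + k) * polyw α n a t =
      ∑ j : Fin (degBound α n + 1), normConst α n * a j *
        ((Real.sqrt (1 + t ^ 2))⁻¹ ^ (α * n + k) * t ^ (n - 2 + 2 * (j : ℕ))) := fun t => by
    rw [polyw, Finset.mul_sum, Finset.mul_sum]
    refine Finset.sum_congr rfl fun j _ => ?_
    ring
  simp_rw [h2]
  have hcont : Continuous fun t : ℝ => (Real.sqrt (1 + t ^ 2))⁻¹ := by
    refine Continuous.inv₀ (by fun_prop) fun t => ?_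
    exact (Real.sqrt_pos.2 (by positivity)).ne'
  rw [intervalIntegral.integral_finsetSum fun j _ => Continuous.intervalIntegrable
    (by fun_prop) _ _,
    Finset.mul_sum]
  refine Finset.sum_congr rfl fun j _ => ?_
  rw [intervalIntegral.integral_const_mul, integral_cos_pow_mul_pow hn]
  ring

end

/-! ### Exponential samples -/

section Exponential

variable {n : ℕ} {a : Fin (degBound 1 n + 1) → ℝ}

lemma expWeight_pos (hn : 2 ≤ n) : 0 < expWeight n := by
  have h2 : (2 : ℝ) ≤ n := by exact_mod_cast hn
  have h1 : (0 : ℝ) < n - 1 := by linarith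
  have hG : 0 < Real.Gamma (((n - 1 : ℕ) : ℝ) / 2 + 1) := Real.Gamma_pos_of_pos (by positivity)
  have hf : (0 : ℝ) < ((n - 1)! : ℝ) := by exact_mod_cast Nat.factorial_pos _
  rw [expWeight, ballVol]
  have := Real.pi_pos
  positivity

/-- For exponential samples the polynomial is a monomial. -/
lemma polyW_one (hn : 2 ≤ n) (ha : IsCoeff 1 n a) (s : ℝ) :
    polyW 1 n a (splitTan n * s) = expWeight n * s ^ (n - 1) := by
  have h2 : (2 : ℝ) ≤ n := by exact_mod_cast hn
  -- For `α = 1` the degree bound is zero: one unknown and one equation, from which `a 0 = 2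
  -- √π^(n-1) / Γ((n-1)/2)`.
  have hsub : Subsingleton (Fin (degBound 1 n + 1)) := by
    simp only [degBound, Nat.sub_self, Nat.zero_mul, Nat.zero_div, zero_add]
    infer_instance
  have h0 := ha 0 (Nat.zero_le _)
  rw [Fintype.sum_subsingleton _ 0, coeffRhs, if_pos odd_one, Finset.piAntidiag_zero] at h0
  simp only [Finset.sum_singleton, Pi.zero_apply, Nat.reduceDiv, Fin.val_zero, Nat.cast_zero,
    mul_zero, zero_mul, add_zero, sub_zero, Nat.factorial_zero, Nat.cast_one, div_one, pow_zero,
    mul_one, Finset.prod_const, Finset.card_univ, Fintype.card_fin, Real.Gamma_one_half_eq] at h0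
  rw [polyW, Fintype.sum_subsingleton _ 0, normConst_eq, expWeight, ballVol]
  obtain ⟨d, rfl⟩ : ∃ d, n = d + 1 := ⟨n - 1, by omega⟩
  have hd : (1 : ℝ) ≤ d := by push_cast at h2; linarith
  have hpi := Real.pi_pos
  have hG : Real.Gamma (((d : ℕ) : ℝ) / 2 + 1) = d / 2 * Real.Gamma (d / 2) :=
    Real.Gamma_add_one (by positivity)
  have e1 : Real.pi ^ ((d : ℝ) / 2) = Real.sqrt Real.pi ^ d := by
    rw [Real.sqrt_eq_rpow, ← Real.rpow_natCast (_ ^ (1 / 2 : ℝ)), ← Real.rpow_mul hpi.le]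
    congr 1
    ring
  have e2 : (((d : ℝ) + 1) * d) ^ ((d : ℝ) / 2) = Real.sqrt (d + 1) ^ d * Real.sqrt d ^ d := by
    rw [← mul_pow, ← Real.sqrt_mul (by positivity), Real.sqrt_eq_rpow,
      ← Real.rpow_natCast (_ ^ (1 / 2 : ℝ)), ← Real.rpow_mul (by positivity)]
    congr 1
    ring
  simp only [Nat.add_sub_cancel, Nat.cast_add, Nat.cast_one, add_sub_cancel_right, Fin.val_zero,
    mul_zero, add_zero, one_mul, Real.Gamma_one, one_pow, hG, e1, e2, Nat.cast_zero, splitTan,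
    Real.Gamma_nat_eq_factorial] at h0 ⊢
  have hg : 0 < Real.Gamma ((d : ℝ) / 2) := Real.Gamma_pos_of_pos (by positivity)
  have hsd : 0 < Real.sqrt d := Real.sqrt_pos.2 (by linarith)
  have hsd' : 0 < Real.sqrt ((d : ℝ) + 1) := Real.sqrt_pos.2 (by linarith)
  have hsp := Real.sqrt_pos.2 hpi
  have ha0 : a 0 = 2 * Real.sqrt Real.pi ^ d / Real.Gamma ((d : ℝ) / 2) := by
    rw [eq_div_iff hg.ne']
    rw [pow_succ] at h0
    exact mul_left_cancel₀ hsp.ne' (by linarith)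
  rw [ha0, mul_pow, div_pow, one_pow, pow_succ]
  field_simp

/-- The monomial of degree `n - 1` cancels the power of `x` in `g_n`, leaving a constant times
`exp(-x)`. Its tail integral is the difference of `G_{n-1}` and `G_n` in `gCdf_succ_add`, up to the
factor `expWeight n`. -/
lemma exponential_remainder (hn : 2 ≤ n) (ha : IsCoeff 1 n a) {y : ℝ} (hy : 0 ≤ y) :
    polyW 1 n a (splitTan n) * gCdf n y +
      ∫ x in Set.Ioi y, gPdf n x * polyW 1 n a (splitTan n * y / x) =
        expWeight n * gCdf ((n - 1 : ℕ) : ℝ) y := by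
  have h1 : polyW 1 n a (splitTan n) = expWeight n := by
    have := polyW_one hn ha 1
    rwa [mul_one, one_pow, mul_one] at this
  have h2 : ∀ x ∈ Set.Ioi y, gPdf n x * polyW 1 n a (splitTan n * y / x) =
      expWeight n * (y ^ (n - 1) / (n - 1)!) * Real.exp (-x) := fun x hx => by
    have hx0 : 0 < x := hy.trans_lt hx
    rw [mul_div_assoc, polyW_one hn ha, gPdf_natCast (by omega), div_pow]
    have hG : Real.Gamma n = ((n - 1)! : ℝ) := by
      rw [← Real.Gamma_nat_eq_factorial, Nat.cast_sub (by omega)]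
      simp
    have hf : ((n - 1)! : ℝ) ≠ 0 := by exact_mod_cast Nat.factorial_ne_zero _
    rw [hG]
    field_simp
  have h3 := gCdf_succ_add (show 1 ≤ n - 1 by omega) y
  rw [Nat.sub_add_cancel (by omega)] at h3
  rw [setIntegral_congr_fun measurableSet_Ioi h2, integral_const_mul, integral_exp_neg_Ioi, h1,
    ← h3]
  ring

end Exponential

/-! ### The law of the angle of a gamma sample -/

section Sample

variable {Ω : Type*} [MeasurableSpace Ω] {μ : Measure Ω} {α n : ℕ} {X : Fin n → Ω → ℝ}

/-- The law of the angle `Φ`. -/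
noncomputable def angleMeasure (α n : ℕ) : Measure ℝ := (sampleLaw α n).map diagAngle

lemma isProbabilityMeasure_angleMeasure (hα : 1 ≤ α) :
    IsProbabilityMeasure (angleMeasure α n) := by
  have := isProbabilityMeasure_sampleLaw (n := n) hα
  exact Measure.isProbabilityMeasure_map measurable_diagAngle.aemeasurable

lemma hasLaw_phi [IsProbabilityMeasure μ] (hlaw : ∀ i, HasLaw (X i) (gammaMeasure (α : ℝ) 1) μ)
    (hind : iIndepFun X μ) : HasLaw (phi X) (angleMeasure α n) μ := by
  rw [show phi X = fun ω => diagAngle fun i => X i ω from funext (phi_eq_diagAngle X)]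
  exact HasLaw.fun_comp ⟨measurable_diagAngle.aemeasurable, rfl⟩ (hind.hasLaw_pi hlaw)

lemma isAngleLaw_angleMeasure (hα : 1 ≤ α) (hn : 2 ≤ n) :
    IsAngleLaw α n (fun j => angleCoeff α (show n ≠ 0 by omega) j) (angleMeasure α n) := by
  have hn0 : 0 < n := by omega
  have hsum : ∀ x : Fin n → ℝ, (∀ i, 0 < x i) → 0 < ∑ i, x i := fun x hx =>
    Finset.sum_pos (fun i _ => hx i) ⟨⟨0, hn0⟩, Finset.mem_univ _⟩
  refine ⟨?_, ?_, fun t ht ht' => ?_⟩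
  · refine (ae_map_iff measurable_diagAngle.aemeasurable
      (measurableSet_Ico (a := (0 : ℝ)) (b := Real.pi / 2))).2 ?_
    filter_upwards [ae_sampleLaw_pos hα] with x hx
    exact ⟨diagAngle_nonneg x, diagAngle_lt (hsum x hx)⟩
  · refine (ae_map_iff measurable_diagAngle.aemeasurable (measurableSet_tan_le _)).2 ?_
    filter_upwards [ae_sampleLaw_pos hα] with x hx
    exact tan_diagAngle_le (fun i => (hx i).le) (hsum x hx)
  · rw [angleMeasure, map_measureReal_apply measurable_diagAngle (measurableSet_tan_le t)]
    exact sampleLaw_tan_le_eq_polyW hα hn ht ht'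

lemma measureReal_sampleStd_le [IsProbabilityMeasure μ] (hα : 1 ≤ α) (hn : 2 ≤ n)
    (hlaw : ∀ i, HasLaw (X i) (gammaMeasure (α : ℝ) 1) μ) (hind : iIndepFun X μ) {r : ℝ}
    (hr : 0 ≤ r) :
    μ.real {ω | Real.sqrt ((n : ℝ) - 1) * sampleStd X ω ≤ r} =
      ∫ θ, gCdf (α * n : ℕ) (r * Real.sqrt n * Real.cot θ) ∂(angleMeasure α n) := by
  have := isProbabilityMeasure_angleMeasure (n := n) hα
  have h1 := (hind.hasLaw_pi hlaw).measureReal_eq (p := fun x => Real.sqrt (devSq x) ≤ r)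
    (measurableSet_le measurable_devSq.sqrt measurable_const)
  simp_rw [sqrt_mul_sampleStd hn]
  rw [h1, sampleLaw_sqrt_devSq_le hα hn hr]
  have hN : 1 ≤ α * n := Nat.mul_pos hα (by omega)
  have h2 : ∫ x, gCdf (α * n : ℕ) |r * Real.sqrt n * (Real.tan (diagAngle x))⁻¹|
      ∂(sampleLaw α n) = ∫ θ, gCdf (α * n : ℕ) |r * Real.sqrt n * (Real.tan θ)⁻¹|
        ∂(angleMeasure α n) := by
    rw [angleMeasure, integral_map measurable_diagAngle.aemeasurable]
    exact ((continuous_gCdf hN).measurable.comp (measurable_norm.comp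
      (measurable_const.mul measurable_tan.inv))).aestronglyMeasurable
  rw [h2]
  refine integral_congr_ae ?_
  filter_upwards [(isAngleLaw_angleMeasure hα hn).ae_tan_pos hn] with θ hθ
  rw [abs_of_nonneg (by positivity), Real.tan_inv_eq_cot]

lemma truncExp_eq [IsProbabilityMeasure μ] (hlaw : ∀ i, HasLaw (X i) (gammaMeasure (α : ℝ) 1) μ)
    (hind : iIndepFun X μ) {f : ℝ → ℝ} (hf : Measurable f) :
    truncExp μ X f = ∫ θ in Set.Ici (splitAngle n), f θ ∂(angleMeasure α n) := by
  have h := hasLaw_phi hlaw hind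
  rw [← h.map_eq, setIntegral_map measurableSet_Ici hf.aestronglyMeasurable h.aemeasurable]
  rfl

lemma angleMeasure_upper_pos (hα : 1 ≤ α) (hn : 3 ≤ n) :
    0 < angleMeasure α n {θ | splitTan n < Real.tan θ} := by
  rw [angleMeasure, Measure.map_apply measurable_diagAngle
    (measurableSet_lt measurable_const measurable_tan)]
  exact sampleLaw_splitTan_lt_pos hα hn

end Sample

/-! ### The scale factor `√(n(n-1))` -/

section Scale

variable {n : ℕ}

lemma scale_mul_cot (hn : 2 ≤ n) (θ : ℝ) :
    (Real.sqrt ((n : ℝ) * ((n : ℝ) - 1)))⁻¹ * Real.sqrt n * Real.cot θ =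
      splitTan n * Real.cot θ := by
  have h2 : (2 : ℝ) ≤ n := by exact_mod_cast hn
  have h3 := Real.sqrt_pos.2 (show (0 : ℝ) < n by linarith)
  rw [Real.sqrt_mul (by linarith), splitTan]
  field_simp

lemma splitTan_mul_sqrt (hn : 2 ≤ n) :
    splitTan n * Real.sqrt ((n : ℝ) - 1) = 1 := by
  have h2 : (2 : ℝ) ≤ n := by exact_mod_cast hn
  have h3 := Real.sqrt_pos.2 (show (0 : ℝ) < n - 1 by linarith)
  rw [splitTan, one_div, inv_mul_cancel₀ h3.ne']

/-- The upper bound makes the mixture weights nonnegative; the positive lower bound makes their sum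
converge. -/
lemma IsUpperAngle.splitTan_mul_cot {θ : ℝ} (h : IsUpperAngle n θ) (hn : 2 ≤ n) :
    splitTan n ^ 2 ≤ splitTan n * Real.cot θ ∧ splitTan n * Real.cot θ ≤ 1 := by
  have h0 := splitTan_pos hn
  refine ⟨?_, ?_⟩
  · rw [sq]
    exact mul_le_mul_of_nonneg_left (h.le_cot hn) h0.le
  · rw [← splitTan_mul_sqrt hn]
    exact mul_le_mul_of_nonneg_left (h.cot_le hn) h0.le

lemma mul_sqrt_div_splitTan (hn : 2 ≤ n) (r : ℝ) :
    r * Real.sqrt n / splitTan n = r * Real.sqrt ((n : ℝ) * ((n : ℝ) - 1)) := by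
  have h2 : (2 : ℝ) ≤ n := by exact_mod_cast hn
  rw [Real.sqrt_mul (by linarith), splitTan, div_div_eq_mul_div, div_one, mul_assoc]

end Scale

/-- The integrand is nonnegative on the truncated range and strictly positive wherever the tangent
exceeds the splitting value. -/
lemma IsAngleLaw.delta_pos {α n : ℕ} {a : Fin (degBound α n + 1) → ℝ} {κ : Measure ℝ}
    [IsProbabilityMeasure κ] (h : IsAngleLaw α n a κ) (hn : 2 ≤ n)
    (hpos : 0 < κ {θ | splitTan n < Real.tan θ}) (N k : ℕ) :
    0 < ∫ θ in Set.Ici (splitAngle n), (splitTan n * Real.cot θ) ^ N *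
      (1 - splitTan n * Real.cot θ) ^ k ∂κ := by
  have h0 := splitTan_pos hn
  have hm : Measurable fun θ => (splitTan n * Real.cot θ) ^ N *
      (1 - splitTan n * Real.cot θ) ^ k := by
    have := measurable_cot
    fun_prop
  have hnn : 0 ≤ᵐ[κ.restrict (Set.Ici (splitAngle n))] fun θ => (splitTan n * Real.cot θ) ^ N *
      (1 - splitTan n * Real.cot θ) ^ k := by
    filter_upwards [h.ae_isUpperAngle hn] with θ hθ
    have h1 := hθ.splitTan_mul_cot hn
    exact mul_nonneg (pow_nonneg (by nlinarith) _) (pow_nonneg (by linarith) _)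
  have hint : IntegrableOn (fun θ => (splitTan n * Real.cot θ) ^ N *
      (1 - splitTan n * Real.cot θ) ^ k) (Set.Ici (splitAngle n)) κ := by
    refine Integrable.of_bound hm.aestronglyMeasurable 1 ?_
    filter_upwards [h.ae_isUpperAngle hn] with θ hθ
    have h1 := hθ.splitTan_mul_cot hn
    have h2 : 0 ≤ splitTan n * Real.cot θ := by nlinarith
    rw [norm_mul, norm_pow, norm_pow, Real.norm_of_nonneg h2,
      Real.norm_of_nonneg (sub_nonneg.2 h1.2)]
    exact mul_le_one₀ (pow_le_one₀ h2 h1.2) (by have := sub_nonneg.2 h1.2; positivity)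
      (pow_le_one₀ (sub_nonneg.2 h1.2) (by linarith))
  rw [setIntegral_pos_iff_support_of_nonneg_ae hnn hint]
  refine hpos.trans_le (measure_mono_ae ?_)
  filter_upwards [h.ae_mem_Ioo hn, h.ae_tan_pos hn] with θ h1 h2
  intro (h3 : splitTan n < Real.tan θ)
  have h4 : splitTan n * Real.cot θ < 1 := by
    rw [← Real.tan_inv_eq_cot, ← div_eq_mul_inv, div_lt_one h2]
    exact h3
  have h5 : 0 < splitTan n * Real.cot θ := by
    rw [← Real.tan_inv_eq_cot]
    positivity
  refine ⟨?_, (IsAngleLaw.splitAngle_le_iff h1).2 h3.le⟩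
  have h6 : 0 < 1 - splitTan n * Real.cot θ := by linarith
  exact (mul_pos (pow_pos h5 _) (pow_pos h6 _)).ne'

end GammaVariance

/-! ### The distribution of the sample standard deviation -/

theorem theorem4p2 {Ω : Type*} [MeasurableSpace Ω] (μ : Measure Ω) [IsProbabilityMeasure μ]
    (α n : ℕ) (hα : 1 ≤ α) (hn : 2 ≤ n) (X : Fin n → Ω → ℝ)
    (hlaw : ∀ i, HasLaw (X i) (gammaMeasure (α : ℝ) 1) μ) (hind : iIndepFun X μ) :
    ∃ a : Fin (degBound α n + 1) → ℝ,
      -- the coefficients are the unique solution of the linear equations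
      IsCoeff α n a ∧ (∀ b, IsCoeff α n b → b = a) ∧
      -- the polynomial is the distribution function of `tan Φ` on `[0, 1/√(n-1)]`,
      -- with the polynomial density
      (∀ t, 0 ≤ t → t ≤ splitTan n →
        μ.real {ω | Real.tan (phi X ω) ≤ t} = polyW α n a t ∧
        polyW α n a t = ∫ s in (0 : ℝ)..t, polyw α n a s) ∧
      -- the truncated moments of `cos Φ`
      (∀ k : ℕ, cosMomentBar α μ X k = cosMoment α μ X k -
        normConst α n * (1 / 2) * ∑ j : Fin (degBound α n + 1),
          a j * incBeta (((n : ℝ) - 1) / 2 + (j : ℕ))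
            ((((α : ℝ) - 1) * n + k + 1) / 2 - (j : ℕ)) (1 / (n : ℝ))) ∧
      -- the truncated moments of `cot Φ`
      (∀ k : ℕ, HasSum
        (fun j : ℕ => Ring.choose (((α : ℝ) * n + k) / 2 + j - 1) j *
          cosMomentBar α μ X (k + 2 * j))
        (cotMomentBar α μ X k)) ∧
      -- the three formulas for the distribution function of `√(n-1) S`
      (∀ r : ℝ, 0 ≤ r →
        (Summable (fun k : ℕ => (-1 : ℝ) ^ k * (cosMomentBar α μ X k / ((α : ℝ) * n + k)) *
            polyP (α * n) k (r * Real.sqrt n)) ∧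
          IntervalIntegrable (fun t => gCdf ((α : ℝ) * n) (r * Real.sqrt n / t) * polyw α n a t)
            volume 0 (splitTan n) ∧
          μ.real {ω | Real.sqrt ((n : ℝ) - 1) * sampleStd X ω ≤ r} =
            (r * Real.sqrt n) ^ (α * n) / Real.Gamma ((α : ℝ) * n) *
              (∑' k : ℕ, (-1 : ℝ) ^ k * (cosMomentBar α μ X k / ((α : ℝ) * n + k)) *
                polyP (α * n) k (r * Real.sqrt n)) +
            ∫ t in (0 : ℝ)..splitTan n,
              gCdf ((α : ℝ) * n) (r * Real.sqrt n / t) * polyw α n a t) ∧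
        (Summable (fun k : ℕ => cotMomentBar α μ X k / ((α : ℝ) * n + k) *
            ((-(r * Real.sqrt n)) ^ k / (k ! : ℝ))) ∧
          IntegrableOn (fun x => gPdf ((α : ℝ) * n) x * polyW α n a (r * Real.sqrt n / x))
            (Set.Ioi (r * Real.sqrt ((n : ℝ) * ((n : ℝ) - 1)))) ∧
          μ.real {ω | Real.sqrt ((n : ℝ) - 1) * sampleStd X ω ≤ r} =
            (r * Real.sqrt n) ^ (α * n) / Real.Gamma ((α : ℝ) * n) *
              (∑' k : ℕ, cotMomentBar α μ X k / ((α : ℝ) * n + k) *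
                ((-(r * Real.sqrt n)) ^ k / (k ! : ℝ))) +
            polyW α n a (splitTan n) *
              gCdf ((α : ℝ) * n) (r * Real.sqrt ((n : ℝ) * ((n : ℝ) - 1))) +
            ∫ x in Set.Ioi (r * Real.sqrt ((n : ℝ) * ((n : ℝ) - 1))),
              gPdf ((α : ℝ) * n) x * polyW α n a (r * Real.sqrt n / x)) ∧
        (∀ l : ℝ, 0 < l →
          HasSum (fun k : ℕ => deltaBar α μ X l k * ((α * n + k - 1).choose k : ℝ) *
              gCdf ((α : ℝ) * n + k) (l * r))
            ((r * Real.sqrt n) ^ (α * n) / Real.Gamma ((α : ℝ) * n) *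
              (∑' k : ℕ, cotMomentBar α μ X k / ((α : ℝ) * n + k) *
                ((-(r * Real.sqrt n)) ^ k / (k ! : ℝ)))))) ∧
      -- the choice `l = √(n(n-1))`: positive coefficients, of total mass `Pr {tan Φ > 1/√(n-1)}`
      (∀ k : ℕ, 0 ≤ deltaBar α μ X (Real.sqrt ((n : ℝ) * ((n : ℝ) - 1))) k) ∧
      (3 ≤ n → ∀ k : ℕ, 0 < deltaBar α μ X (Real.sqrt ((n : ℝ) * ((n : ℝ) - 1))) k) ∧
      HasSum (fun k : ℕ => deltaBar α μ X (Real.sqrt ((n : ℝ) * ((n : ℝ) - 1))) k *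
          ((α * n + k - 1).choose k : ℝ))
        (1 - polyW α n a (splitTan n)) ∧
      -- for `α = 1` this gives an exact probability mixture of gamma distribution functions
      (α = 1 →
        0 < expWeight n ∧
        HasSum (fun k : ℕ => deltaBar α μ X (Real.sqrt ((n : ℝ) * ((n : ℝ) - 1))) k *
            ((n + k - 1).choose k : ℝ))
          (1 - expWeight n) ∧
        ∀ r : ℝ, 0 ≤ r →
          HasSum (fun k : ℕ => deltaBar α μ X (Real.sqrt ((n : ℝ) * ((n : ℝ) - 1))) k *
              ((n + k - 1).choose k : ℝ) *
              gCdf ((n : ℝ) + k) (Real.sqrt ((n : ℝ) * ((n : ℝ) - 1)) * r))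
            (μ.real {ω | Real.sqrt ((n : ℝ) - 1) * sampleStd X ω ≤ r} -
              expWeight n *
                gCdf ((n : ℝ) - 1) (r * Real.sqrt ((n : ℝ) * ((n : ℝ) - 1))))) := by
  have hn0 : n ≠ 0 := by omega
  have hN : 1 ≤ α * n := Nat.mul_pos hα (by omega)
  have hNc : ((α * n : ℕ) : ℝ) = (α : ℝ) * n := Nat.cast_mul α n
  have hNk : ∀ k : ℕ, ((α * n + k : ℕ) : ℝ) = (α : ℝ) * n + k := fun k => by push_cast; ring
  have := isProbabilityMeasure_angleMeasure (n := n) hα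
  have h := isAngleLaw_angleMeasure hα hn
  have hco := isCoeff_angleCoeff hα hn
  have hφ := hasLaw_phi hlaw hind
  have hcot := measurable_cot
  have hν := h.ae_isUpperAngle hn
  set a : Fin (degBound α n + 1) → ℝ := fun j => angleCoeff α hn0 j with ha
  have hcosBar : ∀ k, cosMomentBar α μ X k =
      ∫ θ in Set.Ici (splitAngle n), Real.cos θ ^ (α * n + k) ∂(angleMeasure α n) :=
    fun k => truncExp_eq hlaw hind (by fun_prop)
  have hcotBar : ∀ k, cotMomentBar α μ X k =
      ∫ θ in Set.Ici (splitAngle n), Real.cot θ ^ (α * n + k) ∂(angleMeasure α n) :=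
    fun k => truncExp_eq hlaw hind (by fun_prop)
  have hcos : ∀ k, cosMoment α μ X k = ∫ θ, Real.cos θ ^ (α * n + k) ∂(angleMeasure α n) :=
    fun k => by
      rw [← hφ.map_eq, integral_map hφ.aemeasurable (by fun_prop)]
      rfl
  have hbound : ∀ l : ℝ, ∀ᵐ θ ∂(angleMeasure α n).restrict (Set.Ici (splitAngle n)),
      |l⁻¹ * Real.sqrt n * Real.cot θ| ≤ |l⁻¹ * Real.sqrt n| * Real.sqrt ((n : ℝ) - 1) :=
    fun l => hν.mono fun θ hθ => by
      rw [abs_mul, abs_of_pos hθ.cot_pos]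
      exact mul_le_mul_of_nonneg_left (hθ.cot_le hn) (abs_nonneg _)
  -- In this form the differences are the mixture weights with `u = l⁻¹ √n cot θ`.
  have hdelta : ∀ l k, deltaBar α μ X l k = ∫ θ in Set.Ici (splitAngle n),
      (l⁻¹ * Real.sqrt n * Real.cot θ) ^ (α * n) *
        (1 - l⁻¹ * Real.sqrt n * Real.cot θ) ^ k ∂(angleMeasure α n) := fun l k => by
    rw [← sum_alternating_moments (by fun_prop) (hbound l), deltaBar]
    refine Finset.sum_congr rfl fun i _ => ?_
    rw [scaledCotMomentBar, truncExp_eq hlaw hind (by fun_prop)]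
  have hcotSeries : ∀ r : ℝ, HasSum (fun k : ℕ => cotMomentBar α μ X k / ((α : ℝ) * n + k) *
      ((-(r * Real.sqrt n)) ^ k / (k ! : ℝ))) (upperKernel
        ((angleMeasure α n).restrict (Set.Ici (splitAngle n))) (α * n) (r * Real.sqrt n)) :=
    fun r => by
      simp_rw [hcotBar, ← hNc]
      exact hasSum_cotMoment_series hn hν hN _
  have hcosSeries : ∀ r : ℝ, HasSum (fun k : ℕ => (-1 : ℝ) ^ k *
      (cosMomentBar α μ X k / ((α : ℝ) * n + k)) * polyP (α * n) k (r * Real.sqrt n)) (upperKernel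
        ((angleMeasure α n).restrict (Set.Ici (splitAngle n))) (α * n) (r * Real.sqrt n)) :=
    fun r => by
      simp_rw [hcosBar, ← hNc]
      exact hasSum_cosMoment_series hn hν hN _
  have hcdf : ∀ r : ℝ, 0 ≤ r → μ.real {ω | Real.sqrt ((n : ℝ) - 1) * sampleStd X ω ≤ r} =
      (r * Real.sqrt n) ^ (α * n) / Real.Gamma ((α : ℝ) * n) * upperKernel
        ((angleMeasure α n).restrict (Set.Ici (splitAngle n))) (α * n) (r * Real.sqrt n) +
      ∫ t in (0 : ℝ)..splitTan n, gCdf ((α : ℝ) * n) (r * Real.sqrt n / t) * polyw α n a t :=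
    fun r hr => by
      rw [measureReal_sampleStd_le hα hn hlaw hind hr, h.integral_gCdf_cot hn hN (by positivity),
        hNc]
  have htail : ∀ r : ℝ, 0 ≤ r → IntegrableOn
      (fun x => gPdf ((α : ℝ) * n) x * polyW α n a (r * Real.sqrt n / x))
        (Set.Ioi (r * Real.sqrt ((n : ℝ) * ((n : ℝ) - 1)))) ∧
      ∫ t in (0 : ℝ)..splitTan n, gCdf ((α : ℝ) * n) (r * Real.sqrt n / t) * polyw α n a t =
        polyW α n a (splitTan n) *
          gCdf ((α : ℝ) * n) (r * Real.sqrt ((n : ℝ) * ((n : ℝ) - 1))) +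
        ∫ x in Set.Ioi (r * Real.sqrt ((n : ℝ) * ((n : ℝ) - 1))),
          gPdf ((α : ℝ) * n) x * polyW α n a (r * Real.sqrt n / x) := fun r hr => by
    have h1 := integral_gCdf_mul_polyw (α := α) (a := a) hn hN
      (x := r * Real.sqrt n) (by positivity)
    rwa [mul_sqrt_div_splitTan hn, hNc] at h1
  have hmix : ∀ r : ℝ, 0 ≤ r → ∀ l : ℝ, 0 < l →
      HasSum (fun k : ℕ => deltaBar α μ X l k * ((α * n + k - 1).choose k : ℝ) *
        gCdf ((α : ℝ) * n + k) (l * r))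
      ((r * Real.sqrt n) ^ (α * n) / Real.Gamma ((α : ℝ) * n) * upperKernel
        ((angleMeasure α n).restrict (Set.Ici (splitAngle n))) (α * n) (r * Real.sqrt n)) :=
    fun r hr l hl => by
      simp_rw [hdelta, ← hNk]
      rw [← hNc, mul_upperKernel hN]
      -- The scale cancels in `(l⁻¹ √n cot θ)(l r) = r √n cot θ`, so the sum does not depend on `l`.
      convert hasSum_delta_gCdf (by fun_prop) (hbound l) hN (mul_nonneg hl.le hr) using 4
      field_simp
  have hscale : ∀ k, deltaBar α μ X (Real.sqrt ((n : ℝ) * ((n : ℝ) - 1))) k =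
      ∫ θ in Set.Ici (splitAngle n), (splitTan n * Real.cot θ) ^ (α * n) *
        (1 - splitTan n * Real.cot θ) ^ k ∂(angleMeasure α n) := fun k => by
    simp_rw [hdelta, scale_mul_cot hn]
  have hmass : HasSum (fun k : ℕ => deltaBar α μ X (Real.sqrt ((n : ℝ) * ((n : ℝ) - 1))) k *
      ((α * n + k - 1).choose k : ℝ)) (1 - polyW α n a (splitTan n)) := by
    simp_rw [hscale]
    rw [← h.measureReal_upper hn]
    exact hasSum_delta_mass (by fun_prop) (pow_pos (splitTan_pos hn) 2)
      (hν.mono fun θ hθ => hθ.splitTan_mul_cot hn) hN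
  refine ⟨a, hco, fun b hb => hco.unique hn hb, fun t ht ht' => ⟨?_, (integral_polyw hn t).symm⟩,
    fun k => ?_, fun k => ?_, fun r hr => ⟨⟨(hcosSeries r).summable, ?_, ?_⟩,
      ⟨(hcotSeries r).summable, (htail r hr).1, ?_⟩, fun l hl => ?_⟩, fun k => ?_, fun hn3 k => ?_,
    hmass, ?_⟩
  · rw [hφ.measureReal_eq (p := fun θ => Real.tan θ ≤ t) (measurableSet_tan_le t)]
    exact h.tan_le t ht ht'
  · rw [hcosBar, hcos]
    exact h.upper_cosMoment hn k
  · simp_rw [hcosBar, hcotBar, ← hNk, ← add_assoc]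
    exact hasSum_cotMoment hn hν (α * n + k)
  · rw [← hNc]
    exact intervalIntegrable_gCdf_mul_polyw hn hN (by positivity)
  · rw [(hcosSeries r).tsum_eq]
    exact hcdf r hr
  · rw [(hcotSeries r).tsum_eq, hcdf r hr, (htail r hr).2, add_assoc]
  · rw [(hcotSeries r).tsum_eq]
    exact hmix r hr l hl
  · rw [hscale]
    refine integral_nonneg_of_ae (hν.mono fun θ hθ => ?_)
    have h1 := hθ.splitTan_mul_cot hn
    have h2 : 0 ≤ splitTan n * Real.cot θ := (sq_nonneg _).trans h1.1
    exact mul_nonneg (pow_nonneg h2 _) (pow_nonneg (sub_nonneg.2 h1.2) _)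
  · rw [hscale]
    exact h.delta_pos hn (angleMeasure_upper_pos hα hn3) _ _
  · rintro rfl
    have hW : polyW 1 n a (splitTan n) = expWeight n := by
      simpa using polyW_one hn hco 1
    refine ⟨expWeight_pos hn, ?_, fun r hr => ?_⟩
    · simpa only [hW, one_mul] using hmass
    · have h2 : (2 : ℝ) ≤ n := by exact_mod_cast hn
      have hl : 0 < Real.sqrt ((n : ℝ) * ((n : ℝ) - 1)) :=
        Real.sqrt_pos.2 (mul_pos (by linarith) (by linarith))
      have h3 := exponential_remainder hn hco (y := r * Real.sqrt ((n : ℝ) * ((n : ℝ) - 1)))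
        (by positivity)
      -- Here `y = r √n / splitTan n`, so the argument `splitTan n * y` is `r √n`, as in the tail
      -- integral.
      rw [← mul_sqrt_div_splitTan hn, mul_div_cancel₀ _ (splitTan_pos hn).ne',
        mul_sqrt_div_splitTan hn, Nat.cast_sub (by omega), Nat.cast_one] at h3
      have h4 := hcdf r hr
      rw [(htail r hr).2] at h4
      simp only [Nat.cast_one, one_mul] at h4
      rw [h3] at h4
      rw [h4, add_sub_cancel_right]
      simpa only [Nat.cast_one, one_mul] using hmix r hr _ hl
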